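/- An election consists of a finite set $C$ of candidates, a partition $\mathcal P=\{P_1,\dots,P_k\}$ of $C$ into non-empty parties, and a finite set $V$ of voters, each voter $v$ having a strict total preference order $\succ_v$ over $C$. A nomination scheme is a tuple $(c_1,\dots,c_k)$ with $c_i\in P_i$ for every $i$. Under Plurality, each voter votes for the nominee in $\{c_1,\dots,c_k\}$ that he or she prefers most; the score of a nominee is its number of votes, and the nominees with the highest score (and their parties) are the winners, so ties are allowed. A candidate $c_i'\in P_i\setminus\{c_i\}$ is a Nash deviation by $P_i$ for $(c_1,\dots,c_k)$ if $c_i$ is not a winner under $(c_1,\dots,c_k)$ but $c_i'$ is a winner under $(c_1,\dots,c_{i-1},c_i',c_{i+1},\dots,c_k)$. A (pure) Nash equilibrium is a nomination scheme that admits no Nash deviation. The preference profile is party-aligned single-peaked if there is a strict total order $\triangleleft_{\mathcal P}$ on $\mathcal P$ such that for every voter $v$ there is a strict total order $\triangleleft_v$ on $C$ with the following two properties: (i) for all $a,b,c\in C$ with $a\triangleleft_v b\triangleleft_v c$, $a\succ_v b$ implies $b\succ_v c$; (ii) for all candidates $a\in P_i$, $b\in P_j$ with $P_i\ne P_j$,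 $a\triangleleft_v b$ implies $P_i\triangleleft_{\mathcal P}P_j$. Theorem. The following two decision problems, with inputs restricted to elections whose preference profile is party-aligned single-peaked, are solvable in polynomial time, i.e. by a Turing machine whose number of steps on every such input is at most a polynomial in the length of the input. (The input lists the party of every candidate and the full preference list of every voter, with candidates and parties numbered and the numbers written in binary.) 1. Equilibrium Existence: given $(C,\mathcal P,V,(\succ_v)_{v\in V})$, does there exist a Nash equilibrium? 2. Equilibrium President: given $(C,\mathcal P,V,(\succ_v)_{v\in V})$ and a party $P\in\mathcal P$, does there exist a Nash equilibrium in which $P$ is a winner? -/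

import Mathlib

/-- Candidates `C` partitioned into parties (the fibres of `party`, all non-empty), and voters `V`,
each with a strict total preference order over `C`; `prefers v a b` is `a ≻_v b`. -/
structure Election (C P V : Type) where
  party : C → P
  party_surjective : Function.Surjective party
  prefers : V → C → C → Prop
  prefers_strictTotal : ∀ v, IsStrictTotalOrder C (prefers v)

namespace Election

variable {C P V : Type}

/-- A nomination scheme: party `p` nominates the candidate `c p`, one of its own. -/
def IsScheme (E : Election C P V) (c : P → C) : Prop :=
  ∀ p, E.party (c p) = p

/-- In the reduced election over the nominees `c`, voter `v` votes for the nominee of `p`. -/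
def VotesFor (E : Election C P V) (c : P → C) (v : V) (p : P) : Prop :=
  ∀ q, q ≠ p → E.prefers v (c p) (c q)

open Classical in
/-- Plurality score of the nominee of `p` under the scheme `c`. -/
noncomputable def score [Fintype V] (E : Election C P V) (c : P → C) (p : P) : ℕ :=
  (Finset.univ.filter fun v : V => E.VotesFor c v p).card

/-- The nominee of `p` is a winner (possibly tied) under the scheme `c`. -/
def IsWinner [Fintype V] (E : Election C P V) (c : P → C) (p : P) : Prop :=
  ∀ q, E.score c q ≤ E.score c p

/-- `c'` is a Nash deviation by the party `p` for the scheme `c`. -/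
def IsNashDeviation [DecidableEq P] [Fintype V] (E : Election C P V) (c : P → C)
    (p : P) (c' : C) : Prop :=
  E.party c' = p ∧ c' ≠ c p ∧ ¬ E.IsWinner c p ∧ E.IsWinner (Function.update c p c') p

/-- Pure Nash equilibria of the nomination game. -/
def IsNashEquilibrium [DecidableEq P] [Fintype V] (E : Election C P V) (c : P → C) : Prop :=
  E.IsScheme c ∧ ∀ p c', ¬ E.IsNashDeviation c p c'

/-- The preferences of `v` are single-peaked with respect to `axis`. -/
def IsSinglePeakedAt (E : Election C P V) (v : V) (axis : C → C → Prop) : Prop :=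
  ∀ a b c, axis a b → axis b c → E.prefers v a b → E.prefers v b c

/-- The axis over the candidates is compatible with the axis over the parties. -/
def IsCompatible (E : Election C P V) (axis : C → C → Prop) (partyAxis : P → P → Prop) : Prop :=
  ∀ a b, E.party a ≠ E.party b → axis a b → partyAxis (E.party a) (E.party b)

/-- Party-aligned single-peakedness of the preference profile. -/
def IsPartyAlignedSinglePeaked (E : Election C P V) : Prop :=
  ∃ partyAxis : P → P → Prop, IsStrictTotalOrder P partyAxis ∧
    ∀ v, ∃ axis : C → C → Prop, IsStrictTotalOrder C axis ∧
      E.IsSinglePeakedAt v axis ∧ E.IsCompatible axis partyAxis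

end Election

/-- An instance given explicitly: candidates, parties and voters are numbered from `0`, and
`ranking v r` is the candidate that `v` ranks at position `r`, position `0` being the best. -/
structure Instance where
  numCandidates : ℕ
  numParties : ℕ
  numVoters : ℕ
  party : Fin numCandidates → Fin numParties
  party_surjective : Function.Surjective party
  ranking : Fin numVoters → Equiv.Perm (Fin numCandidates)

namespace Instance

/-- The election described by an instance. -/
def election (I : Instance) :
    Election (Fin I.numCandidates) (Fin I.numParties) (Fin I.numVoters) where
  party := I.party
  party_surjective := I.party_surjective
  prefers v a b := (I.ranking v).symm a < (I.ranking v).symm b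
  prefers_strictTotal v :=
    { trichotomous := fun _ _ hab hba =>
        (I.ranking v).symm.injective (le_antisymm (not_lt.mp hba) (not_lt.mp hab))
      irrefl := fun _ => lt_irrefl _
      trans := fun _ _ _ => lt_trans }

end Instance

/-- The input alphabet. -/
inductive InputSymbol
  | bit (b : Bool)
  | comma
  | semicolon
  deriving DecidableEq, Fintype

/-- A list of numbers: each in binary and followed by a comma, with a final semicolon. -/
def encodeNatList (l : List ℕ) : List InputSymbol :=
  l.flatMap (fun x => (Computability.encodeNat x).map InputSymbol.bit ++ [InputSymbol.comma])
    ++ [InputSymbol.semicolon]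

/-- An instance as a word: the list of the parties of the candidates `0, 1, …`, followed by
the preference lists of the voters, each from best to worst. -/
def Instance.encode (I : Instance) : List InputSymbol :=
  encodeNatList (List.ofFn fun a => (I.party a : ℕ)) ++
    (List.ofFn fun v => encodeNatList (List.ofFn fun r => (I.ranking v r : ℕ))).flatten

/-- Instances whose preference profile is party-aligned single-peaked. -/
def PASPInstance : Type :=
  {I : Instance // I.election.IsPartyAlignedSinglePeaked}

/-- Party-aligned single-peaked instances with a distinguished party. -/
def PASPInstanceWithParty : Type :=
  Σ I : PASPInstance, Fin I.1.numParties

def PASPInstance.encode (I : PASPInstance) : List InputSymbol :=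
  I.1.encode

/-- The distinguished party is written in front of the instance. -/
def PASPInstanceWithParty.encode (J : PASPInstanceWithParty) : List InputSymbol :=
  encodeNatList [(J.2 : ℕ)] ++ J.1.encode

/-- Equilibrium Existence. -/
def EquilibriumExistence (I : PASPInstance) : Prop :=
  ∃ c, I.1.election.IsNashEquilibrium c

/-- Equilibrium President. -/
def EquilibriumPresident (J : PASPInstanceWithParty) : Prop :=
  ∃ c, J.1.1.election.IsNashEquilibrium c ∧ J.1.1.election.IsWinner c J.2

/-- The yes/no question `Q` about the inputs `a : α`, presented as the words `enc a`, is decided by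
a (multi-stack) Turing machine whose number of steps is bounded by a polynomial in the length of
the word. -/
def SolvableInPolyTime {α Γ : Type} (enc : α → List Γ) (Q : α → Prop) : Prop :=
  ∃ f : α → Bool, (∀ a, f a = true ↔ Q a) ∧
    Nonempty (Turing.TM2ComputableInPolyTime enc Computability.encodeBool f)

/-! Call a candidate `a` alive for a voter `v` if every other party has a candidate that `v` ranks
below `a`. A voter never votes for a nominee that is not alive, because some other party consists of
better candidates only. If `a` of party `p` is alive for `v`, it can lose the vote only to a nominee
`b` of a party `q` with `b ≻_v a`. Then no party lies between `p` and `q` on the party axis: it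
would have a candidate below `a`, hence a valley between `a` and `b` on the axis of `v`, against
single-peakedness (`Election.DependsOn.not_between`). So interactions join only consecutive parties,
the interaction graph is a disjoint union of paths (`Election.exists_layout`), and a score depends
only on the nominee and on the nominees of at most two adjacent parties
(`Election.Layout.score_eq`). The graph can be computed from the preferences alone, without knowing
any axis.

A deviation of `p` affects only the scores of `p` and its neighbours. It fails if and only if some
other party beats it. If this is a neighbour, five consecutive nominees suffice to see it. If it is
a party farther away, its score is unchanged, and the winner `w` does at least as well unless `w` is
adjacent to `p`. At most two parties are adjacent to `w`; for each of them one reference party, the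
best of those far from it, is enough. After guessing `w`, its score `m` and two reference parties
`x`, `y` with scores `k`, `l`, being an equilibrium won by `w` is a conjunction of conditions on
windows of five consecutive nominees (`Election.Layout.isNashEquilibrium_of_goodAt`,
`Election.Layout.exists_goodAt`). There are polynomially many guesses. For a fixed guess the paths
are independent, and dynamic programming over four consecutive nominees decides each of them
(`Election.exists_isNashEquilibrium_isWinner_iff`).

For the running time, every object above is a relation of fixed arity on the numbers below the input
length `n`, defined by a first-order formula with a comparison of cardinalities; the dynamic
programming is one such definition iterated `n` times. These relational programs compile to stack
programs whose only loop is "repeat `n` times" (`RelProg.represents_exec_compile`). The nesting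
depth is fixed by the program, so the time is a polynomial in `n`, and a stack program is simulated
instruction by instruction by a multi-stack Turing machine (`StackProg.stepsTo_machine`). -/

/-! ### Stack programs with bounded loops -/

/-- Programs on stacks indexed by `K` with symbols in `Γ`. The only loop construct repeats its body
`n` times, where `n` is a fixed number (the length of the input). -/
inductive StackProg (K Γ : Type)
  | skip
  | push (k : K) (a : Γ)
  | pop (k : K)
  | move (k j : K)
  | ite (k : K) (p : Option Γ → Bool) (c d : StackProg K Γ)
  | seq (c d : StackProg K Γ)
  | rep (c : StackProg K Γ)

/-- The auxiliary stacks of the machine executing a stack program. -/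
inductive AuxStack
  | ctl | cnt | aux | out
  deriving DecidableEq

instance : Fintype AuxStack :=
  ⟨{.ctl, .cnt, .aux, .out}, fun x => by cases x <;> simp⟩

/-- The control points of a bounded loop. -/
inductive LoopPoint
  | start | copy | restore | test
  deriving DecidableEq

instance : Fintype LoopPoint :=
  ⟨{.start, .copy, .restore, .test}, fun x => by cases x <;> simp⟩

/-- The control points of the machine outside its program. -/
inductive Phase
  | load | answer | clear
  deriving DecidableEq

instance : Fintype Phase :=
  ⟨{.load, .answer, .clear}, fun x => by cases x <;> simp⟩

/-- Reachability within a bounded number of steps. -/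
def StepsTo {α : Type*} (f : α → Option α) (t : ℕ) (a b : α) : Prop :=
  ∃ m ≤ t, (flip bind f)^[m] (some a) = some b

namespace StepsTo

variable {α : Type*} {f : α → Option α} {t t' : ℕ} {a b c : α}

theorem single (h : f a = some b) : StepsTo f 1 a b := ⟨1, le_rfl, by simp [flip, h]⟩

theorem trans (h : StepsTo f t a b) (h' : StepsTo f t' b c) : StepsTo f (t + t') a c := by
  obtain ⟨m, hm, e⟩ := h
  obtain ⟨m', hm', e'⟩ := h'
  refine ⟨m' + m, by omega, ?_⟩
  rw [Function.iterate_add_apply, e, e']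

theorem mono (h : StepsTo f t a b) (ht : t ≤ t') : StepsTo f t' a b := by
  obtain ⟨m, hm, e⟩ := h
  exact ⟨m, hm.trans ht, e⟩

theorem head (h : f a = some b) (h' : StepsTo f t b c) : StepsTo f (t + 1) a c :=
  ((single h).trans h').mono (by omega)

end StepsTo

namespace StackProg

variable {K Γ : Type}

section Semantics

variable [DecidableEq K]

/-- The effect of a program on the stacks, when loops are repeated `n` times. -/
def exec (n : ℕ) : StackProg K Γ → (K → List Γ) → (K → List Γ)
  | skip, s => s
  | push k a, s => Function.update s k (a :: s k)
  | pop k, s => Function.update s k (s k).tail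
  | move k j, s =>
    match s k with
    | [] => s
    | a :: l => Function.update (Function.update s k l) j (a :: Function.update s k l j)
  | ite k p c d, s => if p (s k).head? then exec n c s else exec n d s
  | seq c d, s => exec n d (exec n c s)
  | rep c, s => (exec n c)^[n] s

/-- A bound for the running time. -/
noncomputable def time : StackProg K Γ → Polynomial ℕ
  | skip => 1
  | push _ _ => 1
  | pop _ => 1
  | move _ _ => 1
  | ite _ _ c d => time c + time d + 1
  | seq c d => time c + time d
  | rep c => Polynomial.X * (time c + 1) + 2 * Polynomial.X + 4

end Semantics

/-- The control points of a program. -/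
def Label : StackProg K Γ → Type
  | skip => Unit
  | push _ _ => Unit
  | pop _ => Unit
  | move _ _ => Unit
  | ite _ _ c d => Option (Label c ⊕ Label d)
  | seq c d => Label c ⊕ Label d
  | rep c => LoopPoint ⊕ Label c

@[reducible]
def fintypeLabel : (c : StackProg K Γ) → Fintype (Label c)
  | skip => inferInstanceAs (Fintype Unit)
  | push _ _ => inferInstanceAs (Fintype Unit)
  | pop _ => inferInstanceAs (Fintype Unit)
  | move _ _ => inferInstanceAs (Fintype Unit)
  | ite _ _ c d =>
    letI := fintypeLabel c
    letI := fintypeLabel d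
    inferInstanceAs (Fintype (Option (Label c ⊕ Label d)))
  | seq c d =>
    letI := fintypeLabel c
    letI := fintypeLabel d
    inferInstanceAs (Fintype (Label c ⊕ Label d))
  | rep c =>
    letI := fintypeLabel c
    inferInstanceAs (Fintype (LoopPoint ⊕ Label c))

instance (c : StackProg K Γ) : Fintype (Label c) := fintypeLabel c

/-- The initial control point of a program. -/
def entry : (c : StackProg K Γ) → Label c
  | skip => ()
  | push _ _ => ()
  | pop _ => ()
  | move _ _ => ()
  | ite _ _ _ _ => (none : Option _)
  | seq c _ => Sum.inl (entry c)
  | rep _ => Sum.inl LoopPoint.start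

/-- The stack alphabets of the machine. -/
abbrev Alphabet (K Γ : Type) (k : K ⊕ AuxStack) : Type :=
  Sum.rec (motive := fun _ => Type) (fun _ => Γ) (fun _ => Bool) k

/-- The contents of all the stacks of the machine. -/
def allStacks (s : K → List Γ) (ctl cnt aux out : List Bool) :
    (k : K ⊕ AuxStack) → List (Alphabet K Γ k)
  | Sum.inl k => s k
  | Sum.inr AuxStack.ctl => ctl
  | Sum.inr AuxStack.cnt => cnt
  | Sum.inr AuxStack.aux => aux
  | Sum.inr AuxStack.out => out

section Update

variable (s : K → List Γ) (ctl cnt aux out l : List Bool)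

@[simp] theorem update_allStacks_inl [DecidableEq K] (k : K) (l : List Γ) :
    Function.update (allStacks s ctl cnt aux out) (Sum.inl k) l =
      allStacks (Function.update s k l) ctl cnt aux out := by
  funext j
  rcases j with j | j
  · by_cases h : j = k
    · subst h; simp [allStacks]
    · simp [allStacks, h]
  · cases j <;> simp [allStacks]

@[simp] theorem update_allStacks_ctl [DecidableEq K] :
    Function.update (allStacks s ctl cnt aux out) (Sum.inr AuxStack.ctl) l =
      allStacks s l cnt aux out := by
  funext j
  rcases j with j | j
  · simp [allStacks]
  · cases j <;> simp [allStacks]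

@[simp] theorem update_allStacks_cnt [DecidableEq K] :
    Function.update (allStacks s ctl cnt aux out) (Sum.inr AuxStack.cnt) l =
      allStacks s ctl l aux out := by
  funext j
  rcases j with j | j
  · simp [allStacks]
  · cases j <;> simp [allStacks]

@[simp] theorem update_allStacks_aux [DecidableEq K] :
    Function.update (allStacks s ctl cnt aux out) (Sum.inr AuxStack.aux) l =
      allStacks s ctl cnt l out := by
  funext j
  rcases j with j | j
  · simp [allStacks]
  · cases j <;> simp [allStacks]

@[simp] theorem update_allStacks_out [DecidableEq K] :
    Function.update (allStacks s ctl cnt aux out) (Sum.inr AuxStack.out) l =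
      allStacks s ctl cnt aux l := by
  funext j
  rcases j with j | j
  · simp [allStacks]
  · cases j <;> simp [allStacks]

@[simp] theorem allStacks_inl (k : K) : allStacks s ctl cnt aux out (Sum.inl k) = s k := rfl
@[simp] theorem allStacks_ctl : allStacks s ctl cnt aux out (Sum.inr AuxStack.ctl) = ctl := rfl
@[simp] theorem allStacks_cnt : allStacks s ctl cnt aux out (Sum.inr AuxStack.cnt) = cnt := rfl
@[simp] theorem allStacks_aux : allStacks s ctl cnt aux out (Sum.inr AuxStack.aux) = aux := rfl
@[simp] theorem allStacks_out : allStacks s ctl cnt aux out (Sum.inr AuxStack.out) = out := rfl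

end Update

/-- Statements of the machine. -/
abbrev MStmt (K Γ Λ : Type) := Turing.TM2.Stmt (Alphabet K Γ) Λ (Option Γ × Bool)

/-- Whether the symbol on top of a control stack is `true`. -/
def isTrue (a : Option Bool) : Bool := a == some true

open Turing.TM2.Stmt in
/-- The machine code of a program, whose control points are embedded by `e` into the labels of the
machine; control passes to `x` at the end. -/
def code [Inhabited Γ] {Λ : Type} (x : Λ) :
    (c : StackProg K Γ) → (Label c → Λ) → Label c → MStmt K Γ Λ
  | skip, _, _ => goto fun _ => x
  | push k a, _, _ => Turing.TM2.Stmt.push (Sum.inl k) (fun _ => a) (goto fun _ => x)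
  | pop k, _, _ => Turing.TM2.Stmt.pop (Sum.inl k) (fun v _ => v) (goto fun _ => x)
  | move k j, _, _ =>
    Turing.TM2.Stmt.pop (Sum.inl k) (fun v a => (a, v.2))
      (branch (fun v => v.1.isSome)
        (Turing.TM2.Stmt.push (Sum.inl j) (fun v => v.1.getD default) (goto fun _ => x))
        (goto fun _ => x))
  | ite k p c d, e, l =>
    match (l : Option (Label c ⊕ Label d)) with
    | none => peek (Sum.inl k) (fun v a => (a, v.2))
        (goto fun v => if p v.1 then e (some (Sum.inl (entry c))) else e (some (Sum.inr (entry d))))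
    | some (Sum.inl l) => code x c (fun i => e (some (Sum.inl i))) l
    | some (Sum.inr l) => code x d (fun i => e (some (Sum.inr i))) l
  | seq c d, e, l =>
    match (l : Label c ⊕ Label d) with
    | Sum.inl l => code (e (Sum.inr (entry d))) c (fun i => e (Sum.inl i)) l
    | Sum.inr l => code x d (fun i => e (Sum.inr i)) l
  | rep c, e, l =>
    match (l : LoopPoint ⊕ Label c) with
    | Sum.inl LoopPoint.start =>
      Turing.TM2.Stmt.push (Sum.inr AuxStack.ctl) (fun _ => false)
        (goto fun _ => e (Sum.inl LoopPoint.copy))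
    | Sum.inl LoopPoint.copy =>
      Turing.TM2.Stmt.pop (Sum.inr AuxStack.cnt) (fun v a => (v.1, a.isSome))
        (branch (fun v => v.2)
          (Turing.TM2.Stmt.push (Sum.inr AuxStack.aux) (fun _ => true)
            (Turing.TM2.Stmt.push (Sum.inr AuxStack.ctl) (fun _ => true)
              (goto fun _ => e (Sum.inl LoopPoint.copy))))
          (goto fun _ => e (Sum.inl LoopPoint.restore)))
    | Sum.inl LoopPoint.restore =>
      Turing.TM2.Stmt.pop (Sum.inr AuxStack.aux) (fun v a => (v.1, a.isSome))
        (branch (fun v => v.2)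
          (Turing.TM2.Stmt.push (Sum.inr AuxStack.cnt) (fun _ => true)
            (goto fun _ => e (Sum.inl LoopPoint.restore)))
          (goto fun _ => e (Sum.inl LoopPoint.test)))
    | Sum.inl LoopPoint.test =>
      Turing.TM2.Stmt.pop (Sum.inr AuxStack.ctl) (fun v a => (v.1, isTrue a))
        (branch (fun v => v.2)
          (goto fun _ => e (Sum.inr (entry c)))
          (goto fun _ => x))
    | Sum.inr l => code (e (Sum.inl LoopPoint.test)) c (fun i => e (Sum.inr i)) l

/-! ### Simulation of a program by its machine code, with time and height bounds -/

section Correctness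

variable [DecidableEq K]

/-- The embedding `e` and the exit `x` are arbitrary so that a subprogram can sit anywhere inside a
larger machine; this makes the induction over programs work. Between instructions `cnt` holds the
length in unary and `aux` is empty, while `ctl` carries the pending rounds of all enclosing loops
and must be preserved. -/
theorem stepsTo_code [Inhabited Γ] {Λ : Type} (n : ℕ) (M : Λ → MStmt K Γ Λ) (c : StackProg K Γ) :
    ∀ (x : Λ) (e : Label c → Λ), (∀ l, M (e l) = code x c e l) →
    ∀ (s : K → List Γ) (ctl : List Bool) (v : Option Γ × Bool), ∃ v',
      StepsTo (Turing.TM2.step M) (c.time.eval n)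
        ⟨some (e (entry c)), v, allStacks s ctl (List.replicate n true) [] []⟩
        ⟨some x, v', allStacks (exec n c s) ctl (List.replicate n true) [] []⟩ := by
  induction c with
  | skip =>
    intro x e h s ctl v
    refine ⟨v, ?_⟩
    rw [time, Polynomial.eval_one]
    exact StepsTo.single (by simp [h, code, exec])
  | push k a =>
    intro x e h s ctl v
    refine ⟨v, ?_⟩
    rw [time, Polynomial.eval_one]
    exact StepsTo.single (by simp [h, code, exec])
  | pop k =>
    intro x e h s ctl v
    refine ⟨v, ?_⟩
    rw [time, Polynomial.eval_one]
    exact StepsTo.single (by simp [h, code, exec])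
  | move k j =>
    intro x e h s ctl v
    refine ⟨((s k).head?, v.2), ?_⟩
    rw [time, Polynomial.eval_one]
    apply StepsTo.single
    rcases hk : s k with _ | ⟨a, l⟩
    · have : Function.update s k [] = s := by rw [← hk]; simp
      simp [h, code, exec, hk, this]
    · simp [h, code, exec, hk]
  | ite k p c d ihc ihd =>
    intro x e h s ctl v
    by_cases hp : p (s k).head?
    · obtain ⟨v', h'⟩ := ihc x (fun i => e (some (Sum.inl i))) (fun l => h _) s ctl
        ((s k).head?, v.2)
      rw [show exec n (ite k p c d) s = exec n c s by simp [exec, hp]]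
      refine ⟨v', (StepsTo.head ?_ h').mono ?_⟩
      rotate_left
      · simp only [time, Polynomial.eval_add, Polynomial.eval_one]; omega
      · change Turing.TM2.step M ⟨some (e none), _, _⟩ = _
        rw [Turing.TM2.step.eq_2, h (none : Option _)]
        simp [code, hp]
    · obtain ⟨v', h'⟩ := ihd x (fun i => e (some (Sum.inr i))) (fun l => h _) s ctl
        ((s k).head?, v.2)
      rw [show exec n (ite k p c d) s = exec n d s by simp [exec, hp]]
      refine ⟨v', (StepsTo.head ?_ h').mono ?_⟩
      rotate_left
      · simp only [time, Polynomial.eval_add, Polynomial.eval_one]; omega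
      · change Turing.TM2.step M ⟨some (e none), _, _⟩ = _
        rw [Turing.TM2.step.eq_2, h (none : Option _)]
        simp [code, hp]
  | seq c d ihc ihd =>
    intro x e h s ctl v
    obtain ⟨v', h'⟩ := ihc (e (Sum.inr (entry d))) (fun i => e (Sum.inl i)) (fun l => h _) s ctl v
    obtain ⟨v'', h''⟩ := ihd x (fun i => e (Sum.inr i)) (fun l => h _) (exec n c s) ctl v'
    refine ⟨v'', ?_⟩
    simp only [time, Polynomial.eval_add]
    exact h'.trans h''
  | rep c ih =>
    intro x e h s ctl v
    -- The length is copied to `ctl` above a `false` marker; this empties `cnt` into `aux`, from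
    -- which it is restored afterwards.
    have hcopy : ∀ i m v, ∃ v',
        StepsTo (Turing.TM2.step M) (i + 1)
          ⟨some (e (Sum.inl LoopPoint.copy)), v, allStacks s (List.replicate m true ++ false :: ctl)
            (List.replicate i true) (List.replicate m true) []⟩
          ⟨some (e (Sum.inl LoopPoint.restore)), v',
            allStacks s (List.replicate (i + m) true ++ false :: ctl) []
              (List.replicate (i + m) true) []⟩ := by
      intro i
      induction i with
      | zero =>
        intro m v
        refine ⟨(v.1, false), StepsTo.single ?_⟩
        rw [Turing.TM2.step.eq_2, h (Sum.inl LoopPoint.copy)]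
        simp [code]
      | succ i ihi =>
        intro m v
        obtain ⟨v', h'⟩ := ihi (m + 1) (v.1, true)
        rw [show i + (m + 1) = i + 1 + m by ring] at h'
        refine ⟨v', StepsTo.head ?_ h'⟩
        rw [Turing.TM2.step.eq_2, h (Sum.inl LoopPoint.copy)]
        simp [code, List.replicate_succ]
    have hrestore : ∀ i m v, ∃ v',
        StepsTo (Turing.TM2.step M) (i + 1)
          ⟨some (e (Sum.inl LoopPoint.restore)), v, allStacks s (List.replicate n true ++ false :: ctl)
            (List.replicate m true) (List.replicate i true) []⟩
          ⟨some (e (Sum.inl LoopPoint.test)), v',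
            allStacks s (List.replicate n true ++ false :: ctl)
              (List.replicate (i + m) true) [] []⟩ := by
      intro i
      induction i with
      | zero =>
        intro m v
        refine ⟨(v.1, false), StepsTo.single ?_⟩
        rw [Turing.TM2.step.eq_2, h (Sum.inl LoopPoint.restore)]
        simp [code]
      | succ i ihi =>
        intro m v
        obtain ⟨v', h'⟩ := ihi (m + 1) (v.1, true)
        rw [show i + (m + 1) = i + 1 + m by ring] at h'
        refine ⟨v', StepsTo.head ?_ h'⟩
        rw [Turing.TM2.step.eq_2, h (Sum.inl LoopPoint.restore)]
        simp [code, List.replicate_succ]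
    -- Each `true` on `ctl` pays for one round; the `false` below it ends this loop and uncovers the
    -- counter of the enclosing one.
    have hloop : ∀ i s v, ∃ v',
        StepsTo (Turing.TM2.step M) (i * (c.time.eval n + 1) + 1)
          ⟨some (e (Sum.inl LoopPoint.test)), v, allStacks s (List.replicate i true ++ false :: ctl)
            (List.replicate n true) [] []⟩
          ⟨some x, v', allStacks ((exec n c)^[i] s) ctl (List.replicate n true) [] []⟩ := by
      intro i
      induction i with
      | zero =>
        intro s v
        refine ⟨(v.1, false), (StepsTo.single ?_).mono (by omega)⟩
        rw [Turing.TM2.step.eq_2, h (Sum.inl LoopPoint.test)]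
        simp [code, isTrue]
      | succ i ihi =>
        intro s v
        obtain ⟨v', h'⟩ := ih (e (Sum.inl LoopPoint.test)) (fun i => e (Sum.inr i)) (fun l => h _) s
          (List.replicate i true ++ false :: ctl) (v.1, true)
        obtain ⟨v'', h''⟩ := ihi (exec n c s) v'
        refine ⟨v'', (StepsTo.head ?_ (h'.trans h'')).mono (by ring_nf; omega)⟩
        rw [Turing.TM2.step.eq_2, h (Sum.inl LoopPoint.test)]
        simp [code, isTrue, List.replicate_succ]
    obtain ⟨v₁, h₁⟩ := hcopy n 0 v
    obtain ⟨v₂, h₂⟩ := hrestore n 0 v₁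
    obtain ⟨v₃, h₃⟩ := hloop n s v₂
    refine ⟨v₃, (StepsTo.head ?_ ((h₁.trans h₂).trans h₃)).mono ?_⟩
    · change Turing.TM2.step M ⟨some (e (Sum.inl LoopPoint.start)), _, _⟩ = _
      rw [Turing.TM2.step.eq_2, h (Sum.inl LoopPoint.start)]
      simp [code]
    · simp only [time, Polynomial.eval_add, Polynomial.eval_mul, Polynomial.eval_one,
        Polynomial.eval_X, Polynomial.eval_ofNat]
      ring_nf; omega

/-- Each instruction pushes at most one symbol, so heights grow no faster than the time bound. This
limits the cost of clearing the stacks at the end. -/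
theorem length_exec_le (n : ℕ) (c : StackProg K Γ) :
    ∀ (b : ℕ) (s : K → List Γ), (∀ k, (s k).length ≤ b) →
      ∀ k, (exec n c s k).length ≤ b + c.time.eval n := by
  induction c with
  | skip => intro b s h k; simpa [exec] using (h k).trans (Nat.le_add_right _ _)
  | push j a =>
    intro b s h k
    simp only [exec, time, Polynomial.eval_one, Function.update_apply]
    have := h k
    split_ifs with hk
    · subst hk; simpa
    · omega
  | pop j =>
    intro b s h k
    simp only [exec, time, Polynomial.eval_one, Function.update_apply]
    have := h k
    split_ifs with hk
    · subst hk; simp; omega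
    · omega
  | move i j =>
    intro b s h k
    simp only [exec, time, Polynomial.eval_one]
    rcases hi : s i with _ | ⟨a, l⟩
    · exact (h k).trans (Nat.le_add_right _ _)
    · have h₁ := h k
      have h₂ := h i
      have h₃ := h j
      simp only [Function.update_apply]
      rw [hi] at h₂
      simp only [List.length_cons] at h₂
      split_ifs <;> simp <;> omega
  | ite j p c d ihc ihd =>
    intro b s h k
    have h₁ := ihc b s h k
    have h₂ := ihd b s h k
    simp only [exec, time, Polynomial.eval_one, Polynomial.eval_add]
    split_ifs <;> omega
  | seq c d ihc ihd =>
    intro b s h k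
    have := ihd _ _ (ihc b s h) k
    simp only [exec, time, Polynomial.eval_add]
    omega
  | rep c ih =>
    intro b s h k
    have : ∀ i k, ((exec n c)^[i] s k).length ≤ b + i * c.time.eval n := by
      intro i
      induction i with
      | zero => simpa using h
      | succ i ihi =>
        intro k
        rw [Function.iterate_succ_apply']
        have := ih _ _ ihi k
        rw [add_mul]; omega
    have := this n k
    simp only [exec, time, Polynomial.eval_add, Polynomial.eval_mul, Polynomial.eval_one,
        Polynomial.eval_X, Polynomial.eval_ofNat]
    rw [mul_add]; omega

end Correctness

/-! ### The complete machine: loading, running, answering, clearing -/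

section Machine

variable [DecidableEq K]

/-- Pop one symbol from each of the given stacks, remembering whether all were empty. -/
def popAll {Λ : Type} : List (K ⊕ AuxStack) → MStmt K Γ Λ → MStmt K Γ Λ
  | [], q => q
  | k :: ks, q => Turing.TM2.Stmt.pop k (fun v a => (v.1, v.2 || a.isSome)) (popAll ks q)

-- Distinctness is essential: a repeated stack would lose two symbols, and its second pop would
-- inspect contents that have already changed.
open Classical in
theorem stepAux_popAll {Λ : Type} (q : MStmt K Γ Λ) (ks : List (K ⊕ AuxStack)) :
    ∀ (_ : ks.Nodup) (v : Option Γ × Bool) (S : ∀ k, List (Alphabet K Γ k)),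
    Turing.TM2.stepAux (popAll ks q) v S =
      Turing.TM2.stepAux q (v.1, v.2 || ks.any fun k => !(S k).isEmpty)
        (fun k => if k ∈ ks then (S k).tail else S k) := by
  induction ks with
  | nil => intro _ v S; simp [popAll]
  | cons k ks ih =>
    intro hn v S
    rw [List.nodup_cons] at hn
    rw [popAll, Turing.TM2.stepAux.eq_3, ih hn.2]
    congr 1
    · have : (ks.any fun j => !(Function.update S k (S k).tail j).isEmpty) =
          ks.any fun j => !(S j).isEmpty := by
        rw [Bool.eq_iff_iff, List.any_eq_true, List.any_eq_true]
        refine exists_congr fun j => and_congr_right fun hj => ?_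
        rw [Function.update_of_ne]
        rintro rfl
        exact hn.1 hj
      rw [this, List.any_cons, Bool.or_assoc]
      congr 3
      rcases S k with _ | _ <;> rfl
    · funext j
      by_cases hj : j = k
      · subst hj; simp [hn.1]
      · simp [hj]

/-- The non-output stacks of the machine. -/
noncomputable def workStacks (K : Type) [DecidableEq K] [Fintype K] : List (K ⊕ AuxStack) :=
  (Finset.univ.erase (Sum.inr AuxStack.out)).toList

theorem mem_workStacks [Fintype K] (k : K ⊕ AuxStack) :
    k ∈ workStacks K ↔ k ≠ Sum.inr AuxStack.out := by
  simp [workStacks]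

open Turing.TM2.Stmt in
/-- The machine moves its input from the stack `src` to the stack `dst` (which reverses it) while
counting its length, runs the program, tests the top of the stack `res` and clears the stacks. -/
noncomputable def machineCode [Fintype K] [Inhabited Γ] (c : StackProg K Γ) (src dst res : K)
    (p : Option Γ → Bool) : Phase ⊕ Label c → MStmt K Γ (Phase ⊕ Label c)
  | Sum.inl Phase.load =>
    Turing.TM2.Stmt.pop (Sum.inl src) (fun v a => (a, v.2))
      (branch (fun v => v.1.isSome)
        (Turing.TM2.Stmt.push (Sum.inl dst) (fun v => v.1.getD default)
          (Turing.TM2.Stmt.push (Sum.inr AuxStack.cnt) (fun _ => true)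
            (goto fun _ => Sum.inl Phase.load)))
        (goto fun _ => Sum.inr (entry c)))
  | Sum.inl Phase.answer =>
    peek (Sum.inl res) (fun v a => (a, v.2))
      (Turing.TM2.Stmt.push (Sum.inr AuxStack.out) (fun v => p v.1)
        (goto fun _ => Sum.inl Phase.clear))
  | Sum.inl Phase.clear =>
    load (fun _ => (none, false)) (popAll (workStacks K)
      (branch (fun v => v.2) (goto fun _ => Sum.inl Phase.clear) halt))
  | Sum.inr l => code (Sum.inl Phase.answer) c Sum.inr l

/-- The machine as a bundled multi-stack Turing machine. -/
noncomputable def machine [Fintype K] [Inhabited Γ] [Fintype Γ] (c : StackProg K Γ)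
    (src dst res : K) (p : Option Γ → Bool) : Turing.FinTM2 where
  K := K ⊕ AuxStack
  k₀ := Sum.inl src
  k₁ := Sum.inr AuxStack.out
  Γ := Alphabet K Γ
  Λ := Phase ⊕ Label c
  main := Sum.inl Phase.load
  σ := Option Γ × Bool
  initialState := (none, false)
  Γk₀Fin := inferInstanceAs (Fintype Γ)
  m := machineCode c src dst res p

theorem initList_machine [Fintype K] [Inhabited Γ] [Fintype Γ] (c : StackProg K Γ)
    (src dst res : K) (p : Option Γ → Bool) (w : List Γ) :
    Turing.initList (machine c src dst res p) w =
      ⟨some (Sum.inl Phase.load), (none, false),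
        allStacks (Function.update (fun _ => []) src w) [] [] [] []⟩ := by
  unfold Turing.initList
  congr 1
  funext k
  by_cases h : k = Sum.inl src
  · subst h
    refine (dif_pos (show (Sum.inl src : K ⊕ AuxStack) = Sum.inl src from rfl)).trans ?_
    simp only [allStacks_inl, Function.update_self]
    rfl
  · refine (dif_neg h).trans ?_
    rcases k with k | k
    · simp only [allStacks_inl]
      rw [Function.update_of_ne fun e => h (congrArg Sum.inl e)]
      rfl
    · cases k <;> rfl

theorem haltList_machine [Fintype K] [Inhabited Γ] [Fintype Γ] (c : StackProg K Γ)
    (src dst res : K) (p : Option Γ → Bool) (w : List Bool) :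
    Turing.haltList (machine c src dst res p) w =
      ⟨none, (none, false), allStacks (fun _ => []) [] [] [] w⟩ := by
  unfold Turing.haltList
  congr 1
  funext k
  by_cases h : k = Sum.inr AuxStack.out
  · subst h
    exact dif_pos (show (Sum.inr AuxStack.out : K ⊕ AuxStack) = Sum.inr AuxStack.out from rfl)
  · refine (dif_neg h).trans ?_
    rcases k with k | k
    · rfl
    · cases k <;> first | rfl | exact absurd rfl h

/-- Each round shortens all non-empty stacks simultaneously, so the tallest one determines the
number of rounds. One more round finds everything empty and thereby halts with the register in its
initial state, as a halting configuration demands; hence `b + 1`. -/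
theorem stepsTo_clear [Fintype K] [Inhabited Γ] (c : StackProg K Γ)
    (src dst res : K) (p : Option Γ → Bool) (out : List Bool) (b : ℕ) :
    ∀ (s : K → List Γ) (ctl cnt aux : List Bool) (v : Option Γ × Bool),
      (∀ k, (s k).length ≤ b) → ctl.length ≤ b → cnt.length ≤ b → aux.length ≤ b →
      StepsTo (Turing.TM2.step (machineCode c src dst res p)) (b + 1)
        ⟨some (Sum.inl Phase.clear), v, allStacks s ctl cnt aux out⟩
        ⟨none, (none, false), allStacks (fun _ => []) [] [] [] out⟩ := by
  classical
  have key : ∀ (s : K → List Γ) (ctl cnt aux : List Bool) (v : Option Γ × Bool),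
      Turing.TM2.step (machineCode c src dst res p)
        ⟨some (Sum.inl Phase.clear), v, allStacks s ctl cnt aux out⟩ =
      some ⟨if ((∀ k, s k = []) ∧ ctl = [] ∧ cnt = [] ∧ aux = []) then none
        else some (Sum.inl Phase.clear),
        (none, !decide ((∀ k, s k = []) ∧ ctl = [] ∧ cnt = [] ∧ aux = [])),
        allStacks (fun k => (s k).tail) ctl.tail cnt.tail aux.tail out⟩ := by
    intro s ctl cnt aux v
    have hany : ((workStacks K).any fun k => !(allStacks s ctl cnt aux out k).isEmpty) =
        !decide ((∀ k, s k = []) ∧ ctl = [] ∧ cnt = [] ∧ aux = []) := by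
      rw [Bool.eq_iff_iff, List.any_eq_true]
      simp only [mem_workStacks, Bool.not_eq_true', decide_eq_false_iff_not]
      constructor
      · rintro ⟨k, hk, h⟩ ⟨h₁, h₂, h₃, h₄⟩
        rcases k with k | k
        · simp [h₁] at h
        · cases k <;> simp_all
      · intro h
        by_contra hc
        push Not at hc
        refine h ⟨fun k => ?_, ?_, ?_, ?_⟩
        · simpa using hc (Sum.inl k) (by simp)
        · simpa using hc (Sum.inr AuxStack.ctl) (by simp)
        · simpa using hc (Sum.inr AuxStack.cnt) (by simp)
        · simpa using hc (Sum.inr AuxStack.aux) (by simp)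
    have hstk : (fun k => if k ∈ workStacks K then (allStacks s ctl cnt aux out k).tail
        else allStacks s ctl cnt aux out k) =
        allStacks (fun k => (s k).tail) ctl.tail cnt.tail aux.tail out := by
      funext k
      rcases k with k | k
      · simp [mem_workStacks]
      · cases k <;> simp [mem_workStacks]
    rw [Turing.TM2.step.eq_2, machineCode, Turing.TM2.stepAux.eq_4,
      stepAux_popAll _ (workStacks K) (Finset.nodup_toList _), hany, hstk]
    by_cases h : (∀ k, s k = []) ∧ ctl = [] ∧ cnt = [] ∧ aux = []
    · simp [h]
    · simp only [h, if_false]; simp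
  induction b with
  | zero =>
    intro s ctl cnt aux v hs h₁ h₂ h₃
    simp only [Nat.le_zero, List.length_eq_zero_iff] at hs h₁ h₂ h₃
    apply StepsTo.single
    rw [key]
    simp [hs, h₁, h₂, h₃]
  | succ b ih =>
    intro s ctl cnt aux v hs h₁ h₂ h₃
    by_cases h : (∀ k, s k = []) ∧ ctl = [] ∧ cnt = [] ∧ aux = []
    · refine (StepsTo.single ?_).mono (show 1 ≤ b + 1 + 1 by omega)
      rw [key]
      obtain ⟨h₀, rfl, rfl, rfl⟩ := h
      simp [h₀]
    · refine StepsTo.head (b := ⟨some (Sum.inl Phase.clear), (none, true),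
        allStacks (fun k => (s k).tail) ctl.tail cnt.tail aux.tail out⟩) ?_ (ih _ _ _ _ _ ?_ ?_ ?_ ?_)
      · rw [key, if_neg h]; simp [h]
      · intro k; simpa using hs k
      · simpa using h₁
      · simpa using h₂
      · simpa using h₃

/-- Loading takes `w.length + 1` steps, the program `c.time`, the answer `1`, and clearing, by the
height bound, `w.length + c.time + 1`. -/
theorem stepsTo_machine [Fintype K] [Inhabited Γ] (c : StackProg K Γ)
    {src dst : K} (hsd : src ≠ dst) (res : K) (p : Option Γ → Bool) (w : List Γ) :
    StepsTo (Turing.TM2.step (machineCode c src dst res p))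
      ((2 * Polynomial.X + 2 * c.time + 3 : Polynomial ℕ).eval w.length)
      ⟨some (Sum.inl Phase.load), (none, false),
        allStacks (Function.update (fun _ => []) src w) [] [] [] []⟩
      ⟨none, (none, false), allStacks (fun _ => []) [] [] []
        [p (exec w.length c (Function.update (fun _ => []) dst w.reverse) res).head?]⟩ := by
  have hload : ∀ (w u : List Γ) (m : ℕ) (v : Option Γ × Bool), ∃ v',
      StepsTo (Turing.TM2.step (machineCode c src dst res p)) (w.length + 1)
        ⟨some (Sum.inl Phase.load), v,
          allStacks (Function.update (Function.update (fun _ => []) dst u) src w) []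
            (List.replicate m true) [] []⟩
        ⟨some (Sum.inr (entry c)), v', allStacks (Function.update (fun _ => []) dst
          (w.reverse ++ u)) [] (List.replicate (w.length + m) true) [] []⟩ := by
    intro w
    induction w with
    | nil =>
      intro u m v
      refine ⟨(none, v.2), StepsTo.single ?_⟩
      rw [Turing.TM2.step.eq_2, machineCode]
      have : Function.update (Function.update (fun _ => ([] : List Γ)) dst u) src [] =
          Function.update (fun _ => []) dst u := by
        rw [Function.update_eq_self_iff]
        simp [hsd]
      have hu : Function.update (fun _ => ([] : List Γ)) dst u src = [] := by simp [hsd]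
      simp [this, hu]
    | cons a w ih =>
      intro u m v
      obtain ⟨v', h'⟩ := ih (a :: u) (m + 1) (some a, v.2)
      rw [show w.length + (m + 1) = (a :: w).length + m by simp; omega,
        show w.reverse ++ a :: u = (a :: w).reverse ++ u by simp] at h'
      refine ⟨v', StepsTo.head ?_ h'⟩
      rw [Turing.TM2.step.eq_2, machineCode]
      have : Function.update (Function.update (Function.update (fun _ => ([] : List Γ)) dst u) src w)
          dst (a :: u) = Function.update (Function.update (fun _ => []) dst (a :: u)) src w := by
        rw [Function.update_comm hsd, Function.update_idem]
      simp [List.replicate_succ, hsd.symm, this]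
  obtain ⟨v₁, h₁⟩ := hload w [] 0 (none, false)
  rw [List.append_nil, add_zero] at h₁
  have hd : Function.update (Function.update (fun _ => ([] : List Γ)) dst []) src w =
      Function.update (fun _ => []) src w := by
    congr 1
    rw [Function.update_eq_self_iff]
  rw [hd] at h₁
  obtain ⟨v₂, h₂⟩ := stepsTo_code w.length (machineCode c src dst res p) c
    (Sum.inl Phase.answer) Sum.inr (fun _ => rfl) (Function.update (fun _ => []) dst w.reverse) [] v₁
  set s := exec w.length c (Function.update (fun _ => []) dst w.reverse) with hs
  have hlen : ∀ k, (s k).length ≤ w.length + c.time.eval w.length := by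
    apply length_exec_le
    intro k
    rw [Function.update_apply]
    split_ifs <;> simp
  have h₃ := stepsTo_clear c src dst res p [p (s res).head?] (w.length + c.time.eval w.length) s []
    (List.replicate w.length true) [] ((s res).head?, v₂.2) hlen (by simp) (by simp) (by simp)
  have h₄ : StepsTo (Turing.TM2.step (machineCode c src dst res p)) 1
      ⟨some (Sum.inl Phase.answer), v₂, allStacks s [] (List.replicate w.length true) [] []⟩
      ⟨some (Sum.inl Phase.clear), ((s res).head?, v₂.2),
        allStacks s [] (List.replicate w.length true) [] [p (s res).head?]⟩ := by
    apply StepsTo.single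
    simp [machineCode]
  refine (((h₁.trans h₂).trans h₄).trans h₃).mono ?_
  simp only [Polynomial.eval_add, Polynomial.eval_mul, Polynomial.eval_X, Polynomial.eval_ofNat]
  omega

end Machine

/-- A question is decidable in polynomial time if a stack program, started with the reversed input
on the stack `dst`, leaves the answer on top of the stack `res`. -/
theorem solvableInPolyTime [DecidableEq K] [Fintype K] [Inhabited Γ] [Fintype Γ] {α : Type}
    (enc : α → List Γ) (Q : α → Prop) (c : StackProg K Γ) {src dst : K} (hsd : src ≠ dst) (res : K)
    (p : Option Γ → Bool)
    (h : ∀ a, p (exec (enc a).length c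
      (Function.update (fun _ => []) dst (enc a).reverse) res).head? = true ↔ Q a) :
    SolvableInPolyTime enc Q := by
  classical
  refine ⟨fun a => decide (Q a), fun a => decide_eq_true_iff, ⟨?_⟩⟩
  refine
    { tm := machine c src dst res p
      inputAlphabet := Equiv.refl Γ
      outputAlphabet := Equiv.refl Bool
      time := 2 * Polynomial.X + 2 * c.time + 3
      outputsFun := fun a => ?_ }
  have hb : p (exec (enc a).length c
      (Function.update (fun _ => []) dst (enc a).reverse) res).head? = decide (Q a) := by
    rw [Bool.eq_iff_iff, h, decide_eq_true_iff]
  have hm := stepsTo_machine c hsd res p (enc a)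
  rw [hb] at hm
  have hi := initList_machine c src dst res p (enc a)
  have ho := haltList_machine c src dst res p [decide (Q a)]
  have h₀ : List.map (Equiv.refl Γ).invFun (enc a) = enc a := List.map_id _
  have h₁ : List.map (Equiv.refl Bool).invFun (Computability.encodeBool (decide (Q a))) =
    [decide (Q a)] := rfl
  refine ⟨⟨hm.choose, ?_⟩, hm.choose_spec.1⟩
  have := hm.choose_spec.2
  erw [h₀, h₁, hi]
  refine this.trans ?_
  exact congrArg some ho.symm

end StackProg

/-! ### Relational programs -/

/-- The stacks used to evaluate relational programs with variables `V` and relations `J`. -/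
inductive WorkStack (V J : Type)
  | src | word | una | buf | new | tmp1 | tmp2 | acc | ctr
  | var (x : V)
  | rel (j : J)
  deriving DecidableEq, Fintype

/-- First-order formulas with a counting quantifier, over the numbers below the input length. -/
inductive CountFormula (V J : Type)
  | lt (x y : V)
  | rel (j : J) (xs : List V)
  | neg (φ : CountFormula V J)
  | and (φ ψ : CountFormula V J)
  | ex (x : V) (φ : CountFormula V J)
  | cnt (x : V) (φ ψ : CountFormula V J)

/-- Straight-line programs with bounded iteration that assign relations. -/
inductive RelProg (V J : Type)
  | assign (j : J) (xs : List V) (φ : CountFormula V J)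
  | seq (c d : RelProg V J)
  | rep (c : RelProg V J)

/-! ### Invariants for bounded loops -/

namespace StackProg

variable {K Γ : Type} [DecidableEq K]

/-- The loop rule: loops are verified by exhibiting the state `st i` reached after `i` rounds. -/
theorem exec_rep_eq {n : ℕ} {c : StackProg K Γ} (st : ℕ → K → List Γ)
    (h : ∀ i < n, exec n c (st i) = st (i + 1)) : exec n (rep c) (st 0) = st n := by
  have : ∀ i ≤ n, (exec n c)^[i] (st 0) = st i := by
    intro i
    induction i with
    | zero => simp
    | succ i ih =>
      intro hi
      rw [Function.iterate_succ_apply', ih (by omega), h i (by omega)]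
  exact this n le_rfl

/-- Nested loops. -/
def repPow (k : ℕ) (c : StackProg K Γ) : StackProg K Γ :=
  rep^[k] c

theorem exec_repPow (n k : ℕ) (c : StackProg K Γ) (s : K → List Γ) :
    exec n (repPow k c) s = (exec n c)^[n ^ k] s := by
  induction k generalizing s with
  | zero => simp [repPow]
  | succ k ih =>
    have : repPow (k + 1) c = rep (repPow k c) := Function.iterate_succ_apply' _ _ _
    rw [this, exec]
    have he : exec n (repPow k c) = (exec n c)^[n ^ k] := funext ih
    rw [he, ← Function.iterate_mul, pow_succ]

theorem iterate_eq_of_step {α : Type*} {f : α → α} (st : ℕ → α)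
    (h : ∀ i, f (st i) = st (i + 1)) (m i : ℕ) : f^[m] (st i) = st (i + m) := by
  induction m with
  | zero => simp
  | succ m ih => rw [Function.iterate_succ_apply', ih, h]; rfl

end StackProg

namespace InputSymbol

abbrev one : InputSymbol := bit true
abbrev zero : InputSymbol := bit false

instance : Inhabited InputSymbol := ⟨comma⟩

/-- Whether the symbol on top of a stack is a one. -/
def isOne (a : Option InputSymbol) : Bool := decide (a = some one)

open Classical in
/-- The truth value of a proposition as a symbol. -/
noncomputable def ofProp (p : Prop) : InputSymbol := bit (decide p)

@[simp] theorem isOne_ofProp (p : Prop) : isOne (some (ofProp p)) = true ↔ p := by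
  by_cases h : p <;> simp [isOne, ofProp, h]

@[simp] theorem isOne_one : isOne (some one) = true := rfl
@[simp] theorem isOne_zero : isOne (some zero) = false := rfl

theorem ofProp_true {p : Prop} (h : p) : ofProp p = one := by simp [ofProp, h]
theorem ofProp_false {p : Prop} (h : ¬ p) : ofProp p = zero := by simp [ofProp, h]

end InputSymbol

/-! ### Numbers and relations stored on stacks -/

open InputSymbol

/-- The position of a tuple in the lexicographic enumeration of the tuples of numbers below `n`. -/
def tupleIndex (n : ℕ) : List ℕ → ℕ
  | [] => 0
  | a :: l => a * n ^ l.length + tupleIndex n l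

/-- The characteristic sequence of a `k`-ary relation on the numbers below `n`. -/
noncomputable def relBits (n : ℕ) : ℕ → (List ℕ → Prop) → List InputSymbol
  | 0, f => [ofProp (f [])]
  | k + 1, f => (List.range n).flatMap fun a => relBits n k fun l => f (a :: l)

theorem tupleIndex_lt {n : ℕ} {l : List ℕ} (h : ∀ a ∈ l, a < n) :
    tupleIndex n l < n ^ l.length := by
  induction l with
  | nil => simp [tupleIndex]
  | cons a l ih =>
    simp only [List.mem_cons, forall_eq_or_imp] at h
    have := ih h.2
    have h1 : (a + 1) * n ^ l.length ≤ n * n ^ l.length := Nat.mul_le_mul_right _ h.1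
    simp only [tupleIndex, List.length_cons, pow_succ]
    rw [add_mul, one_mul] at h1
    rw [mul_comm (n ^ l.length) n]
    omega

theorem length_relBits (n k : ℕ) (f : List ℕ → Prop) : (relBits n k f).length = n ^ k := by
  induction k generalizing f with
  | zero => simp [relBits]
  | succ k ih => simp [relBits, List.length_flatMap, ih, pow_succ, mul_comm]

theorem getElem?_flatMap_range {α : Type*} (n b : ℕ) (g : ℕ → List α) (hg : ∀ a, (g a).length = b)
    (a i : ℕ) (ha : a < n) (hi : i < b) :
    ((List.range n).flatMap g)[a * b + i]? = (g a)[i]? := by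
  induction n with
  | zero => omega
  | succ n ih =>
    have hl : ((List.range n).flatMap g).length = n * b := by simp [List.length_flatMap, hg]
    rw [List.range_succ, List.flatMap_append]
    rcases Nat.lt_succ_iff_lt_or_eq.mp ha with h | rfl
    · have : (a + 1) * b ≤ n * b := Nat.mul_le_mul_right _ h
      rw [add_mul, one_mul] at this
      rw [List.getElem?_append_left (by omega), ih h]
    · rw [List.getElem?_append_right (by omega), hl]
      simp

theorem getElem?_relBits {n : ℕ} (l : List ℕ) (f : List ℕ → Prop) (h : ∀ a ∈ l, a < n) :
    (relBits n l.length f)[tupleIndex n l]? = some (ofProp (f l)) := by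
  induction l generalizing f with
  | nil => simp [relBits, tupleIndex]
  | cons a l ih =>
    simp only [List.mem_cons, forall_eq_or_imp] at h
    rw [List.length_cons, relBits, tupleIndex,
      getElem?_flatMap_range n (n ^ l.length) _ (fun _ => length_relBits _ _ _) _ _ h.1
        (tupleIndex_lt h.2), ih _ h.2]

/-- A stack stores the `k`-ary relation `f`; missing entries count as false. -/
structure StoresRel (n k : ℕ) (f : List ℕ → Prop) (L : List InputSymbol) : Prop where
  length_le : L.length ≤ n ^ k
  isOne_iff : ∀ l : List ℕ, l.length = k → (∀ a ∈ l, a < n) →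
    (isOne L[tupleIndex n l]? = true ↔ f l)

theorem storesRel_relBits (n k : ℕ) (f : List ℕ → Prop) : StoresRel n k f (relBits n k f) where
  length_le := (length_relBits n k f).le
  isOne_iff := by
    rintro l rfl h
    rw [getElem?_relBits l f h, isOne_ofProp]

/-- This is the reason for tolerating missing entries: stacks start empty, and thus already
represent empty relations without any initialization. -/
theorem storesRel_nil (n k : ℕ) : StoresRel n k (fun _ => False) [] where
  length_le := by simp
  isOne_iff := by intro l _ _; simp [isOne]

/-- A stack holds the number `m` as a run of ones on its top. -/
def HoldsNum (m : ℕ) (l : List InputSymbol) : Prop :=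
  ∃ r : List InputSymbol, l = List.replicate m one ++ r ∧ r.head? ≠ some one

/-! ### Semantics of formulas with counting -/

namespace CountFormula

variable {V J : Type} [DecidableEq V]

open Classical in
/-- Semantics of formulas. -/
def Holds (n : ℕ) (S : J → List ℕ → Prop) : CountFormula V J → (V → ℕ) → Prop
  | lt x y, ρ => ρ x < ρ y
  | rel j xs, ρ => S j (xs.map ρ)
  | neg φ, ρ => ¬ Holds n S φ ρ
  | and φ ψ, ρ => Holds n S φ ρ ∧ Holds n S ψ ρ
  | ex x φ, ρ => ∃ a < n, Holds n S φ (Function.update ρ x a)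
  | cnt x φ ψ, ρ =>
    Nat.count (fun a => Holds n S φ (Function.update ρ x a)) n ≤
      Nat.count (fun a => Holds n S ψ (Function.update ρ x a)) n

/-- Every relation symbol has the right number of arguments. -/
def WellFormed (ar : J → ℕ) : CountFormula V J → Prop
  | lt _ _ => True
  | rel j xs => xs.length = ar j
  | neg φ => WellFormed ar φ
  | and φ ψ => WellFormed ar φ ∧ WellFormed ar ψ
  | ex _ φ => WellFormed ar φ
  | cnt _ φ ψ => WellFormed ar φ ∧ WellFormed ar ψ

end CountFormula

/-! ### Stack programs that evaluate atomic formulas -/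

namespace RelEval

open StackProg WorkStack

variable {V J : Type}

/-- Execute `c` for every value of the variable `x`. -/
def forVar (x : V) (c : StackProg (WorkStack V J) InputSymbol) :
    StackProg (WorkStack V J) InputSymbol :=
  seq (push (var x) comma) (seq (rep (seq c (push (var x) one)))
    (seq (rep (pop (var x))) (pop (var x))))

/-- Skip `n ^ d` entries of the relation `j` for every unit of the variable `x`. -/
def skipBlocks (j : J) (d : ℕ) (x : V) : StackProg (WorkStack V J) InputSymbol :=
  seq (rep (ite (var x) isOne
    (seq (move (var x) tmp1) (repPow d (move (rel j) buf))) skip))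
    (rep (move tmp1 (var x)))

/-- Go to the entry of the relation `j` at the given tuple. -/
def seek (j : J) : List V → StackProg (WorkStack V J) InputSymbol
  | [] => skip
  | x :: xs => seq (skipBlocks j xs.length x) (seek j xs)

/-- Look up the relation `j` at the given tuple. -/
def lookup (j : J) (xs : List V) : StackProg (WorkStack V J) InputSymbol :=
  seq (seek j xs) (seq (ite (rel j) isOne (push acc one) (push acc zero))
    (repPow xs.length (move buf (rel j))))

/-- Compare two variables. -/
def compareVars [DecidableEq V] (x y : V) : StackProg (WorkStack V J) InputSymbol :=
  if x = y then push acc zero else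
    seq (rep (ite (var x) isOne (ite (var y) isOne
      (seq (move (var x) tmp1) (move (var y) tmp2)) skip) skip))
    (seq (ite (var y) isOne (push acc one) (push acc zero))
      (seq (rep (move tmp1 (var x))) (rep (move tmp2 (var y)))))

/-- Evaluate a formula and push its truth value. -/
def evalFormula [DecidableEq V] : CountFormula V J → StackProg (WorkStack V J) InputSymbol
  | .lt x y => compareVars x y
  | .rel j xs => lookup j xs
  | .neg φ => seq (evalFormula φ)
      (ite acc isOne (seq (pop acc) (push acc zero)) (seq (pop acc) (push acc one)))
  | .and φ ψ => seq (evalFormula φ) (seq (evalFormula ψ)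
      (ite acc isOne (pop acc) (seq (pop acc) (seq (pop acc) (push acc zero)))))
  | .ex x φ => seq (push acc zero) (forVar x (seq (evalFormula φ)
      (ite acc isOne (seq (pop acc) (seq (pop acc) (push acc one))) (pop acc))))
  | .cnt x φ ψ => seq (push ctr comma)
      (seq (forVar x (seq (evalFormula φ)
        (ite acc isOne (seq (pop acc) (push ctr one)) (pop acc))))
      (seq (forVar x (seq (evalFormula ψ)
        (ite acc isOne (seq (pop acc) (ite ctr isOne (pop ctr) skip)) (pop acc))))
      (seq (ite ctr isOne (push acc zero) (push acc one))
        (seq (rep (ite ctr isOne (pop ctr) skip)) (pop ctr)))))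

/-- The stacks represent the valuation `ρ` of the variables and the relations `S`. -/
structure Represents (n : ℕ) (ar : J → ℕ) (ρ : V → ℕ) (S : J → List ℕ → Prop)
    (s : WorkStack V J → List InputSymbol) : Prop where
  var : ∀ x, HoldsNum (ρ x) (s (var x))
  lt : ∀ x, ρ x < n
  rel : ∀ j, StoresRel n (ar j) (S j) (s (rel j))
  buf : s buf = []
  tmp1 : s tmp1 = []
  tmp2 : s tmp2 = []

section

variable {n : ℕ} {ar : J → ℕ} {ρ : V → ℕ} {S : J → List ℕ → Prop}
  {s : WorkStack V J → List InputSymbol}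

theorem Represents.congr {s' : WorkStack V J → List InputSymbol} (h : Represents n ar ρ S s)
    (hv : ∀ x, s' (WorkStack.var x) = s (WorkStack.var x))
    (hr : ∀ j, s' (WorkStack.rel j) = s (WorkStack.rel j))
    (hb : s' WorkStack.buf = s WorkStack.buf)
    (h1 : s' WorkStack.tmp1 = s WorkStack.tmp1) (h2 : s' WorkStack.tmp2 = s WorkStack.tmp2) :
    Represents n ar ρ S s' where
  var x := by rw [hv]; exact h.var x
  lt := h.lt
  rel j := by rw [hr]; exact h.rel j
  buf := by rw [hb]; exact h.buf
  tmp1 := by rw [h1]; exact h.tmp1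
  tmp2 := by rw [h2]; exact h.tmp2

variable [DecidableEq V] [DecidableEq J]

/-- The comma separates the new value from the old contents, so a quantifier may rebind a variable
that is already in use. -/
theorem Represents.bind (h : Represents n ar ρ S s) (x : V) {i : ℕ} (hi : i < n)
    (l : List InputSymbol) :
    Represents n ar (Function.update ρ x i) S
      (Function.update s (WorkStack.var x) (List.replicate i one ++ comma :: l)) where
  var y := by
    by_cases hy : y = x
    · subst hy
      simp only [Function.update_self]
      exact ⟨_, rfl, by simp⟩
    · rw [Function.update_of_ne hy, Function.update_of_ne (by simpa using hy)]
      exact h.var y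
  lt y := by
    by_cases hy : y = x
    · subst hy; simpa
    · rw [Function.update_of_ne hy]; exact h.lt y
  rel j := by simpa using h.rel j
  buf := by simpa using h.buf
  tmp1 := by simpa using h.tmp1
  tmp2 := by simpa using h.tmp2

/-- The invariant `t i` describes the stacks as seen from outside, with the loop variable at its old
contents `l`; inside the body the value `i` lies above a comma on top of `l`. -/
theorem exec_forVar {x : V} {c : StackProg (WorkStack V J) InputSymbol}
    (t : ℕ → WorkStack V J → List InputSymbol) (l : List InputSymbol)
    (ht : ∀ i, t i (WorkStack.var x) = l)
    (h : ∀ i < n, exec n c (Function.update (t i) (WorkStack.var x)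
        (List.replicate i one ++ comma :: l)) =
      Function.update (t (i + 1)) (WorkStack.var x) (List.replicate i one ++ comma :: l)) :
    exec n (forVar x c) (t 0) = t n := by
  have h₁ : exec n (rep (seq c (push (WorkStack.var x) one)))
      (Function.update (t 0) (WorkStack.var x) (List.replicate 0 one ++ comma :: l)) =
      Function.update (t n) (WorkStack.var x) (List.replicate n one ++ comma :: l) := by
    refine exec_rep_eq (fun i => Function.update (t i) (WorkStack.var x)
      (List.replicate i one ++ comma :: l)) fun i hi => ?_
    rw [exec, h i hi, exec]
    simp [List.replicate_succ]
  have h₂ : exec n (rep (pop (WorkStack.var x)))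
      (Function.update (t n) (WorkStack.var x) (List.replicate (n - 0) one ++ comma :: l)) =
      Function.update (t n) (WorkStack.var x) (List.replicate (n - n) one ++ comma :: l) := by
    refine exec_rep_eq (fun i => Function.update (t n) (WorkStack.var x)
      (List.replicate (n - i) one ++ comma :: l)) fun i hi => ?_
    obtain ⟨m, hm⟩ : ∃ m, n - i = m + 1 := ⟨n - i - 1, by omega⟩
    rw [exec, hm, show n - (i + 1) = m by omega]
    simp [List.replicate_succ]
  have h₀ : exec n (push (WorkStack.var x) comma) (t 0) =
      Function.update (t 0) (WorkStack.var x) (List.replicate 0 one ++ comma :: l) := by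
    simp [exec, ht]
  rw [forVar, exec, h₀, exec, h₁, exec]
  rw [Nat.sub_zero] at h₂
  rw [h₂, exec]
  simp only [Nat.sub_self, List.replicate_zero, List.nil_append, Function.update_self,
    List.tail_cons, Function.update_idem]
  rw [Function.update_eq_self_iff, ht]

/-- The state in which `m` entries of the contents `L` of the relation `j` have been skipped. -/
def skipped (s : WorkStack V J → List InputSymbol) (j : J) (L : List InputSymbol) (m : ℕ) :
    WorkStack V J → List InputSymbol :=
  Function.update (Function.update s (WorkStack.rel j) (L.drop m)) WorkStack.buf (L.take m).reverse

/-- This also holds beyond the end of `L`: moving from an empty stack does nothing, and `drop` and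
`take` saturate in the same way. Incomplete relation stacks therefore need no special treatment. -/
theorem exec_move_skipped (j : J) (L : List InputSymbol) (m : ℕ) :
    exec n (move (WorkStack.rel j) WorkStack.buf) (skipped s j L m) = skipped s j L (m + 1) := by
  by_cases hm : m < L.length
  · have h : skipped s j L m (WorkStack.rel j) = L[m] :: L.drop (m + 1) := by
      simp [skipped]
    rw [exec, h]
    have : L.take (m + 1) = L.take m ++ [L[m]] := by simp
    simp only [skipped, this, List.reverse_append]
    funext k
    cases k <;> simp [Function.update_apply]
    split_ifs <;> rfl
  · push Not at hm
    have h : skipped s j L m (WorkStack.rel j) = [] := by simp [skipped, hm]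
    rw [exec, h]
    simp [skipped, hm, List.drop_eq_nil_of_le, List.take_of_length_le, Nat.le_succ_of_le]

theorem exec_move_back_skipped (j : J) (L : List InputSymbol) (m : ℕ) (hm : m < L.length) :
    exec n (move WorkStack.buf (WorkStack.rel j)) (skipped s j L (m + 1)) = skipped s j L m := by
  have ht : L.take (m + 1) = L.take m ++ [L[m]] := by simp
  have h : skipped s j L (m + 1) WorkStack.buf = L[m] :: (L.take m).reverse := by
    simp only [skipped, Function.update_self, ht, List.reverse_append]
    rfl
  rw [exec, h]
  funext k
  cases k <;> simp [skipped, Function.update_apply]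
  split_ifs <;> rfl

theorem exec_move_back_skipped_zero (j : J) (L : List InputSymbol) :
    exec n (move WorkStack.buf (WorkStack.rel j)) (skipped s j L 0) = skipped s j L 0 := by
  have h : skipped s j L 0 WorkStack.buf = [] := by simp [skipped]
  rw [exec, h]

/-- Surplus moves are idle once `buf` is empty, so a fixed number of moves, chosen without knowing
`m`, can undo the search. -/
theorem iterate_move_back (j : J) (L : List InputSymbol) (m N : ℕ) (hN : min m L.length ≤ N) :
    (exec n (move WorkStack.buf (WorkStack.rel j)))^[N] (skipped s j L m) = skipped s j L 0 := by
  have h0 : ∀ N, (exec n (move WorkStack.buf (WorkStack.rel j)))^[N] (skipped s j L 0) =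
      skipped s j L 0 := fun N => Function.iterate_fixed (exec_move_back_skipped_zero j L) N
  have h1 : ∀ m N, m ≤ L.length → m ≤ N →
      (exec n (move WorkStack.buf (WorkStack.rel j)))^[N] (skipped s j L m) = skipped s j L 0 := by
    intro m
    induction m with
    | zero => intro N _ _; exact h0 N
    | succ m ih =>
      intro N hm hN
      obtain ⟨N, rfl⟩ : ∃ N', N = N' + 1 := ⟨N - 1, by omega⟩
      rw [Function.iterate_succ_apply, exec_move_back_skipped j L m (by omega),
        ih N (by omega) (by omega)]
  by_cases hm : m ≤ L.length
  · exact h1 m N hm (by omega)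
  · have : skipped s j L m = skipped s j L L.length := by
      simp [skipped, List.drop_eq_nil_of_le (show L.length ≤ m by omega),
        List.take_of_length_le (show L.length ≤ m by omega)]
    rw [this]
    exact h1 _ _ le_rfl (by omega)

/-- Each one on the stack of the variable pays for `n ^ d` moves and is parked on `tmp1`; the second
loop puts the value back. -/
theorem exec_skipBlocks (hv : ∀ x, HoldsNum (ρ x) (s (WorkStack.var x))) (hlt : ∀ x, ρ x < n)
    (h1 : s WorkStack.tmp1 = []) (j : J) (L : List InputSymbol) (d m : ℕ) (x : V) :
    exec n (skipBlocks j d x) (skipped s j L m) = skipped s j L (m + ρ x * n ^ d) := by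
  obtain ⟨r, hr, hr1⟩ := hv x
  have hx := hlt x
  set a := ρ x with ha
  let u : ℕ → ℕ → WorkStack V J → List InputSymbol := fun i m' =>
    skipped (Function.update (Function.update s (WorkStack.var x) (List.replicate (a - i) one ++ r))
      WorkStack.tmp1 (List.replicate i one)) j L m'
  have hu0 : ∀ m', u 0 m' = skipped s j L m' := by
    intro m'
    have : Function.update (Function.update s (WorkStack.var x) (List.replicate (a - 0) one ++ r))
      WorkStack.tmp1 (List.replicate 0 one) = s := by
      rw [Nat.sub_zero, ← hr]
      simp [h1]
    simp only [u, this]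
  have hfirst : exec n (rep (ite (WorkStack.var x) isOne
      (seq (move (WorkStack.var x) WorkStack.tmp1)
        (repPow d (move (WorkStack.rel j) WorkStack.buf))) skip)) (u (min 0 a) (m + min 0 a * n ^ d)) =
      u (min n a) (m + min n a * n ^ d) := by
    -- Only the first `a` of the `n` rounds act; afterwards the top of the variable's stack is no
    -- longer a one.
    refine exec_rep_eq (fun i => u (min i a) (m + min i a * n ^ d)) fun i hi => ?_
    by_cases hia : i < a
    · have e1 : min i a = i := by omega
      have e2 : min (i + 1) a = i + 1 := by omega
      obtain ⟨b, hb⟩ : ∃ b, a - i = b + 1 := ⟨a - i - 1, by omega⟩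
      have hvx : u i (m + i * n ^ d) (WorkStack.var x) = one :: (List.replicate b one ++ r) := by
        simp [u, skipped, hb, List.replicate_succ]
      have hmv : exec n (move (WorkStack.var x) WorkStack.tmp1) (u i (m + i * n ^ d)) =
          u (i + 1) (m + i * n ^ d) := by
        rw [exec, hvx]
        funext k
        simp only [u, skipped, Function.update_apply, show a - (i + 1) = b by omega]
        split_ifs <;> simp_all [List.replicate_succ]
      simp only [e1, e2]
      rw [exec, hvx]
      rw [if_pos (by simp [isOne]), exec, hmv, exec_repPow,
        iterate_eq_of_step (fun m' => u (i + 1) m') (fun m' => exec_move_skipped j L m')]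
      congr 1
      ring
    · have e1 : min i a = a := by omega
      have e2 : min (i + 1) a = a := by omega
      simp only [e1, e2]
      have hvx : u a (m + a * n ^ d) (WorkStack.var x) = r := by
        simp [u, skipped]
      rw [exec, hvx, if_neg (by simpa [isOne] using hr1), exec]
  have hback : exec n (rep (move WorkStack.tmp1 (WorkStack.var x))) (u (a - 0) (m + a * n ^ d)) =
      u (a - n) (m + a * n ^ d) := by
    refine exec_rep_eq (fun i => u (a - i) (m + a * n ^ d)) fun i hi => ?_
    by_cases hia : i < a
    · obtain ⟨b, hb⟩ : ∃ b, a - i = b + 1 := ⟨a - i - 1, by omega⟩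
      have ht : u (a - i) (m + a * n ^ d) WorkStack.tmp1 = one :: List.replicate b one := by
        simp [u, skipped, hb, List.replicate_succ]
      rw [exec, ht]
      funext k
      simp only [u, skipped, Function.update_apply, show a - (a - i) = i by omega,
        show a - (i + 1) = b by omega, show a - b = i + 1 by omega]
      split_ifs <;> simp_all [List.replicate_succ]
    · have ht : u (a - i) (m + a * n ^ d) WorkStack.tmp1 = [] := by
        simp [u, skipped, show a - i = 0 by omega]
      rw [exec, ht, show a - (i + 1) = a - i by omega]
  rw [skipBlocks, exec, ← hu0]
  simp only [Nat.zero_min, zero_mul, add_zero] at hfirst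
  rw [hfirst, show min n a = a by omega]
  rw [Nat.sub_zero] at hback
  rw [hback, show a - n = 0 by omega, hu0]

theorem exec_seek (hv : ∀ x, HoldsNum (ρ x) (s (WorkStack.var x))) (hlt : ∀ x, ρ x < n)
    (h1 : s WorkStack.tmp1 = []) (j : J) (L : List InputSymbol) (xs : List V) (m : ℕ) :
    exec n (seek j xs) (skipped s j L m) = skipped s j L (m + tupleIndex n (xs.map ρ)) := by
  induction xs generalizing m with
  | nil => simp [seek, exec, tupleIndex]
  | cons x xs ih =>
    rw [seek, exec, exec_skipBlocks hv hlt h1, ih]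
    simp [tupleIndex, add_assoc]

/-- The index of the tuple is below `n ^ xs.length`, so that many moves back restore the relation
whatever the tuple was. -/
theorem exec_lookup (h : Represents n ar ρ S s) (j : J) (xs : List V) (hxs : xs.length = ar j) :
    exec n (lookup j xs) s =
      Function.update s WorkStack.acc (ofProp (S j (xs.map ρ)) :: s WorkStack.acc) := by
  set L := s (WorkStack.rel j) with hL
  have hS := h.rel j
  rw [← hL] at hS
  have h0 : s = skipped s j L 0 := by
    simp [skipped, hL, h.buf]
  have hlt : ∀ a ∈ xs.map ρ, a < n := by
    intro a ha
    obtain ⟨x, _, rfl⟩ := List.mem_map.mp ha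
    exact h.lt x
  have hidx := tupleIndex_lt hlt
  rw [List.length_map] at hidx
  have hone := hS.isOne_iff (xs.map ρ) (by simpa using hxs) hlt
  set m := tupleIndex n (xs.map ρ) with hm
  have hpush : exec n (ite (WorkStack.rel j) isOne (push WorkStack.acc one)
      (push WorkStack.acc zero)) (skipped s j L m) =
      skipped (Function.update s WorkStack.acc (ofProp (S j (xs.map ρ)) :: s WorkStack.acc)) j L m := by
    have hh : (skipped s j L m (WorkStack.rel j)).head? = L[m]? := by
      simp [skipped]
    rw [exec, hh]
    by_cases hp : S j (xs.map ρ)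
    · rw [if_pos (hone.mpr hp), exec, ofProp_true hp]
      funext k
      cases k <;> simp [skipped, Function.update_apply]
    · rw [if_neg (fun hc => hp (hone.mp hc)), exec, ofProp_false hp]
      funext k
      cases k <;> simp [skipped, Function.update_apply]
  rw [lookup, exec]
  conv_lhs => rw [h0]
  rw [exec_seek h.var h.lt h.tmp1, zero_add, exec, hpush, exec_repPow, iterate_move_back]
  · funext k
    cases k <;> simp [skipped, Function.update_apply, h.buf]
    rintro rfl
    exact hL
  · omega

/-- Ones are removed from both stacks in pairs until one number is exhausted; the second number is
larger exactly if its stack still shows a one. Equal variables are excluded beforehand because a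
pair would then come from a single stack. -/
theorem exec_compareVars (h : Represents n ar ρ S s) (x y : V) :
    exec n (compareVars x y) s =
      Function.update s WorkStack.acc (ofProp (ρ x < ρ y) :: s WorkStack.acc) := by
  by_cases hxy : x = y
  · subst hxy
    simp [compareVars, exec, ofProp_false]
  rw [compareVars, if_neg hxy]
  obtain ⟨r, hr, hr1⟩ := h.var x
  obtain ⟨q, hq, hq1⟩ := h.var y
  have hx := h.lt x
  have hy := h.lt y
  have ht1 := h.tmp1
  have ht2 := h.tmp2
  set a := ρ x with ha
  set b := ρ y with hb
  let u : List InputSymbol → ℕ → ℕ → WorkStack V J → List InputSymbol := fun A i k =>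
    Function.update (Function.update (Function.update (Function.update
      (Function.update s WorkStack.acc A)
      (WorkStack.var x) (List.replicate (a - i) one ++ r))
      (WorkStack.var y) (List.replicate (b - k) one ++ q))
      WorkStack.tmp1 (List.replicate i one)) WorkStack.tmp2 (List.replicate k one)
  have hu0 : ∀ A, u A 0 0 = Function.update s WorkStack.acc A := by
    intro A
    funext z
    cases z <;> simp [u, Function.update_apply, ← hr, ← hq, ht1, ht2]
    split_ifs <;> simp_all
  have hux : ∀ A i k, u A i k (WorkStack.var x) = List.replicate (a - i) one ++ r := by
    intro A i k
    simp [u, hxy]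
  have huy : ∀ A i k, u A i k (WorkStack.var y) = List.replicate (b - k) one ++ q := by
    intro A i k
    simp [u]
  have hmx : ∀ A i k, i < a → exec n (move (WorkStack.var x) WorkStack.tmp1) (u A i k) =
      u A (i + 1) k := by
    intro A i k hi
    obtain ⟨c, hc⟩ : ∃ c, a - i = c + 1 := ⟨a - i - 1, by omega⟩
    rw [exec, hux, hc, List.replicate_succ, List.cons_append]
    funext z
    rcases z with _ | _ | _ | _ | _ | _ | _ | _ | _ | z | z <;>
      simp [u, Function.update_apply, show a - (i + 1) = c by omega, List.replicate_succ]
    split_ifs <;> simp_all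
  have hmy : ∀ A i k, k < b → exec n (move (WorkStack.var y) WorkStack.tmp2) (u A i k) =
      u A i (k + 1) := by
    intro A i k hi
    obtain ⟨c, hc⟩ : ∃ c, b - k = c + 1 := ⟨b - k - 1, by omega⟩
    rw [exec, huy, hc, List.replicate_succ, List.cons_append]
    funext z
    rcases z with _ | _ | _ | _ | _ | _ | _ | _ | _ | z | z <;>
      simp [u, Function.update_apply, show b - (k + 1) = c by omega, List.replicate_succ]
    split_ifs <;> rfl
  have hbx : ∀ A i k, i < a → exec n (move WorkStack.tmp1 (WorkStack.var x)) (u A (i + 1) k) =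
      u A i k := by
    intro A i k hi
    have ht : u A (i + 1) k WorkStack.tmp1 = one :: List.replicate i one := by
      simp [u, List.replicate_succ]
    rw [exec, ht]
    funext z
    rcases z with _ | _ | _ | _ | _ | _ | _ | _ | _ | z | z <;>
      simp [u, Function.update_apply, show a - i = a - (i + 1) + 1 by omega, List.replicate_succ,
        hxy]
    split_ifs <;> simp_all
  have hby : ∀ A i k, k < b → exec n (move WorkStack.tmp2 (WorkStack.var y)) (u A i (k + 1)) =
      u A i k := by
    intro A i k hi
    have ht : u A i (k + 1) WorkStack.tmp2 = one :: List.replicate k one := by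
      simp [u, List.replicate_succ]
    rw [exec, ht]
    funext z
    rcases z with _ | _ | _ | _ | _ | _ | _ | _ | _ | z | z <;>
      simp [u, Function.update_apply, show b - k = b - (k + 1) + 1 by omega, List.replicate_succ]
    split_ifs <;> rfl
  have hfix1 : ∀ A k, exec n (move WorkStack.tmp1 (WorkStack.var x)) (u A 0 k) = u A 0 k := by
    intro A k
    have ht : u A 0 k WorkStack.tmp1 = [] := by simp [u]
    rw [exec, ht]
  have hfix2 : ∀ A i, exec n (move WorkStack.tmp2 (WorkStack.var y)) (u A i 0) = u A i 0 := by
    intro A k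
    have ht : u A k 0 WorkStack.tmp2 = [] := by simp [u]
    rw [exec, ht]
  set A := s WorkStack.acc with hA
  set c := min a b with hc
  have hloop : exec n (rep (ite (WorkStack.var x) isOne (ite (WorkStack.var y) isOne
      (seq (move (WorkStack.var x) WorkStack.tmp1) (move (WorkStack.var y) WorkStack.tmp2)) skip)
        skip)) (u A (min 0 c) (min 0 c)) = u A (min n c) (min n c) := by
    refine exec_rep_eq (fun i => u A (min i c) (min i c)) fun i hi => ?_
    by_cases hic : i < c
    · rw [show min i c = i by omega, show min (i + 1) c = i + 1 by omega, exec, hux,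
        if_pos, exec, huy, if_pos, exec, hmx _ _ _ (by omega), hmy _ _ _ (by omega)]
      · rw [show b - i = b - i - 1 + 1 by omega]; simp [isOne, List.replicate_succ]
      · rw [show a - i = a - i - 1 + 1 by omega]; simp [isOne, List.replicate_succ]
    · rw [show min i c = c by omega, show min (i + 1) c = c by omega, exec, hux]
      by_cases hac : c = a
      · rw [if_neg, exec]
        simpa [hac, isOne] using hr1
      · have hbc : c = b := by omega
        have hy' : exec n (ite (WorkStack.var y) isOne (seq (move (WorkStack.var x) WorkStack.tmp1)
            (move (WorkStack.var y) WorkStack.tmp2)) skip) (u A c c) = u A c c := by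
          rw [exec, huy, if_neg, exec]
          simpa [hbc, isOne] using hq1
        rw [hy', exec, ite_self]
  have hpush : exec n (ite (WorkStack.var y) isOne (push WorkStack.acc one)
      (push WorkStack.acc zero)) (u A c c) = u (ofProp (a < b) :: A) c c := by
    rw [exec, huy]
    by_cases hab : a < b
    · rw [if_pos, exec, ofProp_true hab]
      · funext z
        cases z <;> simp [u, Function.update_apply]
      · rw [show b - c = b - c - 1 + 1 by omega]; simp [isOne, List.replicate_succ]
    · rw [if_neg, exec, ofProp_false hab]
      · funext z
        cases z <;> simp [u, Function.update_apply]
      · simpa [show b - c = 0 by omega, isOne] using hq1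
  have hr1 : ∀ B k, exec n (rep (move WorkStack.tmp1 (WorkStack.var x))) (u B (c - 0) k) =
      u B (c - n) k := by
    intro B k
    refine exec_rep_eq (fun i => u B (c - i) k) fun i hi => ?_
    by_cases hic : i < c
    · rw [show c - i = c - (i + 1) + 1 by omega, hbx _ _ _ (by omega)]
    · rw [show c - i = 0 by omega, show c - (i + 1) = 0 by omega, hfix1]
  have hr2 : ∀ B k, exec n (rep (move WorkStack.tmp2 (WorkStack.var y))) (u B k (c - 0)) =
      u B k (c - n) := by
    intro B k
    refine exec_rep_eq (fun i => u B k (c - i)) fun i hi => ?_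
    by_cases hic : i < c
    · rw [show c - i = c - (i + 1) + 1 by omega, hby _ _ _ (by omega)]
    · rw [show c - i = 0 by omega, show c - (i + 1) = 0 by omega, hfix2]
  have hs : s = u A 0 0 := by rw [hu0]; simp [hA]
  conv_lhs => rw [hs]
  simp only [Nat.zero_min, Nat.sub_zero] at hloop hr1 hr2
  rw [exec, hloop, show min n c = c by omega, exec, hpush, exec, hr1, show c - n = 0 by omega,
    hr2, show c - n = 0 by omega, hu0]

end

end RelEval

/-! ### Correctness of formula evaluation -/

namespace RelEval

open StackProg WorkStack

theorem isOne_replicate (m : ℕ) (l : List InputSymbol) :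
    isOne (List.replicate m one ++ comma :: l).head? = true ↔ m ≠ 0 := by
  cases m <;> simp [isOne, List.replicate_succ]

section

variable {V J : Type} [DecidableEq V] [DecidableEq J]
variable {n : ℕ} {ar : J → ℕ} {ρ : V → ℕ} {S : J → List ℕ → Prop}
  {s : WorkStack V J → List InputSymbol}

theorem Represents.update_acc (h : Represents n ar ρ S s) (l : List InputSymbol) :
    Represents n ar ρ S (Function.update s WorkStack.acc l) :=
  h.congr (by simp) (by simp) (by simp) (by simp) (by simp)

theorem Represents.update_ctr (h : Represents n ar ρ S s) (l : List InputSymbol) :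
    Represents n ar ρ S (Function.update s WorkStack.ctr l) :=
  h.congr (by simp) (by simp) (by simp) (by simp) (by simp)

theorem Represents.update_new (h : Represents n ar ρ S s) (l : List InputSymbol) :
    Represents n ar ρ S (Function.update s WorkStack.new l) :=
  h.congr (by simp) (by simp) (by simp) (by simp) (by simp)

/-- Postfix evaluation: each subformula adds one truth value to `acc` and leaves everything else as
it was. The statement is universal in `ρ` and `s` because quantifiers evaluate their body under
changed valuations. -/
theorem exec_evalFormula (φ : CountFormula V J) :
    ∀ (ρ : V → ℕ) (s : WorkStack V J → List InputSymbol), Represents n ar ρ S s →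
      φ.WellFormed ar → exec n (evalFormula φ) s =
        Function.update s WorkStack.acc (ofProp (φ.Holds n S ρ) :: s WorkStack.acc) := by
  classical
  induction φ with
  | lt x y => intro ρ s h _; exact exec_compareVars h x y
  | rel j xs => intro ρ s h hw; exact exec_lookup h j xs hw
  | neg φ ih =>
    intro ρ s h hw
    rw [evalFormula, exec, ih ρ s h hw, exec]
    by_cases hp : φ.Holds n S ρ
    · simp [exec, hp, CountFormula.Holds, ofProp_false]
    · simp [exec, hp, CountFormula.Holds, ofProp_true]
  | and φ ψ ih₁ ih₂ =>
    intro ρ s h hw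
    rw [evalFormula, exec, ih₁ ρ s h hw.1, exec, ih₂ ρ _ (h.update_acc _) hw.2, exec]
    by_cases hp : φ.Holds n S ρ <;> by_cases hq : ψ.Holds n S ρ <;>
      simp [exec, hp, hq, CountFormula.Holds, ofProp_false, ofProp_true]
  | ex x φ ih =>
    intro ρ s h hw
    -- After `i` rounds the top of `acc` tells whether a witness below `i` exists.
    have := exec_forVar (n := n) (x := x) (c := seq (evalFormula φ)
      (ite acc isOne (seq (pop acc) (seq (pop acc) (push acc one))) (pop acc)))
      (fun i => Function.update s WorkStack.acc
        (ofProp (∃ a < i, φ.Holds n S (Function.update ρ x a)) :: s WorkStack.acc))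
      (s (WorkStack.var x)) (by simp) ?_
    · rw [evalFormula, exec, exec]
      simpa [CountFormula.Holds, ofProp_false] using this
    · intro i hi
      rw [exec, ih (Function.update ρ x i) _ ((h.update_acc _).bind x hi _) hw, exec]
      have hs : (∃ a < i + 1, φ.Holds n S (Function.update ρ x a)) ↔
          (∃ a < i, φ.Holds n S (Function.update ρ x a)) ∨ φ.Holds n S (Function.update ρ x i) := by
        simp only [Nat.lt_succ_iff_lt_or_eq, or_and_right, exists_or, exists_eq_left]
      by_cases hp : φ.Holds n S (Function.update ρ x i)
      · rw [ofProp_true (hs.mpr (Or.inr hp))]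
        funext k
        cases k <;> simp [exec, hp, Function.update_apply]
      · rw [show (∃ a < i + 1, φ.Holds n S (Function.update ρ x a)) =
          (∃ a < i, φ.Holds n S (Function.update ρ x a)) from
            propext (hs.trans (or_iff_left hp))]
        funext k
        cases k <;> simp [exec, hp, Function.update_apply]
  | cnt x φ ψ ih₁ ih₂ =>
    intro ρ s h hw
    set p : ℕ → ℕ := Nat.count (fun a => φ.Holds n S (Function.update ρ x a)) with hp
    set q : ℕ → ℕ := Nat.count (fun a => ψ.Holds n S (Function.update ρ x a)) with hq
    -- `ctr` first counts the values satisfying `φ`; those satisfying `ψ` are then taken off,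
    -- stopping at zero. A one that survives refutes the comparison.
    have h₁ := exec_forVar (n := n) (x := x) (c := seq (evalFormula φ)
        (ite acc isOne (seq (pop acc) (push ctr one)) (pop acc)))
      (fun i => Function.update s WorkStack.ctr
        (List.replicate (p i) one ++ comma :: s WorkStack.ctr))
      (s (WorkStack.var x)) (by simp) ?_
    · have h₂ := exec_forVar (n := n) (x := x) (c := seq (evalFormula ψ)
          (ite acc isOne (seq (pop acc) (ite ctr isOne (pop ctr) skip)) (pop acc)))
        (fun i => Function.update s WorkStack.ctr
          (List.replicate (p n - q i) one ++ comma :: s WorkStack.ctr))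
        (s (WorkStack.var x)) (by simp) ?_
      · have hp0 : p 0 = 0 := by simp [hp]
        have hq0 : q 0 = 0 := by simp [hq]
        -- The counter never exceeds `n`, so the `n` rounds of the cleanup loop empty it down to the
        -- comma.
        have hpn : p n ≤ n := Nat.count_le _
        have h₃ := exec_rep_eq (n := n) (c := (ite ctr isOne (pop ctr) skip :
            StackProg (WorkStack V J) InputSymbol))
          (fun i => Function.update (Function.update s WorkStack.acc
            (ofProp ((CountFormula.cnt x φ ψ).Holds n S ρ) :: s WorkStack.acc)) WorkStack.ctr
            (List.replicate (p n - q n - i) one ++ comma :: s WorkStack.ctr)) ?_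
        · have h₄ : exec n (ite ctr isOne (push acc zero) (push acc one))
              (Function.update s WorkStack.ctr
                (List.replicate (p n - q n) one ++ comma :: s WorkStack.ctr)) =
              Function.update (Function.update s WorkStack.acc
            (ofProp ((CountFormula.cnt x φ ψ).Holds n S ρ) :: s WorkStack.acc)) WorkStack.ctr
            (List.replicate (p n - q n) one ++ comma :: s WorkStack.ctr) := by
            rw [exec]
            simp only [Function.update_self, isOne_replicate]
            by_cases hc : (CountFormula.cnt x φ ψ).Holds n S ρ
            · have : p n ≤ q n := hc
              rw [if_neg (by omega), exec, ofProp_true hc]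
              funext k
              cases k <;> simp
            · have : ¬ p n ≤ q n := hc
              rw [if_pos (by omega), exec, ofProp_false hc]
              funext k
              cases k <;> simp
          have h₀ : exec n (push ctr comma) s = Function.update s WorkStack.ctr
            (List.replicate (p 0) one ++ comma :: s WorkStack.ctr) := by simp [exec, hp0]
          simp only [hq0, Nat.sub_zero] at h₂
          simp only [Nat.sub_zero] at h₃
          rw [evalFormula, exec, h₀, exec, h₁, exec, h₂, exec, h₄, exec, h₃,
            show p n - q n - n = 0 by omega, exec]
          funext k
          cases k <;> simp
        · intro i hi
          rw [exec]
          simp only [Function.update_self, isOne_replicate]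
          by_cases hc : p n - q n - i = 0
          · rw [if_neg (by omega), exec, hc, show p n - q n - (i + 1) = 0 by omega]
          · obtain ⟨m, hm⟩ : ∃ m, p n - q n - i = m + 1 := ⟨p n - q n - i - 1, by omega⟩
            rw [if_pos (by omega), exec, show p n - q n - (i + 1) = m by omega, hm]
            simp [List.replicate_succ]
      · intro i hi
        rw [exec, ih₂ (Function.update ρ x i) _ ((h.update_ctr _).bind x hi _) hw.2, exec]
        have hs : q (i + 1) = q i + if ψ.Holds n S (Function.update ρ x i) then 1 else 0 :=
          Nat.count_succ _ _
        by_cases hc : ψ.Holds n S (Function.update ρ x i)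
        · rw [if_pos hc] at hs
          rw [Function.update_self, List.head?_cons, if_pos ((isOne_ofProp _).mpr hc), exec, exec,
            exec, exec, exec]
          rw [Function.update_of_ne (by simp), Function.update_of_ne (by simp),
            Function.update_of_ne (by simp), Function.update_self]
          by_cases hz : p n - q i = 0
          · rw [if_neg (by rw [isOne_replicate]; omega), hz, show p n - q (i + 1) = 0 by omega]
            funext k
            cases k <;> simp [Function.update_apply]
          · rw [if_pos (by rw [isOne_replicate]; omega),
              show p n - q i = p n - q (i + 1) + 1 by omega]
            funext k
            cases k <;> simp [Function.update_apply, List.replicate_succ]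
        · rw [if_neg hc, add_zero] at hs
          rw [Function.update_self, List.head?_cons,
            if_neg (fun h => hc ((isOne_ofProp _).mp h)), exec, hs]
          funext k
          cases k <;> simp [Function.update_apply]
    · intro i hi
      rw [exec, ih₁ (Function.update ρ x i) _ ((h.update_ctr _).bind x hi _) hw.1, exec]
      have hs : p (i + 1) = p i + if φ.Holds n S (Function.update ρ x i) then 1 else 0 :=
        Nat.count_succ _ _
      by_cases hc : φ.Holds n S (Function.update ρ x i)
      · rw [if_pos hc] at hs
        rw [hs]
        funext k
        cases k <;> simp [exec, hc, Function.update_apply, List.replicate_succ]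
      · rw [if_neg hc, add_zero] at hs
        rw [hs]
        funext k
        cases k <;> simp [exec, hc, Function.update_apply]

end

end RelEval

/-! ### Compilation of relational programs -/

namespace RelProg

open StackProg RelEval

variable {V J : Type} [DecidableEq V] [DecidableEq J]

/-- Assign the entries of a list to variables. -/
def bindVars (ρ : V → ℕ) : List V → List ℕ → V → ℕ
  | x :: xs, a :: l => bindVars (Function.update ρ x a) xs l
  | _, _ => ρ

/-- Semantics of relational programs. -/
def run (n : ℕ) : RelProg V J → (J → List ℕ → Prop) → J → List ℕ → Prop
  | assign j xs φ, S => Function.update S j fun l => φ.Holds n S (bindVars (fun _ => 0) xs l)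
  | seq c d, S => run n d (run n c S)
  | rep c, S => (run n c)^[n] S

/-- Every relation symbol has the right number of arguments. -/
def WellFormed (ar : J → ℕ) : RelProg V J → Prop
  | assign j xs φ => xs.length = ar j ∧ φ.WellFormed ar
  | seq c d => WellFormed ar c ∧ WellFormed ar d
  | rep c => WellFormed ar c

/-- Push the values of a formula for all values of the given variables. -/
def tabulate (φ : CountFormula V J) : List V → StackProg (WorkStack V J) InputSymbol
  | [] => .seq (evalFormula φ) (.move .acc .new)
  | x :: xs => forVar x (tabulate φ xs)

/-- Implementation of relational programs. -/
def compile : RelProg V J → StackProg (WorkStack V J) InputSymbol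
  | assign j xs φ => .seq (tabulate φ xs) (.seq (repPow xs.length (.pop (.rel j)))
      (repPow xs.length (.move .new (.rel j))))
  | seq c d => .seq (compile c) (compile d)
  | rep c => .rep (compile c)

variable {n : ℕ} {ar : J → ℕ} {S : J → List ℕ → Prop}

/-- Later tuples land on top, so the table appears reversed on `new`; moving it to the stack of the
relation reverses it once more. -/
theorem exec_tabulate (φ : CountFormula V J) (hw : φ.WellFormed ar) (xs : List V) :
    ∀ (ρ : V → ℕ) (s : WorkStack V J → List InputSymbol), Represents n ar ρ S s →
      exec n (tabulate φ xs) s = Function.update s WorkStack.new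
        ((relBits n xs.length fun l => φ.Holds n S (bindVars ρ xs l)).reverse ++
          s WorkStack.new) := by
  induction xs with
  | nil =>
    intro ρ s h
    rw [tabulate, exec, exec_evalFormula φ ρ s h hw, exec]
    simp only [Function.update_self]
    funext k
    cases k <;> simp [relBits, bindVars]
  | cons x xs ih =>
    intro ρ s h
    set g : ℕ → List InputSymbol := fun a =>
      relBits n xs.length fun l => φ.Holds n S (bindVars ρ (x :: xs) (a :: l)) with hg
    have := exec_forVar (n := n) (x := x) (c := tabulate φ xs)
      (fun i => Function.update s WorkStack.new
        (((List.range i).flatMap g).reverse ++ s WorkStack.new)) (s (WorkStack.var x)) (by simp) ?_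
    · simp only [List.range_zero, List.flatMap_nil, List.reverse_nil, List.nil_append,
        Function.update_eq_self] at this
      rw [tabulate, this]
      rfl
    · intro i hi
      rw [ih (Function.update ρ x i) _ ((h.update_new _).bind x hi _), List.range_succ,
        List.flatMap_append, List.reverse_append]
      funext k
      cases k <;> simp [Function.update_apply, hg, bindVars]

theorem iterate_pop (j : J) (s : WorkStack V J → List InputSymbol) (m : ℕ) :
    (exec n (.pop (.rel j)))^[m] s =
      Function.update s (WorkStack.rel j) ((s (WorkStack.rel j)).drop m) := by
  induction m with
  | zero => simp
  | succ m ih =>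
    rw [Function.iterate_succ_apply', ih, exec]
    simp

theorem iterate_move_new (j : J) (A B : List InputSymbol) (s : WorkStack V J → List InputSymbol) :
    (exec n (.move .new (.rel j)))^[A.length]
      (Function.update (Function.update s (WorkStack.rel j) B) WorkStack.new A) =
      Function.update (Function.update s (WorkStack.rel j) (A.reverse ++ B)) WorkStack.new [] := by
  induction A generalizing B with
  | nil => simp
  | cons a A ih =>
    rw [List.length_cons, Function.iterate_succ_apply]
    have : exec n (.move .new (.rel j))
        (Function.update (Function.update s (WorkStack.rel j) B) WorkStack.new (a :: A)) =
        Function.update (Function.update s (WorkStack.rel j) (a :: B)) WorkStack.new A := by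
      rw [exec]
      simp only [Function.update_self]
      funext k
      cases k <;> simp [Function.update_apply]
      split_ifs <;> rfl
    rw [this, ih]
    simp

/-- A formula is tabulated completely before the old relation is discarded, so a relation may be
defined from its own previous value, as iterated definitions require. -/
theorem represents_exec_compile (c : RelProg V J) :
    ∀ (S : J → List ℕ → Prop) (s : WorkStack V J → List InputSymbol), c.WellFormed ar →
      Represents n ar (fun _ => 0) S s → s WorkStack.new = [] →
      Represents n ar (fun _ => 0) (run n c S) (exec n (compile c) s) ∧
        exec n (compile c) s WorkStack.new = [] := by
  induction c with
  | assign j xs φ =>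
    intro S s hw h hnew
    set f : List ℕ → Prop := fun l => φ.Holds n S (bindVars (fun _ => 0) xs l) with hf
    have hlen := length_relBits n xs.length f
    -- The height bound in `StoresRel` ensures that `n ^ k` pops remove the old relation entirely.
    have hrel := (h.rel j).length_le
    rw [← hw.1] at hrel
    have he : exec n (compile (assign j xs φ)) s =
        Function.update (Function.update s (WorkStack.rel j) (relBits n xs.length f))
          WorkStack.new [] := by
      rw [compile, exec, exec_tabulate φ hw.2 xs _ s h, exec, exec_repPow, exec_repPow, iterate_pop,
        Function.update_of_ne (by simp), List.drop_eq_nil_of_le hrel, hnew,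
        List.append_nil, Function.update_comm (by simp)]
      have := iterate_move_new (n := n) j (relBits n xs.length f).reverse [] s
      rw [List.length_reverse, hlen, List.reverse_reverse, List.append_nil] at this
      exact this
    rw [he]
    refine ⟨⟨fun x => ?_, h.lt, fun i => ?_, ?_, ?_, ?_⟩, by simp⟩
    · simpa using h.var x
    · by_cases hi : i = j
      · subst hi
        simp only [run, Function.update_self, ne_eq, reduceCtorEq, not_false_eq_true,
          Function.update_of_ne, ← hw.1]
        exact storesRel_relBits n xs.length f
      · simpa [run, hi] using h.rel i
    · simpa using h.buf
    · simpa using h.tmp1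
    · simpa using h.tmp2
  | seq c d ihc ihd =>
    intro S s hw h hnew
    obtain ⟨h₁, h₂⟩ := ihc S s hw.1 h hnew
    exact ihd _ _ hw.2 h₁ h₂
  | rep c ih =>
    intro S s hw h hnew
    have : ∀ i, Represents n ar (fun _ => 0) ((run n c)^[i] S) ((exec n (compile c))^[i] s) ∧
        (exec n (compile c))^[i] s WorkStack.new = [] := by
      intro i
      induction i with
      | zero => exact ⟨h, hnew⟩
      | succ i ihi =>
        rw [Function.iterate_succ_apply', Function.iterate_succ_apply']
        exact ih _ _ hw ihi.1 ihi.2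
    exact this n

end RelProg

/-! ### Reading the input -/

/-- The table of the entries of a list of rows: entry `y` of row `x` is at most `z`. -/
def tableLe (rows : List (List ℕ)) : List ℕ → Prop
  | [x, y, z] => ∃ v, (rows[x]?.bind fun r => r[y]?) = some v ∧ v ≤ z
  | _ => False

/-! ### From binary lists to a threshold table -/

namespace InputParser

open StackProg WorkStack

variable {V J : Type}

/-- Whether the symbol on top of a stack is a bit. -/
def isBit : Option InputSymbol → Bool
  | some (bit _) => true
  | _ => false

/-- Whether the symbol on top of a stack belongs to an entry of a row in unary. -/
def isEntry (a : Option InputSymbol) : Bool := decide (a = some one ∨ a = some comma)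

/-- Double the number on top of `una`. -/
def doubleTop : StackProg (WorkStack V J) InputSymbol :=
  seq (rep (ite una isOne (move una tmp1) skip))
    (rep (ite tmp1 isOne (seq (pop tmp1) (seq (push una one) (push una one))) skip))

/-- Convert the next symbol of the reversed input from binary to unary. -/
def readSymbol : StackProg (WorkStack V J) InputSymbol :=
  ite word isBit (seq doubleTop (ite word isOne (move word una) (pop word))) (move word una)

/-- Tabulate the next entry of a row. -/
def readCell : StackProg (WorkStack V J) InputSymbol :=
  ite una isEntry
    (seq (rep (ite una isOne (seq (pop una) (push new zero)) (push new one))) (pop una))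
    (rep (push new zero))

/-- Tabulate the input in the relation `j`. -/
def parse (j : J) : StackProg (WorkStack V J) InputSymbol :=
  seq (rep readSymbol) (seq (rep (seq (rep readCell) (pop una))) (repPow 3 (move new (rel j))))

/-- A row in unary. -/
def unaryRow (r : List ℕ) : List InputSymbol :=
  r.flatMap (fun x => List.replicate x one ++ [comma]) ++ [semicolon]

variable [DecidableEq V] [DecidableEq J] {n : ℕ} {s : WorkStack V J → List InputSymbol}

/-- Both loops run exactly `n` rounds, so `r ≤ n` is what lets each of them process the whole
number. -/
theorem exec_doubleTop {r : ℕ} {R : List InputSymbol} (hr : r ≤ n)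
    (hu : s una = List.replicate r one ++ R) (hR : R.head? ≠ some one) (ht : s tmp1 = []) :
    exec n doubleTop s = Function.update s una (List.replicate (2 * r) one ++ R) := by
  let u : ℕ → ℕ → WorkStack V J → List InputSymbol := fun i k =>
    Function.update (Function.update s una (List.replicate i one ++ R)) tmp1 (List.replicate k one)
  have h₀ : u r 0 = s := by
    simp only [u, ← hu, Function.update_eq_self, List.replicate_zero]
    rw [Function.update_eq_self_iff, ht]
  have h₁ : exec n (rep (ite una isOne (move una tmp1) skip)) (u (r - 0) (min 0 r)) =
      u (r - n) (min n r) := by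
    refine exec_rep_eq (fun i => u (r - i) (min i r)) fun i hi => ?_
    by_cases hir : i < r
    · have hz : u (r - i) (min i r) una = one :: (List.replicate (r - (i + 1)) one ++ R) := by
        simp [u, show r - i = r - (i + 1) + 1 by omega, List.replicate_succ]
      rw [exec, hz, if_pos (by simp [isOne]), exec, hz, show min i r = i by omega,
        show min (i + 1) r = i + 1 by omega]
      funext k
      cases k <;> simp [u, List.replicate_succ]
    · have hz : u (r - i) (min i r) una = R := by
        simp [u, show r - i = 0 by omega]
      rw [exec, hz, if_neg (by simpa [isOne] using hR), exec, show r - i = r - (i + 1) by omega,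
        show min i r = min (i + 1) r by omega]
  have h₂ : exec n (rep (ite tmp1 isOne (seq (pop tmp1) (seq (push una one) (push una one))) skip))
      (u (2 * min 0 r) (r - 0)) = u (2 * min n r) (r - n) := by
    refine exec_rep_eq (fun i => u (2 * min i r) (r - i)) fun i hi => ?_
    by_cases hir : i < r
    · have hz : u (2 * min i r) (r - i) tmp1 = one :: List.replicate (r - (i + 1)) one := by
        simp [u, show r - i = r - (i + 1) + 1 by omega, List.replicate_succ]
      rw [exec, hz, if_pos (by simp [isOne]), exec, exec, exec, exec, exec, hz,
        show min i r = i by omega,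
        show min (i + 1) r = i + 1 by omega, show 2 * (i + 1) = 2 * i + 1 + 1 by ring]
      funext k
      cases k <;> simp [u, List.replicate_succ]
    · have hz : u (2 * min i r) (r - i) tmp1 = [] := by
        simp [u, show r - i = 0 by omega]
      rw [exec, hz, if_neg (by simp [isOne]), exec, show r - i = r - (i + 1) by omega,
        show min i r = min (i + 1) r by omega]
  simp only [Nat.sub_zero, Nat.zero_min, mul_zero] at h₁ h₂
  rw [h₀] at h₁
  rw [show r - n = 0 by omega, show min n r = r by omega] at h₁ h₂
  rw [doubleTop, exec, h₁, h₂]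
  funext k
  cases k <;> simp [u, ht]

/-- The state with the given contents of the stacks `word` and `una`. -/
def readState (s : WorkStack V J → List InputSymbol) (W U : List InputSymbol) :
    WorkStack V J → List InputSymbol :=
  Function.update (Function.update s word W) una U

theorem exec_readSymbol_bit {r : ℕ} {R : List InputSymbol} (hr : r ≤ n)
    (hR : R.head? ≠ some one) (ht : s tmp1 = []) (b : Bool) (W : List InputSymbol) :
    exec n readSymbol (readState s (bit b :: W) (List.replicate r one ++ R)) =
      readState s W (List.replicate (2 * r + b.toNat) one ++ R) := by
  have hw : readState s (bit b :: W) (List.replicate r one ++ R) word = bit b :: W := by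
    simp [readState]
  rw [readSymbol, exec, hw, if_pos (by simp [isBit]), exec,
    exec_doubleTop hr (by simp [readState]) hR (by simp [readState, ht])]
  have hw' : Function.update (readState s (bit b :: W) (List.replicate r one ++ R)) una
      (List.replicate (2 * r) one ++ R) word = bit b :: W := by
    simp [readState]
  rw [exec, hw']
  cases b
  · rw [if_neg (by simp [isOne]), exec, hw']
    funext k
    cases k <;> simp [readState]
  · rw [if_pos (by simp [isOne]), exec, hw']
    funext k
    cases k <;> simp [readState, List.replicate_succ]

theorem exec_readSymbol_sep {a : InputSymbol} (ha : isBit (some a) = false)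
    (W U : List InputSymbol) :
    exec n readSymbol (readState s (a :: W) U) = readState s W (a :: U) := by
  have hw : readState s (a :: W) U word = a :: W := by
    simp [readState]
  rw [readSymbol, exec, hw, if_neg (by simp [ha]), exec, hw]
  funext k
  cases k <;> simp [readState]

/-- Reading the word `A` changes the contents of `una` from `U` to `U'`. -/
def Reads (n : ℕ) (s : WorkStack V J → List InputSymbol) (A U U' : List InputSymbol) : Prop :=
  ∀ W, (exec n readSymbol)^[A.length] (readState s (A.reverse ++ W) U) = readState s W U'

/-- The input lies reversed on `word`, so the right factor is read first. Pushing what is read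
restores the original order on `una`. -/
theorem Reads.append {A A' U U' U'' : List InputSymbol} (h' : Reads n s A' U U')
    (h : Reads n s A U' U'') : Reads n s (A ++ A') U U'' := by
  intro W
  rw [List.length_append, Function.iterate_add_apply, List.reverse_append, List.append_assoc,
    h' _, h _]

theorem reads_nil (U : List InputSymbol) : Reads n s [] U U := fun _ => rfl

theorem reads_sep {a : InputSymbol} (ha : isBit (some a) = false) (U : List InputSymbol) :
    Reads n s [a] U (a :: U) := fun W => exec_readSymbol_sep ha W U

theorem reads_bit {r : ℕ} {R : List InputSymbol} (hr : r ≤ n)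
    (hR : R.head? ≠ some one) (ht : s tmp1 = []) (b : Bool) :
    Reads n s [bit b] (List.replicate r one ++ R)
      (List.replicate (2 * r + b.toNat) one ++ R) :=
  fun W => exec_readSymbol_bit hr hR ht b W

/-- Binary digits are written with the least significant first, hence arrive with the most
significant first: the induction over `p` is Horner's scheme. -/
theorem reads_encodePosNum (ht : s tmp1 = []) {R : List InputSymbol} (hR : R.head? ≠ some one)
    (p : PosNum) : (p : ℕ) ≤ n →
      Reads n s ((Computability.encodePosNum p).map bit) R (List.replicate (p : ℕ) one ++ R) := by
  induction p with
  | one =>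
    intro _
    exact reads_bit (r := 0) (Nat.zero_le n) hR ht true
  | bit0 p ih =>
    intro hp
    rw [PosNum.cast_bit0] at hp
    have := (ih (by omega)).append (reads_bit (r := (p : ℕ)) (by omega) hR ht false)
    rw [PosNum.cast_bit0, ← two_mul]
    simpa [Computability.encodePosNum] using this
  | bit1 p ih =>
    intro hp
    rw [PosNum.cast_bit1] at hp
    have := (ih (by omega)).append (reads_bit (r := (p : ℕ)) (by omega) hR ht true)
    rw [PosNum.cast_bit1, ← two_mul]
    simpa [Computability.encodePosNum] using this

theorem reads_encodeNat (ht : s tmp1 = []) {R : List InputSymbol} (hR : R.head? ≠ some one)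
    (x : ℕ) (hx : x ≤ n) :
    Reads n s ((Computability.encodeNat x).map bit) R (List.replicate x one ++ R) := by
  have hc : (((x : Num) : Num) : ℕ) = x := Num.to_of_nat x
  rw [Computability.encodeNat]
  rcases hN : (x : Num) with _ | p
  · rw [hN] at hc
    have : x = 0 := by rw [← hc]; rfl
    subst this
    exact reads_nil R
  · rw [hN] at hc
    have hp : (p : ℕ) = x := by rw [← hc]; rfl
    rw [← hp] at hx ⊢
    exact reads_encodePosNum ht hR p hx

theorem reads_encodeNatList (ht : s tmp1 = []) (r : List ℕ) (hr : ∀ x ∈ r, x ≤ n)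
    (U : List InputSymbol) : Reads n s (encodeNatList r) U (unaryRow r ++ U) := by
  have hs : Reads n s [semicolon] U (semicolon :: U) := reads_sep rfl U
  rw [encodeNatList, unaryRow, List.append_assoc, List.singleton_append]
  refine hs.append ?_
  generalize semicolon :: U = U'
  clear hs
  induction r with
  | nil => exact reads_nil U'
  | cons x r ih =>
    simp only [List.mem_cons, forall_eq_or_imp] at hr
    have h₁ := ih hr.2
    have h₂ := h₁.append (reads_sep (a := comma) rfl _)
    have h₃ := h₂.append (reads_encodeNat ht (by simp) x hr.1)
    simpa using h₃

theorem reads_rows (ht : s tmp1 = []) (rows : List (List ℕ)) (hr : ∀ r ∈ rows, ∀ x ∈ r, x ≤ n) :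
    Reads n s (rows.flatMap encodeNatList) [] (rows.flatMap unaryRow) := by
  induction rows with
  | nil => exact reads_nil _
  | cons r rows ih =>
    simp only [List.mem_cons, forall_eq_or_imp] at hr
    have := (ih hr.2).append (reads_encodeNatList ht r hr.1 _)
    simpa using this

/-- The tabulated form of an entry. -/
noncomputable def cellBits (n : ℕ) (o : Option ℕ) : List InputSymbol :=
  (List.range n).flatMap fun z => [ofProp (∃ v, o = some v ∧ v ≤ z)]

/-- The state with the given contents of the stacks `una` and `new`. -/
def cellState (s : WorkStack V J → List InputSymbol) (U N : List InputSymbol) :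
    WorkStack V J → List InputSymbol :=
  Function.update (Function.update s una U) new N

theorem exec_pop_una (U N : List InputSymbol) :
    exec n (pop una) (cellState s U N) = cellState s U.tail N := by
  rw [exec]
  funext k
  cases k <;> simp [cellState]

/-- Round `z` emits a zero while ones remain and a one afterwards, which is the truth value of `v ≤
z`. Recording this threshold instead of equality lets a single pass over the unary number produce
the whole cell. -/
theorem exec_readCell_some (v : ℕ) (hv : v ≤ n) (U N : List InputSymbol) :
    exec n readCell (cellState s (List.replicate v one ++ comma :: U) N) =
      cellState s U ((cellBits n (some v)).reverse ++ N) := by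
  have h₁ : exec n (rep (ite una isOne (seq (pop una) (push new zero)) (push new one)))
      (cellState s (List.replicate (v - 0) one ++ comma :: U)
        (((List.range 0).flatMap fun z => [ofProp (∃ w, some v = some w ∧ w ≤ z)]).reverse ++ N)) =
      cellState s (List.replicate (v - n) one ++ comma :: U)
        (((List.range n).flatMap fun z => [ofProp (∃ w, some v = some w ∧ w ≤ z)]).reverse ++ N) := by
    refine exec_rep_eq (fun i => cellState s (List.replicate (v - i) one ++ comma :: U)
        (((List.range i).flatMap fun z => [ofProp (∃ w, some v = some w ∧ w ≤ z)]).reverse ++ N))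
        fun i hi => ?_
    rw [List.range_succ, List.flatMap_append, List.reverse_append]
    set B := ((List.range i).flatMap fun z => [ofProp (∃ w, some v = some w ∧ w ≤ z)]).reverse
    by_cases hiv : i < v
    · have hz : cellState s (List.replicate (v - i) one ++ comma :: U) (B ++ N) una =
          one :: (List.replicate (v - (i + 1)) one ++ comma :: U) := by
        simp [cellState, show v - i = v - (i + 1) + 1 by omega, List.replicate_succ]
      have hf : ¬ ∃ w, some v = some w ∧ w ≤ i := by
        rintro ⟨w, hw, hwi⟩
        cases hw
        omega
      simp only [List.flatMap_cons, List.flatMap_nil, ofProp_false hf]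
      rw [exec, hz, if_pos (by simp [isOne]), exec, exec, exec, hz]
      funext k
      cases k <;> simp [cellState]
    · have hz : cellState s (List.replicate (v - i) one ++ comma :: U) (B ++ N) una =
          comma :: U := by
        simp [cellState, show v - i = 0 by omega]
      have hf : ∃ w, some v = some w ∧ w ≤ i := ⟨v, rfl, by omega⟩
      simp only [List.flatMap_cons, List.flatMap_nil, ofProp_true hf]
      rw [exec, hz, if_neg (by simp [isOne]), exec, show v - (i + 1) = v - i by omega]
      funext k
      cases k <;> simp [cellState]
  rw [readCell, exec, if_pos, exec]
  · simp only [List.range_zero, List.flatMap_nil, List.reverse_nil, List.nil_append,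
      Nat.sub_zero] at h₁
    rw [h₁, exec_pop_una, show v - n = 0 by omega]
    rfl
  · cases v <;> simp [cellState, isEntry, List.replicate_succ]

theorem exec_readCell_none (U N : List InputSymbol) (hU : isEntry U.head? = false) :
    exec n readCell (cellState s U N) = cellState s U ((cellBits n none).reverse ++ N) := by
  have hu : cellState s U N una = U := by simp [cellState]
  have h₁ : exec n (rep (push new zero))
      (cellState s U (((List.range 0).flatMap fun z =>
        [ofProp (∃ w, (none : Option ℕ) = some w ∧ w ≤ z)]).reverse ++ N)) =
      cellState s U (((List.range n).flatMap fun z =>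
        [ofProp (∃ w, (none : Option ℕ) = some w ∧ w ≤ z)]).reverse ++ N) := by
    refine exec_rep_eq (fun i => cellState s U (((List.range i).flatMap fun z =>
        [ofProp (∃ w, (none : Option ℕ) = some w ∧ w ≤ z)]).reverse ++ N)) fun i hi => ?_
    rw [List.range_succ, List.flatMap_append, List.reverse_append]
    have hf : ¬ ∃ w, (none : Option ℕ) = some w ∧ w ≤ i := by simp
    simp only [List.flatMap_cons, List.flatMap_nil, ofProp_false hf]
    rw [exec]
    funext k
    cases k <;> simp [cellState]
  rw [readCell, exec, hu, if_neg (by simp [hU])]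
  simpa [cellBits] using h₁

/-- The tabulated form of a row. -/
noncomputable def rowBits (n : ℕ) (o : Option (List ℕ)) : List InputSymbol :=
  (List.range n).flatMap fun y => cellBits n (o.bind fun r => r[y]?)

theorem exec_readRow_some (r : List ℕ) (hr : ∀ x ∈ r, x ≤ n) (hl : r.length ≤ n)
    (U N : List InputSymbol) :
    exec n (seq (rep readCell) (pop una)) (cellState s (unaryRow r ++ U) N) =
      cellState s U ((rowBits n (some r)).reverse ++ N) := by
  have h₁ : exec n (rep readCell) (cellState s (unaryRow (r.drop 0) ++ U)
        (((List.range 0).flatMap fun y => cellBits n r[y]?).reverse ++ N)) =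
      cellState s (unaryRow (r.drop n) ++ U)
        (((List.range n).flatMap fun y => cellBits n r[y]?).reverse ++ N) := by
    refine exec_rep_eq (fun i => cellState s (unaryRow (r.drop i) ++ U)
        (((List.range i).flatMap fun y => cellBits n r[y]?).reverse ++ N)) fun i hi => ?_
    rw [List.range_succ, List.flatMap_append, List.reverse_append]
    by_cases hir : i < r.length
    · have hd : r.drop i = r[i] :: r.drop (i + 1) := by simp
      have hu : unaryRow (r.drop i) ++ U =
          List.replicate r[i] one ++ comma :: (unaryRow (r.drop (i + 1)) ++ U) := by
        rw [hd]
        simp only [unaryRow, List.flatMap_cons, List.append_assoc, List.cons_append,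
          List.nil_append]
      rw [hu, exec_readCell_some _ (hr _ (by simp))]
      simp [hir]
    · have hd : r.drop i = [] := by simp; omega
      have hd' : r.drop (i + 1) = [] := by simp; omega
      rw [hd, hd', exec_readCell_none _ _ (by simp [unaryRow, isEntry])]
      simp [show r[i]? = none by simp; omega]
  rw [exec]
  simp only [List.drop_zero, List.range_zero, List.flatMap_nil, List.reverse_nil,
    List.nil_append] at h₁
  rw [h₁, exec_pop_una, show r.drop n = [] by simp; omega]
  simp [unaryRow, rowBits]

theorem exec_readRow_none (N : List InputSymbol) :
    exec n (seq (rep readCell) (pop una)) (cellState s [] N) =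
      cellState s [] ((rowBits n none).reverse ++ N) := by
  have h₁ : exec n (rep readCell) (cellState s []
        (((List.range 0).flatMap fun _ => cellBits n none).reverse ++ N)) =
      cellState s [] (((List.range n).flatMap fun _ => cellBits n none).reverse ++ N) := by
    refine exec_rep_eq (fun i => cellState s []
        (((List.range i).flatMap fun _ => cellBits n none).reverse ++ N)) fun i hi => ?_
    rw [exec_readCell_none _ _ (by simp [isEntry]), List.range_succ, List.flatMap_append,
      List.reverse_append]
    simp
  rw [exec]
  simp only [List.range_zero, List.flatMap_nil, List.reverse_nil, List.nil_append] at h₁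
  rw [h₁, exec_pop_una]
  simp [rowBits]

/-- Cells beyond the end of a row and rows beyond the end of the list are filled with zeros, so the
output is always a full table of `n ^ 3` bits. -/
theorem exec_readRows (rows : List (List ℕ)) (hr : ∀ r ∈ rows, ∀ x ∈ r, x ≤ n)
    (hl : ∀ r ∈ rows, r.length ≤ n) :
    exec n (rep (seq (rep readCell) (pop una))) (cellState s (rows.flatMap unaryRow) []) =
      cellState s ((rows.drop n).flatMap unaryRow) (relBits n 3 (tableLe rows)).reverse := by
  have h₁ : exec n (rep (seq (rep readCell) (pop una)))
      (cellState s ((rows.drop 0).flatMap unaryRow)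
        ((List.range 0).flatMap fun x => rowBits n rows[x]?).reverse) =
      cellState s ((rows.drop n).flatMap unaryRow)
        ((List.range n).flatMap fun x => rowBits n rows[x]?).reverse := by
    refine exec_rep_eq (fun i => cellState s ((rows.drop i).flatMap unaryRow)
        ((List.range i).flatMap fun x => rowBits n rows[x]?).reverse) fun i hi => ?_
    rw [List.range_succ, List.flatMap_append, List.reverse_append]
    by_cases hir : i < rows.length
    · have hd : rows.drop i = rows[i] :: rows.drop (i + 1) := by simp
      rw [hd, List.flatMap_cons, exec_readRow_some _ (hr _ (by simp)) (hl _ (by simp))]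
      simp [hir]
    · have hd : rows.drop i = [] := by simp; omega
      have hd' : rows.drop (i + 1) = [] := by simp; omega
      rw [hd, hd', List.flatMap_nil, exec_readRow_none]
      simp [show rows[i]? = none by simp; omega]
  simp only [List.drop_zero, List.range_zero, List.flatMap_nil, List.reverse_nil] at h₁
  rw [h₁]
  rfl

theorem represents_exec_parse {ar : J → ℕ} {j : J} (hj : ar j = 3) (rows : List (List ℕ))
    (hn : n = (rows.flatMap encodeNatList).length) (hne : rows ≠ [])
    (hr : ∀ r ∈ rows, ∀ x ∈ r, x < n) :
    RelEval.Represents n ar (fun _ : V => 0) (Function.update (fun _ _ => False) j (tableLe rows))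
      (exec n (parse (V := V) j) (Function.update (fun _ => []) word
        (rows.flatMap encodeNatList).reverse)) ∧
      exec n (parse (V := V) j) (Function.update (fun _ => []) word
        (rows.flatMap encodeNatList).reverse) new = [] := by
  have hl : ∀ r ∈ rows, r.length ≤ n := by
    intro r hrr
    have h1 : r.length ≤ (encodeNatList r).length := by
      simp only [encodeNatList, List.length_append, List.length_flatMap, List.length_map,
        List.length_singleton]
      have : ∀ l : List ℕ, l.length ≤ (l.map fun x =>
          (Computability.encodeNat x).length + 1).sum := by
        intro l
        induction l with
        | nil => simp
        | cons a l ih => simp; omega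
      exact (this r).trans (by simp)
    rw [hn, List.length_flatMap]
    exact h1.trans (List.le_sum_of_mem (List.mem_map.mpr ⟨r, hrr, rfl⟩))
  -- Empty variable stacks hold the value `0`, which has to be an admissible value below `n`.
  have hpos : 0 < n := by
    rw [hn, List.length_pos_iff]
    obtain ⟨r, rows, rfl⟩ := List.exists_cons_of_ne_nil hne
    simp [encodeNatList]
  have h₁ : exec n (rep readSymbol) (Function.update (fun _ => []) word
        (rows.flatMap encodeNatList).reverse) =
      readState (fun _ : WorkStack V J => []) [] (rows.flatMap unaryRow) := by
    have := reads_rows (V := V) (J := J) (n := n) (s := fun _ => []) rfl rows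
      (fun r h x hx => (hr r h x hx).le) []
    rw [← hn, List.append_nil] at this
    rw [exec, ← this]
    congr 1
    funext k
    cases k <;> simp [readState]
  have h₂ : readState (fun _ : WorkStack V J => []) [] (rows.flatMap unaryRow) =
      cellState (fun _ => []) (rows.flatMap unaryRow) [] := by
    funext k
    cases k <;> simp [readState, cellState]
  have h₃ := RelProg.iterate_move_new (V := V) (n := n) j (relBits n 3 (tableLe rows)).reverse []
    (Function.update (fun _ => []) una ((rows.drop n).flatMap unaryRow))
  have h₄ : exec n (parse (V := V) j) (Function.update (fun _ => []) word
        (rows.flatMap encodeNatList).reverse) =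
      Function.update (Function.update (Function.update (fun _ => []) una
        ((rows.drop n).flatMap unaryRow)) (WorkStack.rel j) (relBits n 3 (tableLe rows)))
        WorkStack.new [] := by
    rw [parse, exec, h₁, h₂, exec, exec_readRows rows (fun r h x hx => (hr r h x hx).le) hl,
      exec_repPow]
    rw [List.length_reverse, length_relBits, List.reverse_reverse, List.append_nil] at h₃
    rw [← h₃]
    congr 1
    funext k
    cases k <;> simp [cellState, Function.update_apply]
  rw [h₄]
  refine ⟨⟨fun x => ⟨[], by simp, by simp⟩, fun _ => hpos, fun i => ?_, by simp, by simp, by simp⟩,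
    by simp⟩
  by_cases hi : i = j
  · subst hi
    rw [hj]
    simpa using storesRel_relBits n 3 (tableLe rows)
  · simpa [hi] using storesRel_nil n (ar i)

end InputParser

/-! ### Polynomial time from relational programs -/

namespace RelProg

open StackProg RelEval

variable {V J : Type} [DecidableEq V] [DecidableEq J] [Fintype V] [Fintype J]

/-- A question about tables of numbers is decidable in polynomial time if it is answered by a
relational program, started with the table, and a formula. -/
theorem solvableInPolyTime {α : Type} (enc : α → List InputSymbol) (Q : α → Prop)
    (rows : α → List (List ℕ)) (henc : ∀ a, enc a = (rows a).flatMap encodeNatList)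
    (hne : ∀ a, rows a ≠ []) (hlt : ∀ a, ∀ r ∈ rows a, ∀ x ∈ r, x < (enc a).length)
    (ar : J → ℕ) (j : J) (hj : ar j = 3) (c : RelProg V J) (hc : c.WellFormed ar)
    (φ : CountFormula V J) (hφ : φ.WellFormed ar)
    (h : ∀ a, φ.Holds (enc a).length (c.run (enc a).length
      (Function.update (fun _ _ => False) j (tableLe (rows a)))) (fun _ => 0) ↔ Q a) :
    SolvableInPolyTime enc Q := by
  refine StackProg.solvableInPolyTime (K := WorkStack V J) enc Q
    (.seq (InputParser.parse j) (.seq (compile c) (evalFormula φ)))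
    (src := WorkStack.src) (dst := WorkStack.word) (by simp) WorkStack.acc isOne fun a => ?_
  rw [← h a]
  have hp := InputParser.represents_exec_parse (V := V) hj (rows a)
    (congrArg List.length (henc a)) (hne a) (hlt a)
  rw [← henc] at hp
  have hr := represents_exec_compile c _ _ hc hp.1 hp.2
  rw [exec, exec, exec_evalFormula φ _ _ hr.1 hφ]
  simp

end RelProg

/-! ### Equilibria of party-aligned single-peaked elections -/

namespace Election

variable {C P V : Type} (E : Election C P V)

/-- Every other party has a candidate that `v` ranks below `a`. -/
def Alive (v : V) (a : C) : Prop :=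
  ∀ q, q ≠ E.party a → ∃ b, E.party b = q ∧ E.prefers v a b

/-- Whether `v` votes for a nominee of `p` may depend on the nominee of `q`. -/
def DependsOn (p q : P) : Prop :=
  ∃ v a b, E.party a = p ∧ E.party b = q ∧ p ≠ q ∧ E.Alive v a ∧ E.prefers v b a

/-- The interaction graph of the parties. -/
def Adj (p q : P) : Prop := E.DependsOn p q ∨ E.DependsOn q p

theorem Adj.symm {E : Election C P V} {p q : P} (h : E.Adj p q) : E.Adj q p := Or.symm h

theorem Adj.ne {E : Election C P V} {p q : P} (h : E.Adj p q) : p ≠ q := by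
  rcases h with ⟨_, _, _, _, _, h, _⟩ | ⟨_, _, _, _, _, h, _⟩
  · exact h
  · exact h.symm

/-- `v` votes for `a`, when the adjacent nominees are `l` and `r`. -/
def VotesLocally (l : Option C) (a : C) (r : Option C) (v : V) : Prop :=
  E.Alive v a ∧ (∀ b, l = some b → E.prefers v a b) ∧ (∀ b, r = some b → E.prefers v a b)

open Classical in
/-- The score of `a`, when the adjacent nominees are `l` and `r`. -/
noncomputable def localScore [Fintype V] (l : Option C) (a : C) (r : Option C) : ℕ :=
  (Finset.univ.filter fun v : V => E.VotesLocally l a r v).card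

theorem localScore_comm [Fintype V] (l : Option C) (a : C) (r : Option C) :
    E.localScore l a r = E.localScore r a l := by
  unfold localScore VotesLocally
  congr 1
  ext v
  simp only [Finset.mem_filter]
  tauto

theorem localScore_le [Fintype V] (l : Option C) (a : C) (r : Option C) :
    E.localScore l a r ≤ Fintype.card V :=
  Finset.card_le_univ _

/-- An arrangement of the interaction graph as a union of paths. -/
structure Layout where
  nxt : P → Option P
  prv : P → Option P
  pos : P → ℕ
  bound : ℕ
  nxt_iff : ∀ p q, nxt p = some q ↔ prv q = some p
  adj_iff : ∀ p q, E.Adj p q ↔ nxt p = some q ∨ prv p = some q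
  pos_nxt : ∀ p q, nxt p = some q → pos q = pos p + 1
  pos_injective : Function.Injective pos
  pos_lt : ∀ p, pos p < bound

/-! ### Scores are determined by adjacent nominees -/

namespace Layout

variable {E}

/-- The reversed arrangement. -/
def reverse (L : Layout E) : Layout E where
  nxt := L.prv
  prv := L.nxt
  pos p := L.bound - 1 - L.pos p
  bound := L.bound
  nxt_iff p q := (L.nxt_iff q p).symm
  adj_iff p q := (L.adj_iff p q).trans or_comm
  pos_nxt p q h := by
    have h₁ := L.pos_nxt q p ((L.nxt_iff q p).mpr h)
    have h₂ := L.pos_lt p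
    omega
  pos_injective p q h := by
    apply L.pos_injective
    have h₁ := L.pos_lt p
    have h₂ := L.pos_lt q
    simp only at h
    omega
  pos_lt p := by
    have := L.pos_lt p
    omega

theorem pos_prv (L : Layout E) {p q : P} (h : L.prv p = some q) : L.pos p = L.pos q + 1 :=
  L.pos_nxt q p ((L.nxt_iff q p).mpr h)

/-- The nominee of the next party. -/
def right (L : Layout E) (g : P → C) (p : P) : Option C := (L.nxt p).map g

/-- The nominee of the party after the next. -/
def right₂ (L : Layout E) (g : P → C) (p : P) : Option C := (L.nxt p).bind fun q => (L.nxt q).map g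

/-- The nominee of the previous party. -/
def left (L : Layout E) (g : P → C) (p : P) : Option C := (L.prv p).map g

/-- The nominee of the party before the previous. -/
def left₂ (L : Layout E) (g : P → C) (p : P) : Option C := (L.prv p).bind fun q => (L.prv q).map g

/-- A voter's choice has all other nominees below it, which makes it alive. Conversely, a nominee
preferred to an alive one makes the two parties adjacent by definition, so an alive nominee can be
outranked only by adjacent nominees. -/
theorem score_eq [Fintype V] (L : Layout E) {g : P → C} (hg : E.IsScheme g) (p : P) :
    E.score g p = E.localScore (L.left g p) (g p) (L.right g p) := by
  unfold score localScore
  congr 1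
  ext v
  simp only [Finset.mem_filter, Finset.mem_univ, true_and]
  have := E.prefers_strictTotal v
  constructor
  · intro h
    refine ⟨fun q hq => ⟨g q, hg q, h q (by rwa [hg p] at hq)⟩, fun b hb => ?_, fun b hb => ?_⟩
    · obtain ⟨q, hq, rfl⟩ := Option.map_eq_some_iff.mp hb
      exact h q ((L.adj_iff p q).mpr (Or.inr hq)).ne.symm
    · obtain ⟨q, hq, rfl⟩ := Option.map_eq_some_iff.mp hb
      exact h q ((L.adj_iff p q).mpr (Or.inl hq)).ne.symm
  · rintro ⟨ha, hl, hr⟩ q hq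
    rcases trichotomous_of (E.prefers v) (g p) (g q) with h | h | h
    · exact h
    · exact absurd (by rw [← hg p, ← hg q, h]) hq
    · have : E.Adj p q := Or.inl ⟨v, g p, g q, hg p, hg q, hq.symm, ha, h⟩
      rcases (L.adj_iff p q).mp this with h' | h'
      · exact hr _ (by simp [right, h'])
      · exact hl _ (by simp [left, h'])

end Layout

/-- A party between the two would contain, as `a` is alive, a candidate `d` below `a`. Then `d` lies
between `a` and `b` on the voter's axis while both are preferred to it, a valley that
single-peakedness forbids. -/
theorem DependsOn.not_between {E : Election C P V} {r : P → P → Prop} (hr : IsStrictTotalOrder P r)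
    (hv : ∀ v, ∃ axis : C → C → Prop, IsStrictTotalOrder C axis ∧
      E.IsSinglePeakedAt v axis ∧ E.IsCompatible axis r) {p q : P} (h : E.DependsOn p q) (t : P) :
    ¬ (r p t ∧ r t q) ∧ ¬ (r q t ∧ r t p) := by
  obtain ⟨v, a, b, ha, hb, hpq, hal, hba⟩ := h
  obtain ⟨axis, hax, hsp, hc⟩ := hv v
  have := E.prefers_strictTotal v
  -- Compatibility read backwards: by totality, the order of two distinct parties dictates the order
  -- of all their candidates.
  have key : ∀ x y, r (E.party x) (E.party y) → axis x y := by
    intro x y hxy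
    rcases trichotomous_of axis x y with h | h | h
    · exact h
    · rw [h] at hxy
      exact absurd hxy (irrefl_of r _)
    · have hne : E.party y ≠ E.party x := by
        intro he
        rw [he] at hxy
        exact irrefl_of r _ hxy
      exact absurd hxy (asymm_of r (hc y x hne h))
  constructor
  · rintro ⟨h₁, h₂⟩
    obtain ⟨d, hd, had⟩ := hal t (by rintro rfl; rw [ha] at h₁; exact irrefl_of r _ h₁)
    have h₃ := hsp a d b (key _ _ (by rwa [ha, hd])) (key _ _ (by rwa [hd, hb])) had
    exact irrefl_of (E.prefers v) a (trans_of (E.prefers v) had (trans_of (E.prefers v) h₃ hba))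
  · rintro ⟨h₁, h₂⟩
    obtain ⟨d, hd, had⟩ := hal t (by rintro rfl; rw [ha] at h₂; exact irrefl_of r _ h₂)
    have h₃ := hsp b d a (key _ _ (by rwa [hb, hd])) (key _ _ (by rwa [hd, ha]))
      (trans_of (E.prefers v) hba had)
    exact irrefl_of (E.prefers v) a (trans_of (E.prefers v) had h₃)

/-- Adjacent parties are consecutive on the party axis, so a party has at most one neighbour on each
side. Positions count the parties that come earlier. -/
theorem exists_layout [Fintype P] (h : E.IsPartyAlignedSinglePeaked) :
    ∃ L : Layout E, L.bound = Fintype.card P := by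
  classical
  obtain ⟨r, hr, hv⟩ := h
  have hcons : ∀ p q t, E.Adj p q → ¬ (r p t ∧ r t q) := by
    rintro p q t (h | h)
    · exact (h.not_between hr hv t).1
    · exact (h.not_between hr hv t).2
  -- Of two neighbours on the same side, the nearer would separate `p` from the farther.
  have huniq : ∀ p q q', E.Adj p q → r p q → E.Adj p q' → r p q' → q = q' := by
    intro p q q' h₁ h₂ h₃ h₄
    rcases trichotomous_of r q q' with h | h | h
    · exact absurd ⟨h₂, h⟩ (hcons _ _ _ h₃)
    · exact h
    · exact absurd ⟨h₄, h⟩ (hcons _ _ _ h₁)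
  have huniq' : ∀ p q q', E.Adj p q → r q p → E.Adj p q' → r q' p → q = q' := by
    intro p q q' h₁ h₂ h₃ h₄
    rcases trichotomous_of r q q' with h | h | h
    · exact absurd ⟨h, h₄⟩ (hcons _ _ _ h₁.symm)
    · exact h
    · exact absurd ⟨h, h₂⟩ (hcons _ _ _ h₃.symm)
  let nxt : P → Option P := fun p =>
    if h : ∃ q, E.Adj p q ∧ r p q then some h.choose else none
  let prv : P → Option P := fun p =>
    if h : ∃ q, E.Adj p q ∧ r q p then some h.choose else none
  have hnxt : ∀ p q, nxt p = some q ↔ E.Adj p q ∧ r p q := by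
    intro p q
    by_cases h : ∃ q, E.Adj p q ∧ r p q
    · simp only [nxt, dif_pos h, Option.some.injEq]
      constructor
      · rintro rfl; exact h.choose_spec
      · rintro ⟨h₁, h₂⟩
        exact huniq p _ _ h.choose_spec.1 h.choose_spec.2 h₁ h₂
    · simp only [nxt, dif_neg h]
      simp only [reduceCtorEq, false_iff]
      exact fun hq => h ⟨q, hq⟩
  have hprv : ∀ p q, prv p = some q ↔ E.Adj p q ∧ r q p := by
    intro p q
    by_cases h : ∃ q, E.Adj p q ∧ r q p
    · simp only [prv, dif_pos h, Option.some.injEq]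
      constructor
      · rintro rfl; exact h.choose_spec
      · rintro ⟨h₁, h₂⟩
        exact huniq' p _ _ h.choose_spec.1 h.choose_spec.2 h₁ h₂
    · simp only [prv, dif_neg h]
      simp only [reduceCtorEq, false_iff]
      exact fun hq => h ⟨q, hq⟩
  have hlt : ∀ p q, r p q → (Finset.univ.filter fun x => r x p).card <
      (Finset.univ.filter fun x => r x q).card := by
    intro p q hpq
    apply Finset.card_lt_card
    refine ⟨fun x hx => ?_, fun hs => ?_⟩
    · simp only [Finset.mem_filter, Finset.mem_univ, true_and] at hx ⊢
      exact trans_of r hx hpq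
    · have := hs (by simpa using hpq : p ∈ Finset.univ.filter fun x => r x q)
      simp only [Finset.mem_filter, Finset.mem_univ, true_and] at this
      exact irrefl_of r _ this
  refine ⟨⟨nxt, prv, fun p => (Finset.univ.filter fun x => r x p).card, Fintype.card P, ?_, ?_, ?_,
    ?_, ?_⟩, rfl⟩
  · intro p q
    rw [hnxt, hprv]
    exact ⟨fun h => ⟨h.1.symm, h.2⟩, fun h => ⟨h.1.symm, h.2⟩⟩
  · intro p q
    rw [hnxt, hprv]
    constructor
    · intro h
      rcases trichotomous_of r p q with h' | h' | h'
      · exact Or.inl ⟨h, h'⟩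
      · exact absurd h' h.ne
      · exact Or.inr ⟨h, h'⟩
    · rintro (h | h) <;> exact h.1
  · intro p q h
    obtain ⟨h₁, h₂⟩ := (hnxt p q).mp h
    -- Nothing lies strictly between the adjacent parties `p` and `q`, so the initial segment grows
    -- by `p` alone.
    have : (Finset.univ.filter fun x => r x q) = insert p (Finset.univ.filter fun x => r x p) := by
      ext x
      simp only [Finset.mem_filter, Finset.mem_univ, true_and, Finset.mem_insert]
      constructor
      · intro hx
        rcases trichotomous_of r x p with h' | h' | h'
        · exact Or.inr h'
        · exact Or.inl h'
        · exact absurd ⟨h', hx⟩ (hcons _ _ _ h₁)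
      · rintro (rfl | hx)
        · exact h₂
        · exact trans_of r hx h₂
    simp only [this]
    rw [Finset.card_insert_of_notMem]
    simpa using irrefl_of r p
  · intro p q h
    rcases trichotomous_of r p q with h' | h' | h'
    · exact absurd h (hlt _ _ h').ne
    · exact h'
    · exact absurd h (hlt _ _ h').ne'
  · intro p
    apply Finset.card_lt_univ_of_notMem (x := p)
    simpa using irrefl_of r p

/-- The party `x`, with a nominee of score `m`, is at distance at least two from the nominee `c`
with neighbours `b` and `d`, and beats the score `s`. -/
def BeatsFromAfar (x : P) (m : ℕ) (b : Option C) (c : C) (d : Option C) (s : ℕ) : Prop :=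
  x ≠ E.party c ∧ (∀ b', b = some b' → x ≠ E.party b') ∧ (∀ d', d = some d' → x ≠ E.party d') ∧
    s < m

/-- The local conditions on five consecutive nominees `a`, `b`, `c`, `d`, `e`, when the winner `w`
has the score `m` and reference parties `x` and `y` have the scores `k` and `l`. -/
def GoodWindow [Fintype V] (w : P) (m : ℕ) (x : P) (k : ℕ) (y : P) (l : ℕ)
    (a b : Option C) (c : C) (d e : Option C) : Prop :=
  E.localScore b c d ≤ m ∧ (E.party c = w → E.localScore b c d = m) ∧
    (E.party c = x → E.localScore b c d = k) ∧ (E.party c = y → E.localScore b c d = l) ∧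
    (E.localScore b c d = m ∨ ∀ c', E.party c' = E.party c →
      (∃ b', b = some b' ∧ E.localScore b c' d < E.localScore a b' (some c')) ∨
      (∃ d', d = some d' ∧ E.localScore b c' d < E.localScore (some c') d' e) ∨
      E.BeatsFromAfar w m b c d (E.localScore b c' d) ∨
      E.BeatsFromAfar x k b c d (E.localScore b c' d) ∨
      E.BeatsFromAfar y l b c d (E.localScore b c' d))

/-- The conditions do not distinguish left from right, so a path may be traversed in either
direction; no orientation of the axis has to be found. -/
theorem GoodWindow.symm [Fintype V] {E : Election C P V} {w x y : P} {m k l : ℕ}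
    {a b : Option C} {c : C} {d e : Option C} (h : E.GoodWindow w m x k y l a b c d e) :
    E.GoodWindow w m x k y l e d c b a := by
  have hs : ∀ {t : P} {j s : ℕ}, E.BeatsFromAfar t j b c d s → E.BeatsFromAfar t j d c b s :=
    fun h => ⟨h.1, h.2.2.1, h.2.1, h.2.2.2⟩
  obtain ⟨h₁, h₂, h₃, h₄, h₅⟩ := h
  unfold GoodWindow
  rw [E.localScore_comm d c b]
  refine ⟨h₁, h₂, h₃, h₄, h₅.imp id fun h c' hc => ?_⟩
  rw [E.localScore_comm d c' b]
  rcases h c' hc with ⟨b', hb, h⟩ | ⟨d', hd, h⟩ | h | h | h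
  · exact Or.inr (Or.inl ⟨b', hb, by rwa [E.localScore_comm (some c')]⟩)
  · exact Or.inl ⟨d', hd, by rwa [E.localScore_comm e]⟩
  · exact Or.inr (Or.inr (Or.inl (hs h)))
  · exact Or.inr (Or.inr (Or.inr (Or.inl (hs h))))
  · exact Or.inr (Or.inr (Or.inr (Or.inr (hs h))))

/-! ### Equilibria as a conjunction of local conditions -/

namespace Layout

variable {E} (L : Layout E)

/-- The local conditions at the party `p`. -/
def GoodAt [Fintype V] (w : P) (m : ℕ) (x : P) (k : ℕ) (y : P) (l : ℕ) (g : P → C) (p : P) : Prop :=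
  E.GoodWindow w m x k y l (L.left₂ g p) (L.left g p) (g p) (L.right g p) (L.right₂ g p)

section Deviation

variable [DecidableEq P] {g : P → C}

theorem isScheme_update (hg : E.IsScheme g) (p : P) (c' : C) (hc : E.party c' = p) :
    E.IsScheme (Function.update g p c') := by
  intro q
  by_cases h : q = p
  · subst h; simpa
  · simpa [h] using hg q

theorem left_update_of_ne {p q : P} (c' : C) (h : L.prv q ≠ some p) :
    L.left (Function.update g p c') q = L.left g q := by
  unfold left
  rcases hq : L.prv q with _ | t
  · rfl
  · rw [hq] at h
    simp only [Option.map_some]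
    rw [Function.update_of_ne]
    rintro rfl
    exact h rfl

theorem right_update_of_ne {p q : P} (c' : C) (h : L.nxt q ≠ some p) :
    L.right (Function.update g p c') q = L.right g q :=
  L.reverse.left_update_of_ne c' h

theorem score_update_self [Fintype V] (hg : E.IsScheme g) (p : P) (c' : C) (hc : E.party c' = p) :
    E.score (Function.update g p c') p = E.localScore (L.left g p) c' (L.right g p) := by
  rw [L.score_eq (isScheme_update hg p c' hc), left_update_of_ne, right_update_of_ne,
    Function.update_self]
  · intro h
    have := L.pos_nxt _ _ h
    omega
  · intro h
    have := L.pos_prv h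
    omega

theorem score_update_prv [Fintype V] (hg : E.IsScheme g) (p q : P) (c' : C) (hc : E.party c' = p)
    (hq : L.prv p = some q) :
    E.score (Function.update g p c') q = E.localScore (L.left₂ g p) (g q) (some c') := by
  have hpos := L.pos_prv hq
  rw [L.score_eq (isScheme_update hg p c' hc), left_update_of_ne, Function.update_of_ne]
  · simp [right, left, left₂, hq, (L.nxt_iff q p).mpr hq]
  · rintro rfl
    omega
  · intro h
    have := L.pos_prv h
    omega

theorem score_update_nxt [Fintype V] (hg : E.IsScheme g) (p q : P) (c' : C) (hc : E.party c' = p)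
    (hq : L.nxt p = some q) :
    E.score (Function.update g p c') q = E.localScore (some c') (g q) (L.right₂ g p) := by
  rw [localScore_comm]
  exact L.reverse.score_update_prv hg p q c' hc hq

/-- The nominee of `p` enters only the local scores of `p` and of its two neighbours. -/
theorem score_update_of_ne [Fintype V] (hg : E.IsScheme g) (p q : P) (c' : C) (hc : E.party c' = p)
    (h : q ≠ p) (h₁ : L.prv p ≠ some q) (h₂ : L.nxt p ≠ some q) :
    E.score (Function.update g p c') q = E.score g q := by
  rw [L.score_eq (isScheme_update hg p c' hc), L.score_eq hg, left_update_of_ne,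
    right_update_of_ne, Function.update_of_ne h]
  · rwa [Ne, L.nxt_iff]
  · rwa [Ne, ← L.nxt_iff]

end Deviation

theorem beatsFromAfar_iff {g : P → C} (hg : E.IsScheme g) (p x : P) (m s : ℕ) :
    E.BeatsFromAfar x m (L.left g p) (g p) (L.right g p) s ↔
      x ≠ p ∧ L.prv p ≠ some x ∧ L.nxt p ≠ some x ∧ s < m := by
  unfold BeatsFromAfar left right
  rw [hg p]
  refine and_congr_right fun _ => and_congr ?_ (and_congr_left fun _ => ?_)
  · rcases L.prv p with _ | q
    · simp
    · simp [hg q, eq_comm]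
  · rcases L.nxt p with _ | q
    · simp
    · simp [hg q, eq_comm]

/-- The consistency clauses of the windows force the guessed numbers to be the true scores of `w`,
`x` and `y`. Whichever disjunct a window offers against a deviation then names a party that still
beats it: the new score of a neighbour can be read off the five nominees, and a party farther away
keeps its score. -/
theorem isNashEquilibrium_of_goodAt [Fintype V] [DecidableEq P] {g : P → C}
    (hg : E.IsScheme g) {w x y : P}
    {m k l : ℕ} (h : ∀ p, L.GoodAt w m x k y l g p) :
    E.IsNashEquilibrium g ∧ E.IsWinner g w := by
  have hle : ∀ p, E.score g p ≤ m := fun p => by rw [L.score_eq hg]; exact (h p).1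
  have hw : E.score g w = m := by rw [L.score_eq hg]; exact (h w).2.1 (hg w)
  have hx : E.score g x = k := by rw [L.score_eq hg]; exact (h x).2.2.1 (hg x)
  have hy : E.score g y = l := by rw [L.score_eq hg]; exact (h y).2.2.2.1 (hg y)
  refine ⟨⟨hg, ?_⟩, fun q => hw ▸ hle q⟩
  rintro p c' ⟨hc, -, hnw, hwin⟩
  have hfar : ∀ z n, E.score g z = n →
      E.BeatsFromAfar z n (L.left g p) (g p) (L.right g p)
        (E.localScore (L.left g p) c' (L.right g p)) → False := by
    intro z n hz hb
    rw [L.beatsFromAfar_iff hg] at hb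
    have := hwin z
    rw [L.score_update_self hg p c' hc, L.score_update_of_ne hg p z c' hc hb.1 hb.2.1 hb.2.2.1,
      hz] at this
    omega
  rcases (h p).2.2.2.2 with hm | hm
  · exact hnw fun q => by rw [L.score_eq hg p, hm]; exact hle q
  · rcases hm c' (by rw [hc, hg p]) with ⟨b, hb, hlt⟩ | ⟨d, hd, hlt⟩ | hb | hb | hb
    · obtain ⟨q, hq, rfl⟩ := Option.map_eq_some_iff.mp hb
      have := hwin q
      rw [L.score_update_self hg p c' hc, L.score_update_prv hg p q c' hc hq] at this
      omega
    · obtain ⟨q, hq, rfl⟩ := Option.map_eq_some_iff.mp hd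
      have := hwin q
      rw [L.score_update_self hg p c' hc, L.score_update_nxt hg p q c' hc hq] at this
      omega
    · exact hfar w m hw hb
    · exact hfar x k hx hb
    · exact hfar y l hy hb

/-- If a deviation of `p` is beaten from afar, then `w` beats it as well, unless `w` is adjacent to
`p`. That exception concerns only the two neighbours of `w`, and each receives a reference party of
its own. -/
theorem exists_goodAt [Fintype V] [DecidableEq P] [Fintype P] {g : P → C}
    (hg : E.IsNashEquilibrium g) {w : P}
    (hw : E.IsWinner g w) : ∃ x y, ∀ p,
      L.GoodAt w (E.score g w) x (E.score g x) y (E.score g y) g p := by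
  classical
  obtain ⟨hs, hn⟩ := hg
  have hmax : ∀ i, ∃ x, ∀ j, j ≠ i → L.prv i ≠ some j → L.nxt i ≠ some j →
      x ≠ i ∧ L.prv i ≠ some x ∧ L.nxt i ≠ some x ∧ E.score g j ≤ E.score g x := by
    intro i
    by_cases hne : (Finset.univ.filter fun j =>
        j ≠ i ∧ L.prv i ≠ some j ∧ L.nxt i ≠ some j).Nonempty
    · obtain ⟨x, hx, hx'⟩ := Finset.exists_max_image _ (E.score g) hne
      simp only [Finset.mem_filter, Finset.mem_univ, true_and] at hx hx'
      exact ⟨x, fun j h₁ h₂ h₃ => ⟨hx.1, hx.2.1, hx.2.2, hx' j ⟨h₁, h₂, h₃⟩⟩⟩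
    -- With no party far from `i` the requirement is vacuous, and `w` is a dummy.
    · refine ⟨w, fun j h₁ h₂ h₃ => absurd ⟨j, ?_⟩ hne⟩
      simp [h₁, h₂, h₃]
  choose far hfar using hmax
  -- `x` serves the successor of `w` and `y` its predecessor; where such a neighbour is missing, the
  -- default `w` is never consulted as a substitute witness.
  refine ⟨((L.nxt w).map far).getD w, ((L.prv w).map far).getD w, fun p => ?_⟩
  have hsc := L.score_eq hs p
  refine ⟨hsc ▸ hw p, ?_, ?_, ?_, ?_⟩
  · rintro h; rw [← hsc, ← h, hs p]
  · rintro h; rw [← hsc, ← h, hs p]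
  · rintro h; rw [← hsc, ← h, hs p]
  · rw [← hsc]
    by_cases hp : E.score g p = E.score g w
    · exact Or.inl hp
    right
    intro c' hc
    rw [hs p] at hc
    have hpw : ¬ E.IsWinner g p := fun h => hp (le_antisymm (hw p) (h w))
    have hnot : ¬ E.IsWinner (Function.update g p c') p := by
      intro h
      by_cases hcp : c' = g p
      · subst hcp
        rw [Function.update_eq_self] at h
        exact hpw h
      · exact hn p c' ⟨hc, hcp, hpw, h⟩
    unfold IsWinner at hnot
    push Not at hnot
    obtain ⟨q, hq⟩ := hnot
    rw [L.score_update_self hs p c' hc] at hq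
    have hqp : q ≠ p := by
      rintro rfl
      rw [L.score_update_self hs q c' hc] at hq
      omega
    by_cases h₁ : L.prv p = some q
    · left
      rw [L.score_update_prv hs p q c' hc h₁] at hq
      exact ⟨g q, by simp [left, h₁], hq⟩
    by_cases h₂ : L.nxt p = some q
    · right; left
      rw [L.score_update_nxt hs p q c' hc h₂] at hq
      exact ⟨g q, by simp [right, h₂], hq⟩
    right; right
    rw [L.score_update_of_ne hs p q c' hc hqp h₁ h₂] at hq
    simp only [L.beatsFromAfar_iff hs]
    have hwp : w ≠ p := by rintro rfl; exact hp rfl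
    -- Here `p` is the successor of `w`, so `x` is the best party far from `p` and beats the
    -- deviation because `q` does.
    by_cases h₃ : L.prv p = some w
    · right; left
      have h₄ := (L.nxt_iff w p).mpr h₃
      obtain ⟨e₁, e₂, e₃, e₄⟩ := hfar p q hqp h₁ h₂
      simp only [h₄, Option.map_some, Option.getD_some]
      exact ⟨e₁, e₂, e₃, by omega⟩
    by_cases h₄ : L.nxt p = some w
    · right; right
      have h₅ := (L.nxt_iff p w).mp h₄
      obtain ⟨e₁, e₂, e₃, e₄⟩ := hfar p q hqp h₁ h₂
      simp only [h₅, Option.map_some, Option.getD_some]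
      exact ⟨e₁, e₂, e₃, by omega⟩
    · left
      exact ⟨hwp, h₃, h₄, lt_of_lt_of_le hq (hw q)⟩

end Layout

/-- `d` may follow the nominee `c`, when `c` has been reached from `b`. -/
def MayFollow (b c d : Option C) : Prop :=
  match c with
  | none => d = none
  | some c => (d = none ∧ ∀ q, E.Adj (E.party c) q → ∃ b', b = some b' ∧ E.party b' = q) ∨
      ∃ d', d = some d' ∧ E.Adj (E.party c) (E.party d') ∧
        ∀ b', b = some b' → E.party b' ≠ E.party d'

/-- The nominees `a`, `b`, `c`, `d` can be continued to the end of the path of the interaction graph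
in fewer than `t` steps. -/
def Continues [Fintype V] (w : P) (m : ℕ) (x : P) (k : ℕ) (y : P) (l : ℕ) :
    ℕ → Option C → Option C → Option C → Option C → Prop
  | 0, _, _, _, _ => False
  | _ + 1, _, _, none, _ => True
  | t + 1, a, b, some c, d => ∃ e, E.MayFollow (some c) d e ∧ E.GoodWindow w m x k y l a b c d e ∧
      Continues w m x k y l t b (some c) d e

/-- A party with at most one neighbour. -/
def IsEndpoint (p : P) : Prop := ∀ q q', E.Adj p q → E.Adj p q' → q = q'

/-- Every path of the interaction graph has fewer than `t` parties and admits suitable nominees. -/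
def PathsFeasible [Fintype V] (w : P) (m : ℕ) (x : P) (k : ℕ) (y : P) (l t : ℕ) : Prop :=
  ∀ p, E.IsEndpoint p → ∃ c d, E.party c = p ∧ E.MayFollow none (some c) d ∧
    E.Continues w m x k y l t none none (some c) d

/-! ### Gluing windows along the paths -/

namespace Layout

variable {E}

theorem mayFollow (L : Layout E) {g : P → C} (hg : E.IsScheme g) (p : P) :
    E.MayFollow (L.left g p) (some (g p)) (L.right g p) := by
  unfold MayFollow
  simp only [hg p]
  rcases hp : L.nxt p with _ | q
  · left
    refine ⟨by simp [right, hp], fun q hq => ?_⟩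
    rw [L.adj_iff, hp] at hq
    rcases hq with hq | hq
    · simp at hq
    · exact ⟨g q, by simp [left, hq], hg q⟩
  · right
    refine ⟨g q, by simp [right, hp], ?_, fun b hb => ?_⟩
    · rw [hg q, L.adj_iff]; exact Or.inl hp
    · obtain ⟨t, ht, rfl⟩ := Option.map_eq_some_iff.mp hb
      rw [hg t, hg q]
      rintro rfl
      have h₁ := L.pos_prv ht
      have h₂ := L.pos_nxt _ _ hp
      omega

variable {w x y : P} {m k l : ℕ}

/-- Shifting the window from a party to its successor matches one unfolding of `Continues`; the
counter outlasts the path because positions increase by one and stay below `bound`. -/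
theorem continues_of_goodAt [Fintype V] (L : Layout E) {g : P → C} (hg : E.IsScheme g)
    (h : ∀ p, L.GoodAt w m x k y l g p) : ∀ (t : ℕ) (p : P), L.bound - L.pos p < t →
      E.Continues w m x k y l t (L.left₂ g p) (L.left g p) (some (g p)) (L.right g p) := by
  intro t
  induction t with
  | zero =>
    intro p hp
    omega
  | succ t ih =>
    intro p hp
    have hlt := L.pos_lt p
    rcases hq : L.nxt p with _ | q
    · refine ⟨L.right₂ g p, ?_, h p, ?_⟩
      · simp [MayFollow, right, right₂, hq]
      · rw [show L.right g p = none by simp [right, hq]]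
        -- `pos p < bound` leaves one unit for the step past the end of the path, since `Continues`
        -- fails at zero.
        obtain ⟨t, rfl⟩ := Nat.exists_eq_succ_of_ne_zero (by omega : t ≠ 0)
        trivial
    · have hpos := L.pos_nxt _ _ hq
      have hprv := (L.nxt_iff p q).mp hq
      have h₁ : L.right g p = some (g q) := by simp [right, hq]
      have h₂ : L.right₂ g p = L.right g q := by simp [right, right₂, hq]
      have h₃ : L.left g q = some (g p) := by simp [left, hprv]
      have h₄ : L.left₂ g q = L.left g p := by simp [left, left₂, hprv]
      refine ⟨L.right₂ g p, ?_, h p, ?_⟩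
      · rw [h₁, h₂, ← h₃]
        exact L.mayFollow hg q
      · have := ih q (by omega)
        rwa [h₃, h₄, ← h₁, ← h₂] at this

theorem feasible_of_prv_eq_none [Fintype V] (L : Layout E) {g : P → C} (hg : E.IsScheme g)
    (h : ∀ p, L.GoodAt w m x k y l g p) {t : ℕ} (ht : L.bound < t) {p : P} (hp : L.prv p = none) :
    ∃ c d, E.party c = p ∧ E.MayFollow none (some c) d ∧
      E.Continues w m x k y l t none none (some c) d := by
  have h₁ : L.left g p = none := by simp [left, hp]
  have h₂ : L.left₂ g p = none := by simp [left₂, hp]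
  refine ⟨g p, L.right g p, hg p, ?_, ?_⟩
  · rw [← h₁]; exact L.mayFollow hg p
  · have := L.continues_of_goodAt hg h t p (by omega)
    rwa [h₁, h₂] at this

/-- Feasibility is demanded from both ends of every path, as the graph carries no direction. An
endpoint with a predecessor has no successor, so it is a starting point in the reversed layout. -/
theorem pathsFeasible_of_goodAt [Fintype V] (L : Layout E) {g : P → C} (hg : E.IsScheme g)
    (h : ∀ p, L.GoodAt w m x k y l g p) {t : ℕ} (ht : L.bound < t) :
    E.PathsFeasible w m x k y l t := by
  intro p hp
  rcases h₁ : L.prv p with _ | q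
  · exact L.feasible_of_prv_eq_none hg h ht h₁
  · refine L.reverse.feasible_of_prv_eq_none hg (fun p => (h p).symm) ht ?_
    change L.nxt p = none
    rcases h₂ : L.nxt p with _ | q'
    · rfl
    · have := hp q q' ((L.adj_iff p q).mpr (Or.inr h₁)) ((L.adj_iff p q').mpr (Or.inl h₂))
      subst this
      have h₃ := L.pos_prv h₁
      have h₄ := L.pos_nxt _ _ h₂
      omega

theorem isEndpoint_of_prv_eq_none (L : Layout E) {p : P} (hp : L.prv p = none) :
    E.IsEndpoint p := by
  intro q q' hq hq'
  rw [L.adj_iff, hp] at hq hq'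
  simp only [reduceCtorEq, or_false] at hq hq'
  rw [hq] at hq'
  exact Option.some.inj hq'

theorem left_congr (L : Layout E) {g g' : P → C} {p : P}
    (h : ∀ q, L.pos q < L.pos p → g q = g' q) : L.left g p = L.left g' p := by
  unfold left
  rcases hq : L.prv p with _ | q
  · rfl
  · have := L.pos_prv hq
    simp [h q (by omega)]

theorem left₂_congr (L : Layout E) {g g' : P → C} {p : P}
    (h : ∀ q, L.pos q < L.pos p → g q = g' q) : L.left₂ g p = L.left₂ g' p := by
  unfold left₂
  rcases hq : L.prv p with _ | q
  · rfl
  · have := L.pos_prv hq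
    exact L.left_congr fun q' hq' => h q' (by omega)

/-- The nominees are chosen from left to right: `PathsFeasible` opens each new path and `Continues`
extends the current one. Nominees at positions below `t` are frozen. The two statements, for a
position that does not continue a path and for a position whose nominee and successor are
prescribed, feed each other, so they are proved together by induction on the number of remaining
positions. -/
theorem exists_goodAt_from [Fintype V] (L : Layout E) [DecidableEq P] {s : ℕ}
    (hf : E.PathsFeasible w m x k y l s) :
    ∀ (i t : ℕ), L.bound - t = i →
    (∀ g₀ : P → C, E.IsScheme g₀ → (∀ p, L.pos p = t → L.prv p = none) →
      ∃ g, E.IsScheme g ∧ (∀ q, L.pos q < t → g q = g₀ q) ∧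
        ∀ q, t ≤ L.pos q → L.GoodAt w m x k y l g q) ∧
    (∀ g₀ : P → C, E.IsScheme g₀ → ∀ p, L.pos p = t → ∀ j c d, E.party c = p →
      E.MayFollow (L.left g₀ p) (some c) d →
      E.Continues w m x k y l j (L.left₂ g₀ p) (L.left g₀ p) (some c) d →
      ∃ g, E.IsScheme g ∧ (∀ q, L.pos q < t → g q = g₀ q) ∧ g p = c ∧ L.right g p = d ∧
        ∀ q, t ≤ L.pos q → L.GoodAt w m x k y l g q) := by
  intro i
  induction i with
  | zero =>
    intro t ht
    refine ⟨fun g₀ h₀ _ => ⟨g₀, h₀, fun _ _ => rfl, fun q hq => ?_⟩, fun g₀ h₀ p hp => ?_⟩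
    · have := L.pos_lt q
      omega
    · have := L.pos_lt p
      omega
  | succ i ih =>
    intro t ht
    obtain ⟨ih₁, ih₂⟩ := ih (t + 1) (by omega)
    have second : ∀ g₀ : P → C, E.IsScheme g₀ → ∀ p, L.pos p = t → ∀ j c d, E.party c = p →
        E.MayFollow (L.left g₀ p) (some c) d →
        E.Continues w m x k y l j (L.left₂ g₀ p) (L.left g₀ p) (some c) d →
        ∃ g, E.IsScheme g ∧ (∀ q, L.pos q < t → g q = g₀ q) ∧ g p = c ∧ L.right g p = d ∧
          ∀ q, t ≤ L.pos q → L.GoodAt w m x k y l g q := by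
      intro g₀ h₀ p hp j c d hc hfol hcont
      obtain _ | j := j
      · exact hcont.elim
      obtain ⟨e, he, hwin, hcont'⟩ := hcont
      set g₁ := Function.update g₀ p c with hg₁
      have h₁ : E.IsScheme g₁ := isScheme_update h₀ p c hc
      have hagree : ∀ q, L.pos q < t → g₁ q = g₀ q := by
        intro q hq
        rw [hg₁, Function.update_of_ne]
        rintro rfl
        omega
      -- The window at `p` consists of two frozen nominees, of `c`, and of the next two, `d` and
      -- `e`: it is the window that `Continues` has checked.
      have hfinish : ∀ g : P → C, (∀ q, L.pos q < t + 1 → g q = g₁ q) → L.right g p = d →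
          L.right₂ g p = e → (∀ q, t + 1 ≤ L.pos q → L.GoodAt w m x k y l g q) →
          (∀ q, L.pos q < t → g q = g₀ q) ∧ g p = c ∧ L.right g p = d ∧
          ∀ q, t ≤ L.pos q → L.GoodAt w m x k y l g q := by
        intro g hga hr hr₂ hgood
        have hga' : ∀ q, L.pos q < t → g q = g₀ q := fun q hq =>
          (hga q (by omega)).trans (hagree q hq)
        have hgp : g p = c := by rw [hga p (by omega), hg₁, Function.update_self]
        refine ⟨hga', hgp, hr, fun q hq => ?_⟩
        rcases Nat.lt_or_ge t (L.pos q) with hlt | hge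
        · exact hgood q hlt
        · have hqp : q = p := L.pos_injective (by omega)
          subst hqp
          unfold GoodAt
          rw [hgp, hr, hr₂, L.left_congr (fun q' hq' => hga' q' (by omega)),
            L.left₂_congr (fun q' hq' => hga' q' (by omega))]
          exact hwin
      rcases d with _ | d
      -- Stopping is permitted only if every neighbour is the party of the previous nominee; a
      -- successor would then lie both before and after `p`.
      · have hn : L.nxt p = none := by
          rcases hq : L.nxt p with _ | q
          · rfl
          · simp only [MayFollow, reduceCtorEq, false_and, exists_false, or_false, hc] at hfol
            obtain ⟨b, hb, hbq⟩ := hfol.2 q ((L.adj_iff p q).mpr (Or.inl hq))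
            obtain ⟨t', ht', rfl⟩ := Option.map_eq_some_iff.mp hb
            rw [h₀ t'] at hbq
            subst hbq
            have e₁ := L.pos_prv ht'
            have e₂ := L.pos_nxt _ _ hq
            omega
        have he' : e = none := he
        obtain ⟨g, hg, hga, hgood⟩ := ih₁ g₁ h₁ (by
          intro p' hp'
          rcases hq : L.prv p' with _ | q
          · rfl
          · have e₁ := L.pos_prv hq
            have e₂ : q = p := L.pos_injective (by omega)
            subst e₂
            rw [(L.nxt_iff q p').mpr hq] at hn
            simp at hn)
        exact ⟨g, hg, hfinish g hga (by simp [right, hn]) (by simp [right₂, hn, he']) hgood⟩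
      · simp only [MayFollow, reduceCtorEq, false_and, false_or, Option.some.injEq, hc] at hfol
        obtain ⟨d', rfl, hadj, hback⟩ := hfol
        set q := E.party d with hq
        -- The party of `d` is adjacent to `p` and is not the one just visited, so it is the
        -- successor.
        have hnq : L.nxt p = some q := by
          rcases (L.adj_iff p q).mp hadj with h | h
          · exact h
          · exact absurd (h₀ q) (hback (g₀ q) (by simp [left, h]))
        have hpos := L.pos_nxt _ _ hnq
        have hprv := (L.nxt_iff p q).mp hnq
        have hl : L.left g₁ q = some c := by simp [left, hprv, hg₁]
        have hl₂ : L.left₂ g₁ q = L.left g₀ p := by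
          rw [← L.left_congr (fun q' hq' => hagree q' (by omega))]
          simp [left, left₂, hprv]
        obtain ⟨g, hg, hga, hgq, hgr, hgood⟩ := ih₂ g₁ h₁ q (by omega) j d e rfl
          (by rw [hl]; exact he) (by rw [hl, hl₂]; exact hcont')
        refine ⟨g, hg, hfinish g hga (by simp [right, hnq, hgq]) ?_ hgood⟩
        rw [← hgr]
        simp [right, right₂, hnq]
    refine ⟨fun g₀ h₀ hprv => ?_, second⟩
    -- A layout may leave positions unoccupied; such a position is skipped, and no path can cross
    -- it.
    by_cases hex : ∃ p, L.pos p = t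
    · obtain ⟨p, hp⟩ := hex
      have hp' := hprv p hp
      obtain ⟨c, d, hc, hfol, hcont⟩ := hf p (L.isEndpoint_of_prv_eq_none hp')
      have h₁ : L.left g₀ p = none := by simp [left, hp']
      have h₂ : L.left₂ g₀ p = none := by simp [left₂, hp']
      obtain ⟨g, hg, hga, -, -, hgood⟩ := second g₀ h₀ p hp s c d hc (by rwa [h₁]) (by rwa [h₁, h₂])
      exact ⟨g, hg, hga, hgood⟩
    · obtain ⟨g, hg, hga, hgood⟩ := ih₁ g₀ h₀ (by
        intro p' hp'
        rcases hq : L.prv p' with _ | q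
        · rfl
        · have := L.pos_prv hq
          exact absurd ⟨q, by omega⟩ hex)
      refine ⟨g, hg, fun q hq => hga q (by omega), fun q hq => hgood q ?_⟩
      rcases Nat.lt_or_ge t (L.pos q) with h | h
      · exact h
      · exact absurd ⟨q, by omega⟩ hex

theorem exists_goodAt_of_pathsFeasible [Fintype V] (L : Layout E) [DecidableEq P]
    {s : ℕ} (hf : E.PathsFeasible w m x k y l s) :
    ∃ g, E.IsScheme g ∧ ∀ p, L.GoodAt w m x k y l g p := by
  obtain ⟨g₀, h₀⟩ := E.party_surjective.hasRightInverse
  obtain ⟨g, hg, -, hgood⟩ := (L.exists_goodAt_from hf L.bound 0 (by omega)).1 g₀ h₀ (by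
    intro p hp
    rcases hq : L.prv p with _ | q
    · rfl
    · have := L.pos_prv hq
      omega)
  exact ⟨g, hg, fun p => hgood p (Nat.zero_le _)⟩

end Layout

/-- The winners of equilibria are characterized by the feasibility of all paths. -/
theorem exists_isNashEquilibrium_isWinner_iff [Fintype P] [DecidableEq P] [Fintype V]
    (h : E.IsPartyAlignedSinglePeaked) (w : P) {n : ℕ} (hn : Fintype.card V < n)
    (hp : Fintype.card P < n) :
    (∃ g, E.IsNashEquilibrium g ∧ E.IsWinner g w) ↔
      ∃ m < n, ∃ x, ∃ k < n, ∃ y, ∃ l < n, E.PathsFeasible w m x k y l n := by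
  obtain ⟨L, hL⟩ := E.exists_layout h
  constructor
  · rintro ⟨g, hg, hw⟩
    obtain ⟨x, y, hgood⟩ := L.exists_goodAt hg hw
    have hlt : ∀ p, E.score g p < n := fun p => by
      rw [L.score_eq hg.1]
      exact (E.localScore_le _ _ _).trans_lt hn
    exact ⟨_, hlt w, x, _, hlt x, y, _, hlt y, L.pathsFeasible_of_goodAt hg.1 hgood (hL ▸ hp)⟩
  · rintro ⟨m, -, x, k, -, y, l, -, hf⟩
    obtain ⟨g, hg, hgood⟩ := L.exists_goodAt_of_pathsFeasible hf
    exact ⟨g, L.isNashEquilibrium_of_goodAt hg hgood⟩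

end Election

/-! ### The algorithm as a relational program -/

namespace CountFormula

variable {V J : Type} [DecidableEq V]

def or (φ ψ : CountFormula V J) : CountFormula V J := neg (and (neg φ) (neg ψ))

def imp (φ ψ : CountFormula V J) : CountFormula V J := neg (and φ (neg ψ))

def all (x : V) (φ : CountFormula V J) : CountFormula V J := neg (ex x (neg φ))

def eq (x y : V) : CountFormula V J := and (neg (lt x y)) (neg (lt y x))

section Holds

variable {n : ℕ} {S : J → List ℕ → Prop} {φ ψ : CountFormula V J} {ρ : V → ℕ} {x y : V}

theorem holds_lt : (lt x y).Holds n S ρ ↔ ρ x < ρ y := Iff.rfl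

theorem holds_rel {j : J} {xs : List V} : (rel j xs).Holds n S ρ ↔ S j (xs.map ρ) := Iff.rfl

theorem holds_neg : (neg φ).Holds n S ρ ↔ ¬ φ.Holds n S ρ := Iff.rfl

theorem holds_and : (and φ ψ).Holds n S ρ ↔ φ.Holds n S ρ ∧ ψ.Holds n S ρ := Iff.rfl

theorem holds_ex : (ex x φ).Holds n S ρ ↔ ∃ a < n, φ.Holds n S (Function.update ρ x a) := Iff.rfl

theorem holds_or : (or φ ψ).Holds n S ρ ↔ φ.Holds n S ρ ∨ ψ.Holds n S ρ := by
  simp only [or, Holds]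
  tauto

theorem holds_imp : (imp φ ψ).Holds n S ρ ↔ (φ.Holds n S ρ → ψ.Holds n S ρ) := by
  simp only [imp, Holds]
  tauto

theorem holds_all : (all x φ).Holds n S ρ ↔ ∀ a < n, φ.Holds n S (Function.update ρ x a) := by
  simp only [all, Holds]
  push Not
  rfl

theorem holds_eq : (eq x y).Holds n S ρ ↔ ρ x = ρ y := by
  simp only [eq, Holds]
  omega

end Holds

end CountFormula

namespace EquilibriumProg

/-- Variable names. -/
inductive Name
  | a | b | c | d | e | i | j | k | l | m | p | q | r | s | t | v | w | x | y | z
  deriving DecidableEq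

instance : Fintype Name :=
  ⟨{.a, .b, .c, .d, .e, .i, .j, .k, .l, .m, .p, .q, .r, .s, .t, .v, .w, .x, .y, .z},
    fun name => by cases name <;> simp⟩

/-- The relations that are computed. -/
inductive Sym
  | table | header | entry | party | cand | isParty | pref | alive | dep | adj | vote | score
  | follows | window | cont | ok
  deriving DecidableEq

instance : Fintype Sym :=
  ⟨{.table, .header, .entry, .party, .cand, .isParty, .pref, .alive, .dep, .adj, .vote, .score,
    .follows, .window, .cont, .ok}, fun x => by cases x <;> simp⟩

open CountFormula

/-- The order in which the relations are computed. -/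
def rank : Sym → ℕ
  | .table => 0
  | .header => 1
  | .entry => 2
  | .party => 3
  | .cand => 4
  | .isParty => 5
  | .pref => 6
  | .alive => 7
  | .dep => 8
  | .adj => 9
  | .vote => 10
  | .score => 11
  | .follows => 12
  | .window => 13
  | .cont => 14
  | .ok => 15

/-- The parameters of the relations. -/
def params : Sym → List Name
  | .table => [.x, .y, .z]
  | .header => [.r]
  | .entry => [.x, .y, .z]
  | .party => [.a, .p]
  | .cand => [.a]
  | .isParty => [.p]
  | .pref => [.v, .a, .b]
  | .alive => [.v, .a]
  | .dep => [.p, .q]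
  | .adj => [.p, .q]
  | .vote => [.l, .a, .r, .v]
  | .score => [.l, .a, .r, .m]
  | .follows => [.b, .c, .d]
  | .window => [.w, .m, .x, .k, .y, .l, .a, .b, .c, .d, .e]
  | .cont => [.w, .m, .x, .k, .y, .l, .a, .b, .c, .d]
  | .ok => [.w]

/-- The deviation of score `t` is beaten from afar by the party and the score in the given
variables. -/
def beats (party score : Name) : CountFormula Name Sym :=
  .and (.neg (.rel .party [.c, party])) <| .and (.neg (.rel .party [.b, party])) <|
    .and (.neg (.rel .party [.d, party])) (.lt .t score)

/-- The definitions of the relations; `header` singles out the row of the parties. -/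
def body (header : CountFormula Name Sym) : Sym → CountFormula Name Sym
  | .table => .rel .table [.x, .y, .z]
  | .header => header
  | .entry => .and (.rel .table [.x, .y, .z])
      (.neg (.ex .i (.and (.lt .i .z) (.rel .table [.x, .y, .i]))))
  | .party => .ex .r (.and (.rel .header [.r]) (.rel .entry [.r, .a, .p]))
  | .cand => .ex .p (.rel .party [.a, .p])
  | .isParty => .ex .a (.rel .party [.a, .p])
  | .pref => .ex .r <| .and (.rel .header [.r]) <| .and (.lt .r .v) <| .ex .i <| .ex .j <|
      .and (.lt .i .j) <| .and (.rel .entry [.v, .i, .a]) (.rel .entry [.v, .j, .b])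
  | .alive => .ex .r <| .and (.rel .header [.r]) <| .and (.lt .r .v) <|
      .and (.ex .i (.rel .entry [.v, .i, .a])) <|
      .all .q <| .imp (.rel .isParty [.q]) <| .or (.rel .party [.a, .q]) <|
      .ex .b (.and (.rel .party [.b, .q]) (.rel .pref [.v, .a, .b]))
  | .dep => .ex .v <| .ex .a <| .ex .b <| .and (.rel .party [.a, .p]) <|
      .and (.rel .party [.b, .q]) <| .and (.neg (.eq .p .q)) <|
      .and (.rel .alive [.v, .a]) (.rel .pref [.v, .b, .a])
  | .adj => .or (.rel .dep [.p, .q]) (.rel .dep [.q, .p])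
  | .vote => .and (.rel .alive [.v, .a]) <|
      .and (.imp (.rel .cand [.l]) (.rel .pref [.v, .a, .l]))
        (.imp (.rel .cand [.r]) (.rel .pref [.v, .a, .r]))
  | .score => .and (.rel .cand [.a]) <|
      .and (.cnt .v (.rel .vote [.l, .a, .r, .v]) (.lt .v .m))
        (.cnt .v (.lt .v .m) (.rel .vote [.l, .a, .r, .v]))
  | .follows => .or (.and (.neg (.rel .cand [.c])) (.neg (.rel .cand [.d]))) <|
      .and (.rel .cand [.c]) <| .or
        (.and (.neg (.rel .cand [.d])) <| .all .p <| .all .q <| .imp (.rel .party [.c, .p]) <|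
          .imp (.rel .adj [.p, .q]) (.rel .party [.b, .q]))
        (.ex .p <| .ex .q <| .and (.rel .party [.c, .p]) <| .and (.rel .party [.d, .q]) <|
          .and (.rel .adj [.p, .q]) (.neg (.rel .party [.b, .q])))
  | .window => .and (.rel .isParty [.w]) <| .and (.rel .isParty [.x]) <|
      .and (.rel .isParty [.y]) <| .ex .s <| .and (.rel .score [.b, .c, .d, .s]) <|
      .and (.neg (.lt .m .s)) <| .and (.imp (.rel .party [.c, .w]) (.eq .s .m)) <|
      .and (.imp (.rel .party [.c, .x]) (.eq .s .k)) <|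
      .and (.imp (.rel .party [.c, .y]) (.eq .s .l)) <| .or (.eq .s .m) <|
      .all .z <| .all .p <| .imp (.rel .party [.c, .p]) <| .imp (.rel .party [.z, .p]) <|
      .ex .t <| .and (.rel .score [.b, .z, .d, .t]) <|
      .or (.ex .i (.and (.rel .score [.a, .b, .z, .i]) (.lt .t .i))) <|
      .or (.ex .i (.and (.rel .score [.z, .d, .e, .i]) (.lt .t .i))) <|
      .or (beats .w .m) <| .or (beats .x .k) (beats .y .l)
  | .cont => .and (.rel .isParty [.w]) <| .and (.rel .isParty [.x]) <|
      .and (.rel .isParty [.y]) <| .or (.neg (.rel .cand [.c])) <|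
      .ex .e <| .and (.rel .follows [.c, .d, .e]) <|
      .and (.rel .window [.w, .m, .x, .k, .y, .l, .a, .b, .c, .d, .e])
        (.rel .cont [.w, .m, .x, .k, .y, .l, .b, .c, .d, .e])
  | .ok => .and (.rel .isParty [.w]) <| .ex .m <| .ex .x <| .and (.rel .isParty [.x]) <|
      .ex .k <| .ex .y <| .and (.rel .isParty [.y]) <| .ex .l <| .all .p <|
      .imp (.rel .isParty [.p]) <|
      .imp (.all .q <| .all .r <| .imp (.rel .adj [.p, .q]) <| .imp (.rel .adj [.p, .r])
        (.eq .q .r)) <|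
      .ex .c <| .ex .d <| .and (.rel .party [.c, .p]) <| .ex .z <|
      .and (.neg (.rel .cand [.z])) <| .and (.rel .follows [.z, .c, .d])
        (.rel .cont [.w, .m, .x, .k, .y, .l, .z, .z, .c, .d])

/-- Compute one relation from its definition. -/
def define (header : CountFormula Name Sym) (j : Sym) : RelProg Name Sym :=
  .assign j (params j) (body header j)

/-- The computation of all relations. -/
def program (header : CountFormula Name Sym) : RelProg Name Sym :=
  .seq (define header .header) <| .seq (define header .entry) <| .seq (define header .party) <|
  .seq (define header .cand) <| .seq (define header .isParty) <| .seq (define header .pref) <|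
  .seq (define header .alive) <| .seq (define header .dep) <| .seq (define header .adj) <|
  .seq (define header .vote) <| .seq (define header .score) <| .seq (define header .follows) <|
  .seq (define header .window) <| .seq (.assign .cont (params .cont) (.lt .a .a)) <|
  .seq (.rep (define header .cont)) (define header .ok)

theorem wellFormed_body {header : CountFormula Name Sym}
    (h : header.WellFormed fun j => (params j).length) (j : Sym) :
    (body header j).WellFormed fun j => (params j).length := by
  cases j <;> first
    | exact h
    | simp [body, beats, CountFormula.WellFormed, params, CountFormula.or, CountFormula.imp,
        CountFormula.all, CountFormula.eq]

theorem wellFormed_program {header : CountFormula Name Sym}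
    (h : header.WellFormed fun j => (params j).length) :
    (program header).WellFormed fun j => (params j).length := by
  simp [program, define, RelProg.WellFormed, wellFormed_body h, CountFormula.WellFormed]

/-! #### Semantics -/

/-- The object numbered `a`, if there is one. -/
def obj (N a : ℕ) : Option (Fin N) := if h : a < N then some ⟨a, h⟩ else none

@[simp] theorem obj_val {N : ℕ} (a : Fin N) : obj N a = some a := by simp [obj]

theorem obj_eq_some {N a : ℕ} {o : Fin N} : obj N a = some o ↔ (o : ℕ) = a := by
  unfold obj
  split_ifs with h
  · rw [Option.some.injEq, Fin.ext_iff]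
    exact eq_comm
  · simp only [false_iff]
    rintro rfl
    exact h o.2

theorem obj_eq_none {N a : ℕ} : obj N a = none ↔ N ≤ a := by
  unfold obj
  split_ifs with h
  · simpa using h
  · simpa using h

/-- Every number from `N` on codes an absent object, and `N` itself is such a code within the range
of the quantifiers. -/
theorem exists_obj_eq {N n : ℕ} (h : N < n) (o : Option (Fin N)) : ∃ a < n, obj N a = o := by
  rcases o with _ | o
  · exact ⟨N, h, obj_eq_none.mpr le_rfl⟩
  · exact ⟨o, o.2.trans h, obj_val o⟩

/-- The table `rows` lists the instance `I`: the parties in row `h`, and the voters in the rows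
after it. -/
structure Lists (I : Instance) (n h : ℕ) (rows : List (List ℕ)) : Prop where
  cand_lt : I.numCandidates < n
  voter_lt : h + I.numVoters < n
  value_lt : ∀ x y z : ℕ, (rows[x]?.bind fun r => r[y]?) = some z → z < n
  header_iff : ∀ a p : ℕ, (rows[h]?.bind fun r => r[a]?) = some p ↔
    ∃ o : Fin I.numCandidates, (o : ℕ) = a ∧ (I.party o : ℕ) = p
  voter_iff : ∀ u i a : ℕ, (rows[h + 1 + u]?.bind fun r => r[i]?) = some a ↔
    ∃ (o : Fin I.numVoters) (r : Fin I.numCandidates),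
      (o : ℕ) = u ∧ (r : ℕ) = i ∧ (I.ranking o r : ℕ) = a

variable (I : Instance) (n h : ℕ) (rows : List (List ℕ))

/-- The intended meaning of the relations. -/
def Meaning : Sym → List ℕ → Prop
  | .table, l => tableLe rows l
  | .header, [r] => r = h
  | .entry, [x, y, z] => (rows[x]?.bind fun r => r[y]?) = some z
  | .party, [a, p] => ∃ o : Fin I.numCandidates, (o : ℕ) = a ∧ (I.party o : ℕ) = p
  | .cand, [a] => a < I.numCandidates
  | .isParty, [p] => p < I.numParties
  | .pref, [v, a, b] => ∃ (v' : Fin I.numVoters) (a' b' : Fin I.numCandidates),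
      h + 1 + (v' : ℕ) = v ∧ (a' : ℕ) = a ∧ (b' : ℕ) = b ∧ I.election.prefers v' a' b'
  | .alive, [v, a] => ∃ (v' : Fin I.numVoters) (a' : Fin I.numCandidates),
      h + 1 + (v' : ℕ) = v ∧ (a' : ℕ) = a ∧ I.election.Alive v' a'
  | .dep, [p, q] => ∃ p' q' : Fin I.numParties, (p' : ℕ) = p ∧ (q' : ℕ) = q ∧
      I.election.DependsOn p' q'
  | .adj, [p, q] => ∃ p' q' : Fin I.numParties, (p' : ℕ) = p ∧ (q' : ℕ) = q ∧ I.election.Adj p' q'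
  | .vote, [l, a, r, v] => ∃ (v' : Fin I.numVoters) (a' : Fin I.numCandidates),
      h + 1 + (v' : ℕ) = v ∧ (a' : ℕ) = a ∧
      I.election.VotesLocally (obj _ l) a' (obj _ r) v'
  | .score, [l, a, r, m] => ∃ a' : Fin I.numCandidates, (a' : ℕ) = a ∧
      I.election.localScore (obj _ l) a' (obj _ r) = m
  | .follows, [b, c, d] => I.election.MayFollow (obj _ b) (obj _ c) (obj _ d)
  | .window, [w, m, x, k, y, l, a, b, c, d, e] => ∃ (w' x' y' : Fin I.numParties)
      (c' : Fin I.numCandidates), (w' : ℕ) = w ∧ (x' : ℕ) = x ∧ (y' : ℕ) = y ∧ (c' : ℕ) = c ∧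
      I.election.GoodWindow w' m x' k y' l (obj _ a) (obj _ b) c' (obj _ d) (obj _ e)
  | .cont, [w, m, x, k, y, l, a, b, c, d] => ∃ w' x' y' : Fin I.numParties,
      (w' : ℕ) = w ∧ (x' : ℕ) = x ∧ (y' : ℕ) = y ∧ I.election.Continues w' m x' k y' l n (obj _ a) (obj _ b) (obj _ c) (obj _ d)
  | .ok, [w] => ∃ w' : Fin I.numParties, (w' : ℕ) = w ∧ ∃ m < n, ∃ x, ∃ k < n, ∃ y, ∃ l < n,
      I.election.PathsFeasible w' m x k y l n
  | _, _ => False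

/-- The relations of rank less than `t` have their intended meaning. -/
def Computed (t : ℕ) (S : Sym → List ℕ → Prop) : Prop :=
  ∀ j, rank j < t → ∀ l, l.length = (params j).length → (S j l ↔ Meaning I n h rows j l)

theorem rank_injective : Function.Injective rank := by
  intro i j
  cases i <;> cases j <;> simp [rank]

variable {I n h rows} {S : Sym → List ℕ → Prop} {header : CountFormula Name Sym}

/-- Relations are assigned by increasing rank, so an assignment never disturbs the ones it has to
preserve. -/
theorem Computed.update {j : Sym} (hS : Computed I n h rows (rank j) S) {f : List ℕ → Prop}
    (hf : ∀ l, l.length = (params j).length → (f l ↔ Meaning I n h rows j l)) :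
    Computed I n h rows (rank j + 1) (Function.update S j f) := by
  intro i hi l hl
  by_cases hij : i = j
  · subst hij
    rw [Function.update_self]
    exact hf l hl
  · rw [Function.update_of_ne hij]
    have : rank i ≠ rank j := fun e => hij (rank_injective e)
    exact hS i (by omega) l hl

/-! ### Unfolding relations that are already computed -/

section Lookup

variable {t : ℕ}

theorem Computed.table_iff (hS : Computed I n h rows t S) (ht : 0 < t) (x y z : ℕ) :
    S .table [x, y, z] ↔ ∃ v, (rows[x]?.bind fun r => r[y]?) = some v ∧ v ≤ z :=
  hS .table ht [x, y, z] rfl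

theorem Computed.header_iff (hS : Computed I n h rows t S) (ht : 1 < t) (r : ℕ) :
    S .header [r] ↔ r = h :=
  hS .header ht [r] rfl

theorem Computed.entry_iff (hS : Computed I n h rows t S) (ht : 2 < t) (x y z : ℕ) :
    S .entry [x, y, z] ↔ (rows[x]?.bind fun r => r[y]?) = some z :=
  hS .entry ht [x, y, z] rfl

theorem Computed.party_iff (hS : Computed I n h rows t S) (ht : 3 < t) (a p : ℕ) :
    S .party [a, p] ↔ ∃ o : Fin I.numCandidates, (o : ℕ) = a ∧ (I.party o : ℕ) = p :=
  hS .party ht [a, p] rfl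

theorem Computed.cand_iff (hS : Computed I n h rows t S) (ht : 4 < t) (a : ℕ) :
    S .cand [a] ↔ a < I.numCandidates :=
  hS .cand ht [a] rfl

theorem Computed.isParty_iff (hS : Computed I n h rows t S) (ht : 5 < t) (p : ℕ) :
    S .isParty [p] ↔ p < I.numParties :=
  hS .isParty ht [p] rfl

theorem Computed.pref_iff (hS : Computed I n h rows t S) (ht : 6 < t) (v a b : ℕ) :
    S .pref [v, a, b] ↔ ∃ (v' : Fin I.numVoters) (a' b' : Fin I.numCandidates),
      h + 1 + (v' : ℕ) = v ∧ (a' : ℕ) = a ∧ (b' : ℕ) = b ∧ I.election.prefers v' a' b' :=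
  hS .pref ht [v, a, b] rfl

theorem Computed.alive_iff (hS : Computed I n h rows t S) (ht : 7 < t) (v a : ℕ) :
    S .alive [v, a] ↔ ∃ (v' : Fin I.numVoters) (a' : Fin I.numCandidates),
      h + 1 + (v' : ℕ) = v ∧ (a' : ℕ) = a ∧ I.election.Alive v' a' :=
  hS .alive ht [v, a] rfl

theorem Computed.dep_iff (hS : Computed I n h rows t S) (ht : 8 < t) (p q : ℕ) :
    S .dep [p, q] ↔ ∃ p' q' : Fin I.numParties, (p' : ℕ) = p ∧ (q' : ℕ) = q ∧
      I.election.DependsOn p' q' :=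
  hS .dep ht [p, q] rfl

theorem Computed.adj_iff (hS : Computed I n h rows t S) (ht : 9 < t) (p q : ℕ) :
    S .adj [p, q] ↔ ∃ p' q' : Fin I.numParties, (p' : ℕ) = p ∧ (q' : ℕ) = q ∧
      I.election.Adj p' q' :=
  hS .adj ht [p, q] rfl

theorem Computed.vote_iff (hS : Computed I n h rows t S) (ht : 10 < t) (l a r v : ℕ) :
    S .vote [l, a, r, v] ↔ ∃ (v' : Fin I.numVoters) (a' : Fin I.numCandidates),
      h + 1 + (v' : ℕ) = v ∧ (a' : ℕ) = a ∧
        I.election.VotesLocally (obj _ l) a' (obj _ r) v' :=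
  hS .vote ht [l, a, r, v] rfl

theorem Computed.score_iff (hS : Computed I n h rows t S) (ht : 11 < t) (l a r m : ℕ) :
    S .score [l, a, r, m] ↔ ∃ a' : Fin I.numCandidates, (a' : ℕ) = a ∧
      I.election.localScore (obj _ l) a' (obj _ r) = m :=
  hS .score ht [l, a, r, m] rfl

theorem Computed.follows_iff (hS : Computed I n h rows t S) (ht : 12 < t) (b c d : ℕ) :
    S .follows [b, c, d] ↔ I.election.MayFollow (obj _ b) (obj _ c) (obj _ d) :=
  hS .follows ht [b, c, d] rfl

theorem Computed.window_iff (hS : Computed I n h rows t S) (ht : 13 < t)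
    (w m x k y l a b c d e : ℕ) :
    S .window [w, m, x, k, y, l, a, b, c, d, e] ↔ ∃ (w' x' y' : Fin I.numParties)
      (c' : Fin I.numCandidates), (w' : ℕ) = w ∧ (x' : ℕ) = x ∧ (y' : ℕ) = y ∧ (c' : ℕ) = c ∧
      I.election.GoodWindow w' m x' k y' l (obj _ a) (obj _ b) c' (obj _ d) (obj _ e) :=
  hS .window ht [w, m, x, k, y, l, a, b, c, d, e] rfl

theorem Computed.cont_iff (hS : Computed I n h rows t S) (ht : 14 < t)
    (w m x k y l a b c d : ℕ) :
    S .cont [w, m, x, k, y, l, a, b, c, d] ↔ ∃ w' x' y' : Fin I.numParties, (w' : ℕ) = w ∧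
      (x' : ℕ) = x ∧ (y' : ℕ) = y ∧
      I.election.Continues w' m x' k y' l n (obj _ a) (obj _ b) (obj _ c) (obj _ d) :=
  hS .cont ht [w, m, x, k, y, l, a, b, c, d] rfl

theorem Computed.ok_iff (hS : Computed I n h rows t S) (ht : 15 < t) (w : ℕ) :
    S .ok [w] ↔ ∃ w' : Fin I.numParties, (w' : ℕ) = w ∧ ∃ m < n, ∃ x, ∃ k < n, ∃ y, ∃ l < n,
      I.election.PathsFeasible w' m x k y l n :=
  hS .ok ht [w] rfl

end Lookup

end EquilibriumProg

/-! ### Correctness of the relations up to the local scores -/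

namespace EquilibriumProg

open CountFormula

variable {I : Instance} {n h : ℕ} {rows : List (List ℕ)} {S : Sym → List ℕ → Prop}
  {header : CountFormula Name Sym}

theorem Lists.numParties_lt (hI : Lists I n h rows) : I.numParties < n := by
  have := Fintype.card_le_of_surjective _ I.party_surjective
  simp only [Fintype.card_fin] at this
  exact this.trans_lt hI.cand_lt

theorem computed_header (hh : ∀ S ρ, header.Holds n S ρ ↔ ρ .r = h)
    (hS : Computed I n h rows 1 S) :
    Computed I n h rows 2 ((define header .header).run n S) := by
  refine Computed.update (j := .header) hS fun l hl => ?_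
  match l, hl with
  | [r], _ => simp [body, hh, params, RelProg.bindVars, Meaning]

/-- The table is upward closed in its last argument, so an entry is the least value recorded for its
cell; `value_lt` puts the true value within the range of the quantifier that tests minimality. -/
theorem computed_entry (hI : Lists I n h rows) (hS : Computed I n h rows 2 S) :
    Computed I n h rows 3 ((define header .entry).run n S) := by
  refine Computed.update (j := .entry) hS fun l hl => ?_
  match l, hl with
  | [x, y, z], _ =>
    have ht := hS.table_iff (by decide)
    simp only [body, params, RelProg.bindVars, Meaning, holds_and, holds_rel, holds_neg, holds_ex,
      holds_lt, List.map_cons, List.map_nil, Function.update_apply, reduceCtorEq, if_true, if_false,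
      ht]
    constructor
    · rintro ⟨⟨v, hv, hvz⟩, hmin⟩
      rcases hvz.lt_or_eq with hlt | rfl
      · exact absurd ⟨v, hI.value_lt _ _ _ hv, hlt, v, hv, le_rfl⟩ hmin
      · exact hv
    · intro hz
      refine ⟨⟨z, hz, le_rfl⟩, ?_⟩
      rintro ⟨i, -, hi, v, hv, hvi⟩
      rw [hz, Option.some.injEq] at hv
      omega

theorem computed_party (hI : Lists I n h rows) (hS : Computed I n h rows 3 S) :
    Computed I n h rows 4 ((define header .party).run n S) := by
  refine Computed.update (j := .party) hS fun l hl => ?_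
  match l, hl with
  | [a, p], _ =>
    have hh := hS.header_iff (by decide)
    have he := hS.entry_iff (by decide)
    simp only [body, params, RelProg.bindVars, Meaning, holds_and, holds_rel, holds_ex,
      List.map_cons, List.map_nil, Function.update_apply, reduceCtorEq, if_true, if_false, hh, he]
    rw [← hI.header_iff]
    constructor
    · rintro ⟨_, -, rfl, hr⟩
      exact hr
    · exact fun hr => ⟨h, (Nat.le_add_right _ _).trans_lt hI.voter_lt, rfl, hr⟩

theorem computed_cand (hI : Lists I n h rows) (hS : Computed I n h rows 4 S) :
    Computed I n h rows 5 ((define header .cand).run n S) := by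
  refine Computed.update (j := .cand) hS fun l hl => ?_
  match l, hl with
  | [a], _ =>
    have hp := hS.party_iff (by decide)
    simp only [body, params, RelProg.bindVars, Meaning, holds_rel, holds_ex,
      List.map_cons, List.map_nil, Function.update_apply, reduceCtorEq, if_true, if_false, hp]
    constructor
    · rintro ⟨_, -, o, rfl, -⟩
      exact o.2
    · exact fun ha => ⟨_, (I.party ⟨a, ha⟩).2.trans hI.numParties_lt, ⟨a, ha⟩, rfl, rfl⟩

theorem computed_isParty (hI : Lists I n h rows) (hS : Computed I n h rows 5 S) :
    Computed I n h rows 6 ((define header .isParty).run n S) := by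
  refine Computed.update (j := .isParty) hS fun l hl => ?_
  match l, hl with
  | [p], _ =>
    have hp := hS.party_iff (by decide)
    simp only [body, params, RelProg.bindVars, Meaning, holds_rel, holds_ex,
      List.map_cons, List.map_nil, Function.update_apply, reduceCtorEq, if_true, if_false, hp]
    constructor
    · rintro ⟨_, -, o, -, rfl⟩
      exact (I.party o).2
    · intro hp
      obtain ⟨o, ho⟩ := I.party_surjective ⟨p, hp⟩
      exact ⟨o, o.2.trans hI.cand_lt, o, rfl, by rw [ho]⟩

/-- In the row of a voter the columns are the ranks, so comparing column numbers compares
candidates; a voter is identified with the number of the row. -/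
theorem computed_pref (hI : Lists I n h rows) (hS : Computed I n h rows 6 S) :
    Computed I n h rows 7 ((define header .pref).run n S) := by
  refine Computed.update (j := .pref) hS fun l hl => ?_
  match l, hl with
  | [v, a, b], _ =>
    have hh := hS.header_iff (by decide)
    have he := hS.entry_iff (by decide)
    simp only [body, params, RelProg.bindVars, Meaning, holds_and, holds_rel, holds_ex, holds_lt,
      List.map_cons, List.map_nil, Function.update_apply, reduceCtorEq, if_true, if_false, hh, he]
    constructor
    · rintro ⟨_, -, rfl, hv, i, -, j, -, hij, hi, hj⟩
      obtain ⟨u, rfl⟩ := Nat.exists_eq_add_of_le (Nat.succ_le_of_lt hv)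
      obtain ⟨o, r, rfl, rfl, rfl⟩ := (hI.voter_iff _ _ _).mp hi
      obtain ⟨o', r', ho, rfl, rfl⟩ := (hI.voter_iff _ _ _).mp hj
      obtain rfl := Fin.ext ho
      refine ⟨o', _, _, rfl, rfl, rfl, ?_⟩
      change (I.ranking o').symm _ < (I.ranking o').symm _
      rw [Equiv.symm_apply_apply, Equiv.symm_apply_apply]
      exact hij
    · rintro ⟨v', a', b', rfl, rfl, rfl, hab⟩
      refine ⟨h, (Nat.le_add_right _ _).trans_lt hI.voter_lt, rfl, by omega,
        _, ((I.ranking v').symm a').2.trans hI.cand_lt, _,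
        ((I.ranking v').symm b').2.trans hI.cand_lt, hab, (hI.voter_iff _ _ _).mpr ?_,
        (hI.voter_iff _ _ _).mpr ?_⟩
      · exact ⟨v', _, rfl, rfl, by simp⟩
      · exact ⟨v', _, rfl, rfl, by simp⟩

/-- The clause that some rank holds `a` certifies that `v` is the row of a voter. Without it the
universal clause could hold vacuously, for instance when there is only one party. -/
theorem computed_alive (hI : Lists I n h rows) (hS : Computed I n h rows 7 S) :
    Computed I n h rows 8 ((define header .alive).run n S) := by
  refine Computed.update (j := .alive) hS fun l hl => ?_
  match l, hl with
  | [v, a], _ =>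
    have hh := hS.header_iff (by decide)
    have he := hS.entry_iff (by decide)
    have hp := hS.party_iff (by decide)
    have hq := hS.isParty_iff (by decide)
    have hpr := hS.pref_iff (by decide)
    simp only [body, params, RelProg.bindVars, Meaning, holds_and, holds_rel, holds_ex, holds_lt,
      holds_all, holds_imp, holds_or, List.map_cons, List.map_nil, Function.update_apply,
      reduceCtorEq, if_true, if_false, hh, he, hp, hq, hpr]
    constructor
    · rintro ⟨_, -, rfl, hv, ⟨i, -, hi⟩, hal⟩
      obtain ⟨u, rfl⟩ := Nat.exists_eq_add_of_le (Nat.succ_le_of_lt hv)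
      obtain ⟨o, r, rfl, rfl, rfl⟩ := (hI.voter_iff _ _ _).mp hi
      refine ⟨o, _, rfl, rfl, fun q hq => ?_⟩
      rcases hal q (q.2.trans hI.numParties_lt) q.2 with ⟨a', ha, hq'⟩ |
        ⟨_, -, ⟨b, rfl, hb⟩, v', a', b', hv', ha', hb', h'⟩
      · obtain rfl := Fin.ext ha
        exact absurd (Fin.ext hq').symm hq
      · obtain rfl := Fin.ext ha'
        obtain rfl := Fin.ext hb'
        obtain rfl : v' = o := Fin.ext (by omega)
        exact ⟨b', Fin.ext hb, h'⟩
    · rintro ⟨v', a', rfl, rfl, hal⟩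
      refine ⟨h, (Nat.le_add_right _ _).trans_lt hI.voter_lt, rfl, by omega,
        ⟨_, ((I.ranking v').symm a').2.trans hI.cand_lt, (hI.voter_iff _ _ _).mpr
          ⟨v', _, rfl, rfl, by simp⟩⟩, fun q _ hq => ?_⟩
      by_cases hqa : (I.party a' : ℕ) = q
      · exact Or.inl ⟨a', rfl, hqa⟩
      · obtain ⟨b, hb, hab⟩ := hal ⟨q, hq⟩ (fun e => hqa (congrArg Fin.val e.symm))
        exact Or.inr ⟨b, b.2.trans hI.cand_lt, ⟨b, rfl, congrArg Fin.val hb⟩, v', a',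
          b, rfl, rfl, rfl, hab⟩

theorem computed_dep (hI : Lists I n h rows) (hS : Computed I n h rows 8 S) :
    Computed I n h rows 9 ((define header .dep).run n S) := by
  refine Computed.update (j := .dep) hS fun l hl => ?_
  match l, hl with
  | [p, q], _ =>
    have hp := hS.party_iff (by decide)
    have hpr := hS.pref_iff (by decide)
    have hal := hS.alive_iff (by decide)
    simp only [body, params, RelProg.bindVars, Meaning, holds_and, holds_rel, holds_ex, holds_neg,
      holds_eq, List.map_cons, List.map_nil, Function.update_apply,
      reduceCtorEq, if_true, if_false, hp, hpr, hal]
    constructor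
    · rintro ⟨_, -, _, -, _, -, ⟨a, rfl, rfl⟩, ⟨b, rfl, rfl⟩, hne, ⟨v, a', rfl, ha, hv⟩,
        v', b', a'', hv', hb', ha'', hpref⟩
      obtain rfl := Fin.ext ha
      obtain rfl := Fin.ext ha''
      obtain rfl := Fin.ext hb'
      obtain rfl : v' = v := Fin.ext (by omega)
      exact ⟨_, _, rfl, rfl, v', a'', b', rfl, rfl, fun e => hne (congrArg Fin.val e), hv, hpref⟩
    · rintro ⟨p', q', rfl, rfl, v, a, b, rfl, rfl, hne, hv, hpref⟩
      have h₁ := hI.voter_lt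
      have h₂ := v.2
      exact ⟨h + 1 + v, by omega, a, a.2.trans hI.cand_lt, b, b.2.trans hI.cand_lt, ⟨a, rfl, rfl⟩,
        ⟨b, rfl, rfl⟩, fun e => hne (Fin.ext e), ⟨v, a, rfl, rfl, hv⟩, v, b, a,
        rfl, rfl, rfl, hpref⟩

theorem computed_adj (hS : Computed I n h rows 9 S) :
    Computed I n h rows 10 ((define header .adj).run n S) := by
  refine Computed.update (j := .adj) hS fun l hl => ?_
  match l, hl with
  | [p, q], _ =>
    have hd := hS.dep_iff (by decide)
    simp only [body, params, RelProg.bindVars, Meaning, holds_rel, holds_or, List.map_cons,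
      List.map_nil, Function.update_apply, reduceCtorEq, if_true, if_false, hd]
    constructor
    · rintro (⟨p', q', rfl, rfl, hpq⟩ | ⟨p', q', rfl, rfl, hpq⟩)
      · exact ⟨_, _, rfl, rfl, Or.inl hpq⟩
      · exact ⟨_, _, rfl, rfl, Or.inr hpq⟩
    · rintro ⟨p', q', rfl, rfl, hpq | hpq⟩
      · exact Or.inl ⟨_, _, rfl, rfl, hpq⟩
      · exact Or.inr ⟨_, _, rfl, rfl, hpq⟩

theorem computed_vote (hS : Computed I n h rows 10 S) :
    Computed I n h rows 11 ((define header .vote).run n S) := by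
  refine Computed.update (j := .vote) hS fun l hl => ?_
  match l, hl with
  | [l, a, r, v], _ =>
    have hc := hS.cand_iff (by decide)
    have hpr := hS.pref_iff (by decide)
    have hal := hS.alive_iff (by decide)
    have key : ∀ (v : Fin I.numVoters) (a : Fin I.numCandidates) (b : ℕ),
        (b < I.numCandidates → S .pref [h + 1 + v, a, b]) ↔
          ∀ b', obj I.numCandidates b = some b' → I.election.prefers v a b' := by
      intro v a b
      constructor
      · intro H b' hb
        rw [obj_eq_some] at hb
        subst hb
        obtain ⟨v', a', b'', hv', ha', hb', hab⟩ := (hpr _ _ _).mp (H b'.2)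
        obtain rfl := Fin.ext ha'
        obtain rfl := Fin.ext hb'
        obtain rfl : v' = v := Fin.ext (by omega)
        exact hab
      · intro H hb
        exact (hpr _ _ _).mpr ⟨v, a, ⟨b, hb⟩, rfl, rfl, rfl, H _ (obj_eq_some.mpr rfl)⟩
    simp only [body, params, RelProg.bindVars, Meaning, holds_rel, holds_and, holds_imp,
      List.map_cons, List.map_nil, Function.update_apply, reduceCtorEq, if_true, if_false, hc, hal]
    constructor
    · rintro ⟨⟨v', a', rfl, rfl, hv⟩, h₁, h₂⟩
      exact ⟨v', a', rfl, rfl, hv, (key _ _ _).mp h₁, (key _ _ _).mp h₂⟩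
    · rintro ⟨v', a', rfl, rfl, hv, h₁, h₂⟩
      exact ⟨⟨v', a', rfl, rfl, hv⟩, (key _ _ _).mpr h₁, (key _ _ _).mpr h₂⟩

open Classical in
theorem count_lt_eq_min (n m : ℕ) : Nat.count (fun a => a < m) n = min n m := by
  induction n with
  | zero => simp
  | succ n ih =>
    rw [Nat.count_succ, ih]
    split_ifs <;> omega

open Classical in
theorem count_shift_eq_card {N n t : ℕ} (h : t + N ≤ n) (F : Fin N → Prop) :
    Nat.count (fun a => ∃ v : Fin N, t + (v : ℕ) = a ∧ F v) n =
      (Finset.univ.filter F).card := by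
  rw [Nat.count_eq_card_filter_range]
  symm
  apply Finset.card_bij fun (v : Fin N) _ => t + (v : ℕ)
  · intro v hv
    simp only [Finset.mem_filter, Finset.mem_univ, true_and, Finset.mem_range] at hv ⊢
    exact ⟨by omega, v, rfl, hv⟩
  · intro v _ v' _ e
    exact Fin.ext (by omega)
  · intro a ha
    simp only [Finset.mem_filter, Finset.mem_range] at ha
    obtain ⟨-, v, rfl, hv⟩ := ha
    exact ⟨v, by simpa using hv, rfl⟩

/-- Two opposite comparisons equate the number of votes with the size of `{v < m}`, which within the
range is `min n m`. As there are fewer than `n` voters, the minimum can only be attained by `m`. -/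
theorem computed_score (hI : Lists I n h rows) (hS : Computed I n h rows 11 S) :
    Computed I n h rows 12 ((define header .score).run n S) := by
  classical
  refine Computed.update (j := .score) hS fun l hl => ?_
  match l, hl with
  | [l, a, r, m], _ =>
    have hc := hS.cand_iff (by decide)
    have hv := hS.vote_iff (by decide)
    have hcount : ∀ a : Fin I.numCandidates, Nat.count (fun v => S .vote [l, a, r, v]) n =
        I.election.localScore (obj _ l) a (obj _ r) := by
      intro a
      rw [Election.localScore, ← count_shift_eq_card (t := h + 1) (n := n)
        (by have := hI.voter_lt; omega)]
      congr! 2 with v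
      rw [hv]
      constructor
      · rintro ⟨v', a', rfl, ha, H⟩
        obtain rfl := Fin.ext ha
        exact ⟨v', rfl, H⟩
      · rintro ⟨v', rfl, H⟩
        exact ⟨v', a, rfl, rfl, H⟩
    have hle : ∀ a : Fin I.numCandidates, I.election.localScore (obj _ l) a (obj _ r) < n := by
      intro a
      have h₁ := I.election.localScore_le (obj _ l) a (obj _ r)
      have h₂ := hI.voter_lt
      rw [Fintype.card_fin] at h₁
      omega
    simp only [body, params, RelProg.bindVars, Meaning, holds_and, Holds,
      List.map_cons, List.map_nil, Function.update_apply, reduceCtorEq, if_true, if_false, hc,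
      count_lt_eq_min]
    constructor
    · rintro ⟨ha, h₁, h₂⟩
      refine ⟨⟨a, ha⟩, rfl, ?_⟩
      have h₃ := hcount ⟨a, ha⟩
      have h₄ := hle ⟨a, ha⟩
      simp only at h₃
      rw [h₃] at h₁ h₂
      omega
    · rintro ⟨a, rfl, rfl⟩
      have h₄ := hle a
      rw [hcount]
      exact ⟨a.2, by omega, by omega⟩

end EquilibriumProg

/-! ### Correctness of the dynamic programming relations -/

namespace EquilibriumProg

open CountFormula

variable {I : Instance} {n h : ℕ} {rows : List (List ℕ)} {S : Sym → List ℕ → Prop}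
  {header : CountFormula Name Sym}

theorem Computed.party_obj_iff {t : ℕ} (hS : Computed I n h rows t S) (ht : 3 < t) (a : ℕ)
    (p : Fin I.numParties) :
    S .party [a, p] ↔ ∃ o, obj _ a = some o ∧ I.election.party o = p := by
  simp only [hS.party_iff ht, obj_eq_some, ← Fin.ext_iff]
  rfl

theorem Computed.not_cand_iff {t : ℕ} (hS : Computed I n h rows t S) (ht : 4 < t) (a : ℕ) :
    ¬ S .cand [a] ↔ obj I.numCandidates a = none := by
  rw [hS.cand_iff ht, obj_eq_none, not_lt]

theorem computed_follows (hI : Lists I n h rows) (hS : Computed I n h rows 12 S) :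
    Computed I n h rows 13 ((define header .follows).run n S) := by
  refine Computed.update (j := .follows) hS fun l hl => ?_
  match l, hl with
  | [b, c, d], _ =>
    have hp := hS.party_obj_iff (by decide)
    have hc := hS.not_cand_iff (by decide)
    have ha := hS.adj_iff (by decide)
    simp only [body, params, RelProg.bindVars, Meaning, holds_and, holds_rel, holds_ex, holds_neg,
      holds_all, holds_imp, holds_or, List.map_cons, List.map_nil, Function.update_apply,
      reduceCtorEq, if_true, if_false, hc]
    rw [← not_not (a := S .cand [c]), hc]
    rcases hc' : obj I.numCandidates c with _ | c'
    · simp [Election.MayFollow]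
    · obtain rfl := obj_eq_some.mp hc'
      have hlt := fun p : Fin I.numParties => p.2.trans hI.numParties_lt
      simp only [reduceCtorEq, not_false_eq_true, true_and, false_and, false_or,
        Election.MayFollow]
      refine or_congr (and_congr_right fun _ => ?_) ?_
      · constructor
        · intro H q hq
          exact (hp b q).mp (H _ (hlt _) q (hlt q) ((hp _ _).mpr ⟨c', hc', rfl⟩)
            ((ha _ _).mpr ⟨_, _, rfl, rfl, hq⟩))
        · intro H p _ q _ hcp hpq
          obtain ⟨p, q, rfl, rfl, hadj⟩ := (ha _ _).mp hpq
          obtain ⟨o, ho, rfl⟩ := (hp _ _).mp hcp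
          rw [hc', Option.some.injEq] at ho
          subst ho
          exact (hp _ _).mpr (H q hadj)
      · constructor
        · rintro ⟨p, -, q, -, hcp, hdq, hpq, hbq⟩
          obtain ⟨p, q, rfl, rfl, hadj⟩ := (ha _ _).mp hpq
          obtain ⟨o, ho, rfl⟩ := (hp _ _).mp hcp
          rw [hc', Option.some.injEq] at ho
          subst ho
          obtain ⟨d', hd, rfl⟩ := (hp _ _).mp hdq
          exact ⟨d', hd, hadj, fun b' hb' hb => hbq ((hp _ _).mpr ⟨b', hb', hb⟩)⟩
        · rintro ⟨d', hd, hpq, hb⟩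
          refine ⟨_, hlt _, _, hlt _, (hp _ _).mpr ⟨c', hc', rfl⟩, (hp _ _).mpr ⟨d', hd, rfl⟩,
            (ha _ _).mpr ⟨_, _, rfl, rfl, hpq⟩, fun H => ?_⟩
          obtain ⟨b', hb', H⟩ := (hp _ _).mp H
          exact hb b' hb' H

/-- The score relation is the graph of a function with values below `n`, so a quantified score can
be replaced by the function value. -/
theorem Computed.exists_score_iff {t : ℕ} (hS : Computed I n h rows t S) (ht : 11 < t)
    (hI : Lists I n h rows) (l a r : ℕ) (F : ℕ → Prop) :
    (∃ s < n, S .score [l, a, r, s] ∧ F s) ↔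
      ∃ o, obj _ a = some o ∧ F (I.election.localScore (obj _ l) o (obj _ r)) := by
  simp only [hS.score_iff ht, obj_eq_some]
  constructor
  · rintro ⟨s, -, ⟨o, rfl, rfl⟩, hs⟩
    exact ⟨o, rfl, hs⟩
  · rintro ⟨o, rfl, hs⟩
    have h₁ := I.election.localScore_le (obj _ l) o (obj _ r)
    have h₂ := hI.voter_lt
    rw [Fintype.card_fin] at h₁
    exact ⟨_, by omega, ⟨o, rfl, rfl⟩, hs⟩

theorem Computed.beats_iff {t : ℕ} (hS : Computed I n h rows t S) (ht : 3 < t)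
    (x : Fin I.numParties) (m b : ℕ) (c : Fin I.numCandidates) (d s : ℕ) :
    (¬ S .party [c, x] ∧ ¬ S .party [b, x] ∧ ¬ S .party [d, x] ∧ s < m) ↔
      I.election.BeatsFromAfar x m (obj _ b) c (obj _ d) s := by
  simp only [hS.party_obj_iff ht, Election.BeatsFromAfar, obj_val, Option.some.injEq,
    exists_eq_left', not_exists, not_and, ne_eq, eq_comm (a := x)]

/-- Once scores are substituted, the formula agrees with `GoodWindow` clause by clause; the bound
variable `p` only expresses that `z` and `c` belong to the same party. -/
theorem computed_window (hI : Lists I n h rows) (hS : Computed I n h rows 13 S) :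
    Computed I n h rows 14 ((define header .window).run n S) := by
  refine Computed.update (j := .window) hS fun l hl => ?_
  match l, hl with
  | [w, m, x, k, y, l, a, b, c, d, e], _ =>
    have hs := hS.exists_score_iff (by decide) hI
    have hp := hS.party_obj_iff (by decide)
    have hq := hS.isParty_iff (by decide)
    have hb := hS.beats_iff (by decide)
    have hlt := fun p : Fin I.numParties => p.2.trans hI.numParties_lt
    simp only [body, beats, params, RelProg.bindVars, Meaning, holds_and, holds_rel, holds_neg,
      holds_ex, holds_or, holds_imp, holds_all, holds_eq, holds_lt, List.map_cons, List.map_nil,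
      Function.update_apply, reduceCtorEq, if_true, if_false, hs]
    have key : ∀ (w x y : Fin I.numParties) (c : Fin I.numCandidates), obj _ (c : ℕ) = some c →
      ((¬m < I.election.localScore (obj _ b) c (obj _ d) ∧
        (S .party [c, w] → I.election.localScore (obj _ b) c (obj _ d) = m) ∧
        (S .party [c, x] → I.election.localScore (obj _ b) c (obj _ d) = k) ∧
        (S .party [c, y] → I.election.localScore (obj _ b) c (obj _ d) = l) ∧
        (I.election.localScore (obj _ b) c (obj _ d) = m ∨ ∀ z < n, ∀ p < n, S .party [c, p] →
          S .party [z, p] → ∃ o, obj I.numCandidates z = some o ∧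
            ((∃ o', obj I.numCandidates b = some o' ∧ I.election.localScore (obj _ b) o (obj _ d) <
                I.election.localScore (obj _ a) o' (obj _ z)) ∨
              (∃ o', obj I.numCandidates d = some o' ∧
                I.election.localScore (obj _ b) o (obj _ d) <
                I.election.localScore (obj _ z) o' (obj _ e)) ∨
              (¬ S .party [c, w] ∧ ¬ S .party [b, w] ∧ ¬ S .party [d, w] ∧
                I.election.localScore (obj _ b) o (obj _ d) < m) ∨
              (¬ S .party [c, x] ∧ ¬ S .party [b, x] ∧ ¬ S .party [d, x] ∧
                I.election.localScore (obj _ b) o (obj _ d) < k) ∨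
              (¬ S .party [c, y] ∧ ¬ S .party [b, y] ∧ ¬ S .party [d, y] ∧
                I.election.localScore (obj _ b) o (obj _ d) < l)))) ↔
        I.election.GoodWindow w m x k y l (obj _ a) (obj _ b) c (obj _ d) (obj _ e)) := by
      intro w x y c _
      simp only [hb]
      have hpc : ∀ p : Fin I.numParties, S .party [c, p] ↔ I.election.party c = p := by
        simp [hp]
      simp only [hpc, not_lt, Election.GoodWindow]
      refine and_congr_right fun _ => and_congr_right fun _ => and_congr_right fun _ =>
        and_congr_right fun _ => or_congr_right ⟨fun H c' hc' => ?_, fun H z _ p _ h₁ h₂ => ?_⟩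
      · obtain ⟨o, ho, H⟩ := H c' (c'.2.trans hI.cand_lt) _ (hlt _) ((hpc _).mpr rfl)
          ((hp _ _).mpr ⟨c', obj_val c', hc'⟩)
        rw [obj_val, Option.some.injEq] at ho
        subst ho
        simpa only [obj_val] using H
      · obtain ⟨c', rfl, rfl⟩ := (hS.party_iff (by decide) _ _).mp h₂
        refine ⟨c', obj_val c', ?_⟩
        simpa only [obj_val] using H c' ((hpc _).mp h₁).symm
    constructor
    · rintro ⟨hw, hx, hy, o, ho, H⟩
      obtain ⟨w, rfl⟩ : ∃ w' : Fin I.numParties, (w' : ℕ) = w := ⟨⟨w, (hq w).mp hw⟩, rfl⟩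
      obtain ⟨x, rfl⟩ : ∃ x' : Fin I.numParties, (x' : ℕ) = x := ⟨⟨x, (hq x).mp hx⟩, rfl⟩
      obtain ⟨y, rfl⟩ : ∃ y' : Fin I.numParties, (y' : ℕ) = y := ⟨⟨y, (hq y).mp hy⟩, rfl⟩
      obtain rfl := obj_eq_some.mp ho
      exact ⟨w, x, y, o, rfl, rfl, rfl, rfl, (key w x y o ho).mp H⟩
    · rintro ⟨w, x, y, o, rfl, rfl, rfl, rfl, H⟩
      exact ⟨(hq _).mpr w.2, (hq _).mpr x.2, (hq _).mpr y.2, o, obj_val o,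
        (key w x y o (obj_val o)).mpr H⟩

/-- The continuation relation after `t` rounds. -/
def ContComputed (I : Instance) (t : ℕ) (S : Sym → List ℕ → Prop) : Prop :=
  ∀ w m x k y l a b c d, S .cont [w, m, x, k, y, l, a, b, c, d] ↔
    ∃ w' x' y' : Fin I.numParties, (w' : ℕ) = w ∧ (x' : ℕ) = x ∧ (y' : ℕ) = y ∧
      I.election.Continues w' m x' k y' l t (obj _ a) (obj _ b) (obj _ c) (obj _ d)

theorem Computed.update_cont (hS : Computed I n h rows 14 S) (f : List ℕ → Prop) :
    Computed I n h rows 14 (Function.update S .cont f) := by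
  intro j hj
  rw [Function.update_of_ne]
  · exact hS j hj
  · rintro rfl
    exact absurd hj (by decide)

/-- The formula mirrors the recursion of `Continues`, and quantifying over numbers below `n` loses
nothing because every optional candidate has a code there. -/
theorem contComputed_succ (hI : Lists I n h rows) (hS : Computed I n h rows 14 S) {t : ℕ}
    (hc : ContComputed I t S) : ContComputed I (t + 1) ((define header .cont).run n S) := by
  intro w m x k y l a b c d
  have hq := hS.isParty_iff (by decide)
  have hn := hS.not_cand_iff (by decide)
  have hf := hS.follows_iff (by decide)
  have hw := hS.window_iff (by decide)
  simp only [define, RelProg.run, Function.update_self]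
  simp only [body, params, RelProg.bindVars, holds_and, holds_rel, holds_neg,
    holds_ex, holds_or, List.map_cons, List.map_nil,
    Function.update_apply, reduceCtorEq, if_true, if_false, hn, hf]
  constructor
  · rintro ⟨hw', hx', hy', H⟩
    rcases H with H | ⟨e, -, h₁, h₂, h₃⟩
    · refine ⟨⟨w, (hq w).mp hw'⟩, ⟨x, (hq x).mp hx'⟩, ⟨y, (hq y).mp hy'⟩, rfl, rfl, rfl, ?_⟩
      rw [H]
      trivial
    · obtain ⟨w', x', y', c', rfl, rfl, rfl, rfl, hwin⟩ := (hw _ _ _ _ _ _ _ _ _ _ _).mp h₂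
      obtain ⟨w'', x'', y'', e₁, e₂, e₃, hcont⟩ := (hc _ _ _ _ _ _ _ _ _ _).mp h₃
      obtain rfl := Fin.ext e₁
      obtain rfl := Fin.ext e₂
      obtain rfl := Fin.ext e₃
      rw [obj_val] at h₁ hcont
      refine ⟨w'', x'', y'', rfl, rfl, rfl, ?_⟩
      rw [obj_val]
      exact ⟨_, h₁, hwin, hcont⟩
  · rintro ⟨w, x, y, rfl, rfl, rfl, H⟩
    refine ⟨(hq _).mpr w.2, (hq _).mpr x.2, (hq _).mpr y.2, ?_⟩
    rcases hc' : obj I.numCandidates c with _ | c'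
    · exact Or.inl rfl
    · obtain rfl := obj_eq_some.mp hc'
      rw [hc'] at H
      obtain ⟨o, h₁, h₂, h₃⟩ := H
      obtain ⟨e, he, rfl⟩ := exists_obj_eq hI.cand_lt o
      refine Or.inr ⟨e, he, h₁, (hw _ _ _ _ _ _ _ _ _ _ _).mpr
        ⟨w, x, y, c', rfl, rfl, rfl, rfl, h₂⟩, (hc _ _ _ _ _ _ _ _ _ _).mpr
        ⟨w, x, y, rfl, rfl, rfl, ?_⟩⟩
      rwa [hc']

/-- The empty relation is `Continues` at zero, and each of the `n` rounds raises the counter by one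
without touching the relations of lower rank. -/
theorem computed_cont (hI : Lists I n h rows) (hS : Computed I n h rows 14 S)
    (h₀ : ∀ l, ¬ S .cont l) :
    Computed I n h rows 15 ((RelProg.rep (define header .cont)).run n S) := by
  have key : ∀ t, Computed I n h rows 14 (((define header .cont).run n)^[t] S) ∧
      ContComputed I t (((define header .cont).run n)^[t] S) := by
    intro t
    induction t with
    | zero =>
      refine ⟨hS, fun w m x k y l a b c d => ⟨fun H => absurd H (h₀ _), ?_⟩⟩
      rintro ⟨_, _, _, _, _, _, H⟩
      exact H.elim
    | succ t ih =>
      rw [Function.iterate_succ_apply']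
      exact ⟨ih.1.update_cont _, contComputed_succ hI ih.1 ih.2⟩
  obtain ⟨h₁, h₂⟩ := key n
  intro j hj l hl
  by_cases hjc : j = .cont
  · subst hjc
    match l, hl with
    | [w, m, x, k, y, l, a, b, c, d], _ => exact h₂ w m x k y l a b c d
  · have : rank j ≠ rank .cont := fun e => hjc (rank_injective e)
    exact h₁ j (lt_of_le_of_ne (Nat.le_of_lt_succ hj) this) l hl

/-- A number `z` that is no candidate stands for the missing predecessors at the start of a path. -/
theorem computed_ok (hI : Lists I n h rows) (hS : Computed I n h rows 15 S) :
    Computed I n h rows 16 ((define header .ok).run n S) := by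
  refine Computed.update (j := .ok) hS fun l hl => ?_
  match l, hl with
  | [w], _ =>
    have hp := hS.party_iff (by decide)
    have hn := hS.not_cand_iff (by decide)
    have hq := hS.isParty_iff (by decide)
    have ha := hS.adj_iff (by decide)
    have hf := hS.follows_iff (by decide)
    have hc := hS.cont_iff (by decide)
    have hlt := fun p : Fin I.numParties => p.2.trans hI.numParties_lt
    simp only [body, params, RelProg.bindVars, Meaning, holds_and, holds_rel, holds_neg,
      holds_ex, holds_imp, holds_all, holds_eq, List.map_cons, List.map_nil,
      Function.update_apply, reduceCtorEq, if_true, if_false, hn, hq, hf]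
    have hend : ∀ p : Fin I.numParties, (∀ q < n, ∀ r < n, S .adj [p, q] → S .adj [p, r] → q = r) ↔
        I.election.IsEndpoint p := by
      intro p
      constructor
      · intro H q q' h₁ h₂
        exact Fin.ext (H q (hlt q) q' (hlt q') ((ha _ _).mpr ⟨_, _, rfl, rfl, h₁⟩)
          ((ha _ _).mpr ⟨_, _, rfl, rfl, h₂⟩))
      · intro H q _ r _ h₁ h₂
        obtain ⟨p₁, q, e₁, rfl, hadj₁⟩ := (ha _ _).mp h₁
        obtain ⟨p₂, r, e₂, rfl, hadj₂⟩ := (ha _ _).mp h₂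
        obtain rfl := Fin.ext e₁
        obtain rfl := Fin.ext e₂
        rw [H q r hadj₁ hadj₂]
    constructor
    · rintro ⟨hw, m, hm, x, -, hx, k, hk, y, -, hy, l, hl, H⟩
      refine ⟨⟨w, hw⟩, rfl, m, hm, ⟨x, hx⟩, k, hk, ⟨y, hy⟩, l, hl, fun p hend' => ?_⟩
      obtain ⟨c, -, d, -, hcp, z, -, hz, h₁, h₂⟩ := H p (hlt p) p.2 ((hend p).mpr hend')
      obtain ⟨c, rfl, e⟩ := (hp _ _).mp hcp
      obtain ⟨w', x', y', rfl, rfl, rfl, hcont⟩ := (hc _ _ _ _ _ _ _ _ _ _).mp h₂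
      rw [hz, obj_val] at h₁ hcont
      exact ⟨c, _, Fin.ext e, h₁, hcont⟩
    · rintro ⟨w, rfl, m, hm, x, k, hk, y, l, hl, H⟩
      refine ⟨w.2, m, hm, x, hlt x, x.2, k, hk, y, hlt y, y.2, l, hl, fun p _ hp' hend' => ?_⟩
      obtain ⟨c, d', e, h₁, h₂⟩ := H ⟨p, hp'⟩ ((hend ⟨p, hp'⟩).mp hend')
      obtain ⟨d, hd, rfl⟩ := exists_obj_eq hI.cand_lt d'
      have hz : obj I.numCandidates I.numCandidates = none := obj_eq_none.mpr le_rfl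
      refine ⟨c, c.2.trans hI.cand_lt, d, hd, (hp _ _).mpr ⟨c, rfl, congrArg Fin.val e⟩,
        _, hI.cand_lt, hz, ?_, (hc _ _ _ _ _ _ _ _ _ _).mpr ⟨w, x, y, rfl, rfl, rfl, ?_⟩⟩
      · rwa [hz, obj_val]
      · rwa [hz, obj_val]

theorem computed_program (hI : Lists I n h rows) (hh : ∀ S ρ, header.Holds n S ρ ↔ ρ .r = h) :
    Computed I n h rows 16
      ((program header).run n (Function.update (fun _ _ => False) .table (tableLe rows))) := by
  have h₀ : Computed I n h rows 1 (Function.update (fun _ _ => False) .table (tableLe rows)) := by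
    intro j hj l _
    have : j = .table := rank_injective (Nat.lt_one_iff.mp hj)
    subst this
    rw [Function.update_self]
    rfl
  refine computed_ok hI (computed_cont hI (Computed.update_cont (computed_window hI
    (computed_follows hI (computed_score hI (computed_vote (computed_adj (computed_dep hI
    (computed_alive hI (computed_pref hI (computed_isParty hI (computed_cand hI
    (computed_party hI (computed_entry hI (computed_header hh h₀))))))))))))) _) fun l => ?_)
  simp only [RelProg.run, Function.update_self]
  exact lt_irrefl _

end EquilibriumProg

/-! ### Encodings as lists of rows, and their lengths -/

namespace Instance

/-- The lists of numbers that make up the encoding of an instance. -/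
def rows (I : Instance) : List (List ℕ) :=
  (List.ofFn fun a => (I.party a : ℕ)) ::
    List.ofFn fun v => List.ofFn fun r => (I.ranking v r : ℕ)

theorem encode_eq (I : Instance) : I.encode = I.rows.flatMap encodeNatList := by
  simp [encode, rows, List.flatMap_def, List.map_ofFn, Function.comp_def]

end Instance

theorem length_lt_length_encodeNatList (l : List ℕ) : l.length < (encodeNatList l).length := by
  unfold encodeNatList
  induction l with
  | nil => simp
  | cons x l ih =>
    simp only [List.flatMap_cons, List.length_append, List.length_map, List.length_cons,
      List.length_nil] at ih ⊢
    omega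

theorem length_le_length_flatMap_encodeNatList (rows : List (List ℕ)) :
    rows.length ≤ (rows.flatMap encodeNatList).length := by
  induction rows with
  | nil => simp
  | cons r rows ih =>
    have := length_lt_length_encodeNatList r
    simp only [List.flatMap_cons, List.length_append, List.length_cons]
    omega

/-! ### The two decision problems -/

namespace EquilibriumProg

open CountFormula

/-- Every candidate contributes a comma to the row of the parties, and every list a semicolon; the
semicolon of the party row makes the inequality strict. Hence all numbers in use, and one code for
absence, lie below the input length. -/
theorem length_encode_ge (I : Instance) (pre : List (List ℕ)) :
    pre.length + I.numCandidates + I.numVoters <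
      ((pre ++ I.rows).flatMap encodeNatList).length := by
  have h₁ := length_le_length_flatMap_encodeNatList pre
  have h₂ := length_lt_length_encodeNatList (List.ofFn fun a => (I.party a : ℕ))
  have h₃ := length_le_length_flatMap_encodeNatList
    (List.ofFn fun v => List.ofFn fun r => (I.ranking v r : ℕ))
  simp only [List.length_ofFn] at h₂ h₃
  simp only [Instance.rows, List.flatMap_append, List.flatMap_cons, List.length_append]
  omega

theorem numParties_le (I : Instance) : I.numParties ≤ I.numCandidates := by
  simpa using Fintype.card_le_of_surjective _ I.party_surjective

theorem lt_of_mem_rows {I : Instance} {r : List ℕ} (hr : r ∈ I.rows) {x : ℕ} (hx : x ∈ r) :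
    x < I.numCandidates := by
  simp only [Instance.rows, List.mem_cons, List.mem_ofFn] at hr
  rcases hr with rfl | ⟨v, rfl⟩
  · obtain ⟨a, rfl⟩ := (List.mem_ofFn' _ _).mp hx
    exact (I.party a).2.trans_le (numParties_le I)
  · obtain ⟨a, rfl⟩ := (List.mem_ofFn' _ _).mp hx
    exact (I.ranking v a).2

theorem getElem?_ofFn_eq_some {α : Type*} {N i : ℕ} {f : Fin N → α} {x : α} :
    (List.ofFn f)[i]? = some x ↔ ∃ o : Fin N, (o : ℕ) = i ∧ f o = x := by
  rw [List.getElem?_ofFn]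
  split_ifs with hi
  · simp only [Option.some.injEq]
    constructor
    · exact fun hx => ⟨⟨i, hi⟩, rfl, hx⟩
    · rintro ⟨o, rfl, rfl⟩
      rfl
  · simp only [false_iff]
    rintro ⟨o, rfl, -⟩
    exact hi o.2

theorem lists_append_rows (I : Instance) (pre : List (List ℕ)) {n : ℕ}
    (hn : n = ((pre ++ I.rows).flatMap encodeNatList).length)
    (hlt : ∀ r ∈ pre ++ I.rows, ∀ x ∈ r, x < n) : Lists I n pre.length (pre ++ I.rows) := by
  have hlen := length_encode_ge I pre
  rw [← hn] at hlen
  refine ⟨by omega, by omega, fun x y z hz => ?_, fun a p => ?_, fun u i a => ?_⟩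
  · obtain ⟨r, hr, hz⟩ := Option.bind_eq_some_iff.mp hz
    exact hlt r (List.mem_of_getElem? hr) z (List.mem_of_getElem? hz)
  · rw [List.getElem?_append_right le_rfl, Nat.sub_self]
    simp only [Instance.rows, List.getElem?_cons_zero, Option.bind_some, getElem?_ofFn_eq_some]
  · rw [List.getElem?_append_right (by omega),
      show pre.length + 1 + u - pre.length = u + 1 by omega]
    simp only [Instance.rows, List.getElem?_cons_succ, Option.bind_eq_some_iff,
      getElem?_ofFn_eq_some]
    constructor
    · rintro ⟨_, ⟨o, rfl, rfl⟩, hi⟩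
      obtain ⟨r, rfl, rfl⟩ := getElem?_ofFn_eq_some.mp hi
      exact ⟨o, r, rfl, rfl, rfl⟩
    · rintro ⟨o, r, rfl, rfl, rfl⟩
      exact ⟨_, ⟨o, rfl, rfl⟩, getElem?_ofFn_eq_some.mpr ⟨r, rfl, rfl⟩⟩

/-- The first row lists the parties. -/
def firstRow : CountFormula Name Sym := .neg (.ex .y (.lt .y .r))

/-- The second row lists the parties. -/
def secondRow : CountFormula Name Sym :=
  .and (.ex .y (.lt .y .r)) (.neg (.ex .y (.and (.lt .y .r) (.ex .z (.lt .z .y)))))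

theorem holds_firstRow {n : ℕ} (hn : 0 < n) (S : Sym → List ℕ → Prop) (ρ : Name → ℕ) :
    firstRow.Holds n S ρ ↔ ρ .r = 0 := by
  simp only [firstRow, holds_neg, holds_ex, holds_lt, Function.update_apply, reduceCtorEq, if_true,
    if_false]
  constructor
  · intro H
    by_contra hr
    exact H ⟨0, hn, Nat.pos_of_ne_zero hr⟩
  · rintro hr ⟨a, -, ha⟩
    omega

theorem holds_secondRow {n : ℕ} (hn : 1 < n) (S : Sym → List ℕ → Prop) (ρ : Name → ℕ) :
    secondRow.Holds n S ρ ↔ ρ .r = 1 := by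
  simp only [secondRow, holds_and, holds_neg, holds_ex, holds_lt, Function.update_apply,
    reduceCtorEq, if_true, if_false]
  constructor
  · rintro ⟨⟨a, -, ha⟩, H⟩
    by_contra hr
    exact H ⟨1, hn, by omega, 0, by omega, by omega⟩
  · intro hr
    refine ⟨⟨0, by omega, by omega⟩, ?_⟩
    rintro ⟨a, -, ha, b, -, hb⟩
    omega

theorem ok_iff_exists {I : Instance} (hI : I.election.IsPartyAlignedSinglePeaked) {n h : ℕ}
    {rows : List (List ℕ)} (hL : Lists I n h rows) {S : Sym → List ℕ → Prop}
    (hS : Computed I n h rows 16 S) (p : ℕ) :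
    S .ok [p] ↔ ∃ w : Fin I.numParties, (w : ℕ) = p ∧
      ∃ c, I.election.IsNashEquilibrium c ∧ I.election.IsWinner c w := by
  rw [hS.ok_iff (by decide)]
  refine exists_congr fun w => and_congr_right fun _ => ?_
  rw [Election.exists_isNashEquilibrium_isWinner_iff _ hI w (n := n)]
  · have := hL.voter_lt
    rw [Fintype.card_fin]
    omega
  · simpa using hL.numParties_lt

/-- Among finitely many nominees one has the highest score, so with at least one party an
equilibrium exists if and only if some party wins one. Without parties the empty scheme is an
equilibrium that has no winner, which is why the formula has a second disjunct. -/
theorem solvable_equilibriumExistence :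
    SolvableInPolyTime PASPInstance.encode EquilibriumExistence := by
  have hlt : ∀ I : PASPInstance, ∀ r ∈ I.1.rows, ∀ x ∈ r, x < I.encode.length := by
    intro I r hr x hx
    have h₁ := lt_of_mem_rows hr hx
    have h₂ := length_encode_ge I.1 []
    rw [List.nil_append, ← Instance.encode_eq] at h₂
    exact h₁.trans_le (by simp only [PASPInstance.encode]; omega)
  refine RelProg.solvableInPolyTime _ _ (fun I => I.1.rows) (fun I => I.1.encode_eq)
    (fun I => by simp [Instance.rows]) hlt (fun j => (params j).length) Sym.table rfl
    (program firstRow) (wellFormed_program (by simp [firstRow, CountFormula.WellFormed]))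
    (.or (.ex .p (.rel .ok [.p])) (.neg (.ex .p (.rel .isParty [.p]))))
    (by simp [CountFormula.WellFormed, CountFormula.or, params]) fun I => ?_
  have hL : Lists I.1 I.encode.length 0 I.1.rows :=
    lists_append_rows I.1 [] (congrArg List.length I.1.encode_eq) (hlt I)
  have hS := computed_program hL (holds_firstRow ((Nat.zero_le _).trans_lt hL.cand_lt))
  simp only [holds_or, holds_neg, holds_ex, holds_rel, List.map_cons, List.map_nil,
    Function.update_self, ok_iff_exists I.2 hL hS, hS.isParty_iff (by decide)]
  constructor
  · rintro (⟨_, -, w, -, c, hc, -⟩ | H)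
    · exact ⟨c, hc⟩
    · have hempty : IsEmpty (Fin I.1.numParties) :=
        ⟨fun p => H ⟨p, p.2.trans hL.numParties_lt, p.2⟩⟩
      exact ⟨fun p => isEmptyElim p, fun p => isEmptyElim p, fun p => isEmptyElim p⟩
  · rintro ⟨c, hc⟩
    by_cases hp : ∃ p < I.encode.length, p < I.1.numParties
    · obtain ⟨p, -, hp⟩ := hp
      have : Nonempty (Fin I.1.numParties) := ⟨⟨p, hp⟩⟩
      obtain ⟨w, hw⟩ := Finite.exists_max (I.1.election.score c)
      exact Or.inl ⟨w, w.2.trans hL.numParties_lt, w, rfl, c, hc, hw⟩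
    · exact Or.inr hp

/-- The distinguished party occupies row `0` alone, which shifts the row of the parties to `1`.
Formulas have no constants, so `0` is expressed as the number with nothing below it, and the party
is the entry at row and column `0`. -/
theorem solvable_equilibriumPresident :
    SolvableInPolyTime PASPInstanceWithParty.encode EquilibriumPresident := by
  have henc : ∀ J : PASPInstanceWithParty,
      J.encode = ([[(J.2 : ℕ)]] ++ J.1.1.rows).flatMap encodeNatList := by
    intro J
    simp [PASPInstanceWithParty.encode, PASPInstance.encode, Instance.encode_eq]
  have hlt : ∀ J : PASPInstanceWithParty, ∀ r ∈ [[(J.2 : ℕ)]] ++ J.1.1.rows, ∀ x ∈ r,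
      x < J.encode.length := by
    intro J r hr x hx
    have h₁ := length_encode_ge J.1.1 [[(J.2 : ℕ)]]
    rw [← henc] at h₁
    rcases List.mem_append.mp hr with hr | hr
    · obtain rfl := List.mem_singleton.mp hr
      obtain rfl := List.mem_singleton.mp hx
      have h₂ := J.2.2.trans_le (numParties_le J.1.1)
      omega
    · have h₂ := lt_of_mem_rows hr hx
      omega
  refine RelProg.solvableInPolyTime _ _ (fun J => [[(J.2 : ℕ)]] ++ J.1.1.rows) henc
    (fun J => by simp) hlt (fun j => (params j).length) Sym.table rfl
    (program secondRow) (wellFormed_program (by simp [secondRow, CountFormula.WellFormed]))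
    (.ex .p (.and (.rel .ok [.p]) (.ex .z (.and (.neg (.ex .y (.lt .y .z)))
      (.rel .entry [.z, .z, .p])))))
    (by simp [CountFormula.WellFormed, params]) fun J => ?_
  have hL : Lists J.1.1 J.encode.length 1 ([[(J.2 : ℕ)]] ++ J.1.1.rows) :=
    lists_append_rows J.1.1 [[(J.2 : ℕ)]] (congrArg List.length (henc J)) (hlt J)
  have hn : 1 < J.encode.length := (Nat.le_add_right _ _).trans_lt hL.voter_lt
  have hS := computed_program hL (holds_secondRow hn)
  simp only [holds_and, holds_neg, holds_ex, holds_rel, holds_lt, List.map_cons, List.map_nil,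
    Function.update_apply, reduceCtorEq, if_true, if_false, ok_iff_exists J.1.2 hL hS,
    hS.entry_iff (by decide)]
  constructor
  · rintro ⟨_, -, ⟨w, rfl, H⟩, z, -, hz, hw⟩
    obtain rfl : z = 0 := by
      by_contra hne
      exact hz ⟨0, by omega, Nat.pos_of_ne_zero hne⟩
    have : J.2 = w := Fin.ext (by simpa using hw)
    rwa [EquilibriumPresident, this]
  · intro H
    refine ⟨J.2, J.2.2.trans hL.numParties_lt, ⟨J.2, rfl, H⟩, 0, by omega, ?_, by simp⟩
    rintro ⟨_, -, h⟩
    exact absurd h (Nat.not_lt_zero _)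

end EquilibriumProg

theorem mainTheorem1 :
    SolvableInPolyTime PASPInstance.encode EquilibriumExistence ∧
      SolvableInPolyTime PASPInstanceWithParty.encode EquilibriumPresident :=
  ⟨EquilibriumProg.solvable_equilibriumExistence, EquilibriumProg.solvable_equilibriumPresident⟩
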